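/- All graphs are finite and simple, and induced subgraphs are identified with their vertex sets. $N(v)=N_G(v)$ is the set of neighbors of $v$ in $G$, and $N[X]$ is $X$ together with all vertices that have a neighbor in $X$. A path in $G$ is an induced subgraph that is a path; the interior $P^*$ of a path $P$ is $P$ minus its ends; the length of a path or cycle is its number of edges. A hole is an induced cycle of length at least four. Two disjoint sets are complete (anticomplete) to each other if all (none) of the edges between them are present. A theta consists of three paths between the same two ends, each of length at least $2$, with pairwise disjoint and anticomplete interiors. A near-prism consists of two triangles $\{a_1,a_2,a_3\}$, $\{b_1,b_2,b_3\}$ and three paths $P_i$ from $a_i$ to $b_i$ (possibly of length $0$) such that $P_i\cup P_j$ is a hole for all distinct $i,j$; it is a prism if the two triangles are disjoint. An extended near-prism is obtained from a near-prism by adding an edge $uv$, its cross-edge, with $u\in P_i^*$ and $v\in P_j^*$ for some distinct $i,j$. A pyramid with apex $a$, base $b_1b_2b_3$ and paths $P_1,P_2,P_3$ consists of a vertex $a$, a triangle $\{b_1,b_2,b_3\}$ and paths $P_i$ from $a$ to $b_i$ such that $P_i\cup P_j$ is a hole for all distinct $i,j$. A wheel $(H,x)$ is a hole $H$ with a vertex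 $x$ that has at least three neighbors in $H$; it is even if $|N(x)\cap H|$ is even, and proper if $N(x)\cap H$ contains a stable set of size three. All these configurations are considered in $G$ as induced subgraphs. Let $\mathcal C$ be the class of graphs with no $C_4$, theta, prism or even wheel ("$C_4$-free odd-signable graphs"). A loaded pyramid is a pyramid (with $a,b_i,P_i$ as above) such that $a$ is adjacent to $b_2$, together with a path $R=p_1\hbox{-}\cdots\hbox{-}p_k$ such that $p_1$ is adjacent to $b_2$; $p_k$ has a neighbor in $P_1^*$; $P_3$ is anticomplete to $R$; $b_2$ is anticomplete to $R\setminus p_1$; and $P_1\setminus b_1$ is anticomplete to $R\setminus p_k$. Its corner is $b_2$. A vertex of $G$ is a hub if it is the center $x$ of a proper wheel $(H,x)$ in $G$ or the corner of a loaded pyramid in $G$; $\mathrm{Hub}(G)$ is the set of hubs. For a path $P$ with an end $y$ and a non-empty set $A\subseteq P$, the $(P,y)$-last vertex of $A$ is the vertex of $A$ closest to $y$ along $P$. \textbf{Theorem.} Let $G\in\mathcal C$. Let $\Sigma$ be a pyramid in $G$ with apex $a$, base $b_1b_2b_3$ and paths $P_1,P_2,P_3$. For each $i\in\{1,2,3\}$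 let $Q_i$ be a subpath of $P_i$, of length at least one, with ends $a$ and $x_i$, such that all internal vertices of $Q_i$ have degree two in $G$. Let $b\in V(G)\setminus(Q_1\cup Q_2\cup Q_3)$. Assume that \begin{itemize} \item $N_G(a)\subseteq\Sigma$; \item $\{x_1,x_2,x_3\}$ is a stable set; \item $b$ is non-adjacent to $x_1,x_2,x_3$; \item $a$ does not belong to a cross-edge of an extended near-prism in $G$; and \item $\mathrm{Hub}(G)\cap\{x_1,x_2,x_3\}=\emptyset$. \end{itemize} Let $D=G\setminus(Q_1\cup Q_2\cup Q_3)$. Then there are a (possibly empty) clique $K\subseteq D$ and distinct $i,j\in\{1,2,3\}$ such that, writing $D_l$ for the union of those components of $D\setminus K$ that contain a neighbor of $x_l$, one of the following holds: \begin{enumerate} \item $b\notin K\cup D_i\cup D_j$; or \item $b\notin N[D_i]$, and there are a set $D_j'$ of vertices and a vertex $q$ such that \begin{itemize} \item $D_j'$ is not a clique; \item $D_j'$ is complete to $K$; \item either $b\in K$ and $q=b$, or there is $k\in\{1,2,3\}\setminus\{i\}$ such that $x_k$ is complete to $K\cup D_j'$ and $q=x_k$; \item for every $v\in D_j'$ there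 is a path $P$ in $D\cup\{x_j\}$ from $b$ to $x_j$ such that $P\cap N(q)\ne\emptyset$ and the $(P,x_j)$-last vertex of $P\cap N(q)$ is $v$; and \item for every path $P$ in $D\cup\{x_j\}$ from $b$ to $x_j$ we have $P\cap N(q)\neq\emptyset$, and the $(P,x_j)$-last vertex of $P\cap N(q)$ is complete to $K$. \end{itemize} \end{enumerate} -/

import Mathlib

namespace EvenHole

variable {V : Type*}

/-- Two vertex sets are anticomplete: they are disjoint and no edge joins them. -/
def Anticomplete (G : SimpleGraph V) (X Y : Set V) : Prop :=
  Disjoint X Y ∧ ∀ x ∈ X, ∀ y ∈ Y, ¬ G.Adj x y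

/-- Every vertex of `X` is adjacent to every vertex of `Y` (so `X` and `Y` are disjoint). -/
def Complete (G : SimpleGraph V) (X Y : Set V) : Prop :=
  ∀ x ∈ X, ∀ y ∈ Y, G.Adj x y

/-- The closed neighborhood `N[X]`. -/
def closedNbhd (G : SimpleGraph V) (X : Set V) : Set V :=
  {v | v ∈ X ∨ ∃ x ∈ X, G.Adj x v}

/-- The vertex set of a walk. -/
def verts {G : SimpleGraph V} {u w : V} (P : G.Walk u w) : Set V :=
  {v | v ∈ P.support}

/-- The interior of a path: its vertex set without its two ends. -/
def interior {G : SimpleGraph V} {u w : V} (P : G.Walk u w) : Set V :=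
  verts P \ {u, w}

/-- A path that is an induced subgraph: no edge of `G` joins two vertices of the path,
except the edges of the path. Length zero is allowed. -/
structure IsInducedPath {G : SimpleGraph V} {u w : V} (P : G.Walk u w) : Prop where
  isPath : P.IsPath
  chordless : P.IsChordless

/-- `S` is the vertex set of a hole: `G[S]` is a cycle of length at least four. -/
def IsHole (G : SimpleGraph V) (S : Set V) : Prop :=
  ∃ n : ℕ, 4 ≤ n ∧ Nonempty (SimpleGraph.cycleGraph n ≃g G.induce S)

/-- A wheel `(H, x)`: a hole `H` and a vertex `x` with at least three neighbors in `H`. -/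
def IsWheel (G : SimpleGraph V) (H : Set V) (x : V) : Prop :=
  IsHole G H ∧ 3 ≤ (G.neighborSet x ∩ H).ncard

/-- A wheel whose center has an even number of neighbors in the hole. -/
def IsEvenWheel (G : SimpleGraph V) (H : Set V) (x : V) : Prop :=
  IsWheel G H x ∧ Even (G.neighborSet x ∩ H).ncard

/-- A wheel such that the neighbors of the center in the hole have stability number
at least three. -/
def IsProperWheel (G : SimpleGraph V) (H : Set V) (x : V) : Prop :=
  IsWheel G H x ∧ 3 ≤ (G.induce (G.neighborSet x ∩ H)).indepNum

/-- The three paths `P i` from `a` to `b` form a theta that is an induced subgraph of `G`. -/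
structure IsTheta (G : SimpleGraph V) (a b : V) (P : Fin 3 → G.Walk a b) : Prop where
  path : ∀ i, IsInducedPath (P i)
  two_le_length : ∀ i, 2 ≤ (P i).length
  anticomplete : ∀ i j, i ≠ j → Anticomplete G (interior (P i)) (interior (P j))

/-- The triangles `a`, `b` and the paths `P i` from `a i` to `b i` form a near-prism that is an
induced subgraph of `G`. The triangles may share a vertex, and then one of the paths
has length zero. -/
structure IsNearPrism (G : SimpleGraph V) (a b : Fin 3 → V)
    (P : ∀ i, G.Walk (a i) (b i)) : Prop where
  triangle_a : ∀ i j, i ≠ j → G.Adj (a i) (a j)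
  triangle_b : ∀ i j, i ≠ j → G.Adj (b i) (b j)
  path : ∀ i, IsInducedPath (P i)
  hole : ∀ i j, i ≠ j → IsHole G (verts (P i) ∪ verts (P j))

/-- A near-prism whose two triangles are disjoint. -/
def IsPrism (G : SimpleGraph V) (a b : Fin 3 → V) (P : ∀ i, G.Walk (a i) (b i)) : Prop :=
  IsNearPrism G a b P ∧ ∀ i j, a i ≠ b j

/-- `uv` is the cross-edge of an extended near-prism that is an induced subgraph of `G`:
after the edge `uv` of `G` is removed there is an induced near-prism such that `u` and `v` are in
the interiors of two different paths of it. -/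
def IsCrossEdge (G : SimpleGraph V) (u v : V) : Prop :=
  G.Adj u v ∧
    ∃ (a b : Fin 3 → V) (P : ∀ i, (G.deleteEdges {s(u, v)}).Walk (a i) (b i)),
      IsNearPrism (G.deleteEdges {s(u, v)}) a b P ∧
        ∃ i j, i ≠ j ∧ u ∈ interior (P i) ∧ v ∈ interior (P j)

/-- The class of (C₄, theta, prism, even wheel)-free graphs. -/
structure C4FreeOddSignable (G : SimpleGraph V) : Prop where
  c4_free : ¬ (SimpleGraph.cycleGraph 4).IsIndContained G
  theta_free : ∀ (a b : V) (P : Fin 3 → G.Walk a b), ¬ IsTheta G a b P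
  prism_free : ∀ (a b : Fin 3 → V) (P : ∀ i, G.Walk (a i) (b i)), ¬ IsPrism G a b P
  even_wheel_free : ∀ (H : Set V) (x : V), ¬ IsEvenWheel G H x

/-- The paths `P i` from the apex `a` to the vertices `b i` of the base form a pyramid that is an
induced subgraph of `G`. -/
structure IsPyramid (G : SimpleGraph V) (a : V) (b : Fin 3 → V)
    (P : ∀ i, G.Walk a (b i)) : Prop where
  base : ∀ i j, i ≠ j → G.Adj (b i) (b j)
  path : ∀ i, IsInducedPath (P i)
  hole : ∀ i j, i ≠ j → IsHole G (verts (P i) ∪ verts (P j))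

/-- The pyramid `(a, b, P)` and the path `R` from `p` to `p'` form a loaded pyramid with
corner `b 1`. The indices `0, 1, 2` stand for `1, 2, 3`. -/
structure IsLoadedPyramid (G : SimpleGraph V) (a : V) (b : Fin 3 → V)
    (P : ∀ i, G.Walk a (b i)) {p p' : V} (R : G.Walk p p') : Prop where
  pyramid : IsPyramid G a b P
  adj_apex : G.Adj a (b 1)
  path : IsInducedPath R
  adj_first : G.Adj p (b 1)
  adj_last : ∃ v ∈ interior (P 0), G.Adj p' v
  anticomplete_third : Anticomplete G (verts (P 2)) (verts R)
  anticomplete_corner : Anticomplete G {b 1} (verts R \ {p})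
  anticomplete_first : Anticomplete G (verts (P 0) \ {b 0}) (verts R \ {p'})

/-- A hub: the center of a proper wheel or the corner of a loaded pyramid. -/
def IsHub (G : SimpleGraph V) (v : V) : Prop :=
  (∃ H : Set V, IsProperWheel G H v) ∨
    ∃ (a : V) (b : Fin 3 → V) (P : ∀ i, G.Walk a (b i)) (p p' : V) (R : G.Walk p p'),
      IsLoadedPyramid G a b P R ∧ v = b 1

/-- The union of the components of `G[S]` that contain a neighbor of `x`. -/
def attached (G : SimpleGraph V) (S : Set V) (x : V) : Set V :=
  {v | ∃ C : (G.induce S).ConnectedComponent,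
    (∃ u ∈ C.supp, G.Adj x u) ∧ ∃ w ∈ C.supp, (w : V) = v}

/-- `v` is the vertex of the set `A` that is closest to the end `y` along the path `P`. -/
def IsLastVertex {G : SimpleGraph V} {u y : V} (P : G.Walk u y) (A : Set V) (v : V) : Prop :=
  ∃ n ≤ P.length, P.getVert n = v ∧ v ∈ A ∧
    ∀ m, n < m → m ≤ P.length → P.getVert m ∉ A

/-- The first outcome: `b` is neither in `K` nor in `D_i` nor in `D_j`. -/
def SeparatesPair (G : SimpleGraph V) (D K : Set V) (x : Fin 3 → V) (b : V) (i j : Fin 3) :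
    Prop :=
  b ∉ K ∪ attached G (D \ K) (x i) ∪ attached G (D \ K) (x j)

/-- The second, weaker outcome; `D'` is the set `D_j'`. -/
def WeaklySeparates (G : SimpleGraph V) (D K : Set V) (x : Fin 3 → V) (b : V) (i j : Fin 3) :
    Prop :=
  b ∉ closedNbhd G (attached G (D \ K) (x i)) ∧
    ∃ D' : Set V, ¬ G.IsClique D' ∧ Complete G D' K ∧
      ∃ q : V,
        ((b ∈ K ∧ q = b) ∨ ∃ k, k ≠ i ∧ Complete G {x k} (K ∪ D') ∧ q = x k) ∧
        (∀ v ∈ D', ∃ P : G.Walk b (x j), IsInducedPath P ∧ verts P ⊆ D ∪ {x j} ∧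
          (verts P ∩ G.neighborSet q).Nonempty ∧
          IsLastVertex P (verts P ∩ G.neighborSet q) v) ∧
        ∀ P : G.Walk b (x j), IsInducedPath P → verts P ⊆ D ∪ {x j} →
          (verts P ∩ G.neighborSet q).Nonempty ∧
          ∀ v, IsLastVertex P (verts P ∩ G.neighborSet q) v → Complete G {v} K

end EvenHole

/-! Delete the paths `Q i`. What remains of the pyramid are three rungs, leading from the roots `x
i` to the base, which see each other only in the base triangle. The proof grows them into strips:
disjoint sets `M i ∋ x i` with ends `A i` that are pairwise complete, such that no other edge joins
two strips. Choose strips covering as many vertices as possible.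

The heart is `strips_local`: a path in `D` outside the strips with a neighbor in `M i \ A i` has no
neighbor in another strip. Take a minimal offending path. By `connector_end`, whichever rungs are
chosen in the other two strips, its far end sees exactly their ends. The path can therefore be added
to strip `i`, against maximality.

Two facts give `connector_end`. By `attach_path`, a path from `x i` that reaches an induced path
between the other two roots attaches there at exactly two consecutive vertices, since otherwise
there is a theta. By `two_edges_false`, a connector that attaches in this way inside two single
rungs yields a prism or an even wheel. The theta argument for `attach_path` leaves one exception:
the only neighbor is a root `x j` adjacent to `a`. Then some induced path between the other two
roots passes through `x j`, which `no_middle` forbids; this is where the assumptions on hubs and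
cross-edges enter.

Adding to each `M i` whatever hangs on `M i \ A i` gives a partition of `D` and the roots in which
`N i` meets the outside only through `A i` (`exists_separation`). As there is no `C₄`, at least two
of the pairwise complete sets `A i` are cliques (`clique_or_clique`), and cliques cut out of the
sets `A i` separate `b` from two roots. Complications arise only if some `A j` contains its root,
which cannot belong to `K ⊆ D`, or if `b` itself lies in some `A i`. Then the last neighbors of `q`,
where `q` is that root or `b`, take over: if they form a clique they can be added to the cutset, and
if not they form the set `D_j'` (`exists_separates_of_last`). -/

namespace EvenHole

variable {V : Type*}

/-! ### Induced paths, handled as vertex sets. -/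

/-- `S` is the vertex set of an induced path of `G` from `u` to `v`. -/
inductive PS (G : SimpleGraph V) : Set V → V → V → Prop
  | single (u : V) : PS G {u} u u
  | cons {S : Set V} {u v w : V} : PS G S v w → u ∉ S → G.Adj u v →
      (∀ y ∈ S, G.Adj u y → y = v) → PS G (insert u S) u w

/-- The sets `S` and `T` are disjoint and no edge joins them. -/
def Anti (G : SimpleGraph V) (S T : Set V) : Prop :=
  ∀ x ∈ S, ∀ y ∈ T, x ≠ y ∧ ¬ G.Adj x y

/-- The sets `S` and `T` are disjoint and the only edge that joins them is `uv`. -/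
def Link (G : SimpleGraph V) (S T : Set V) (u v : V) : Prop :=
  ∀ x ∈ S, ∀ y ∈ T, x ≠ y ∧ (G.Adj x y ↔ x = u ∧ y = v)

variable {G : SimpleGraph V} {S T A : Set V} {u v w z : V}

lemma Anti.symm (h : Anti G S T) : Anti G T S := fun x hx y hy =>
  ⟨(h y hy x hx).1.symm, fun e => (h y hy x hx).2 e.symm⟩

lemma Anti.anticomplete (h : Anti G S T) : Anticomplete G S T :=
  ⟨Set.disjoint_left.2 fun x hx hy => (h x hx x hy).1 rfl, fun x hx y hy => (h x hx y hy).2⟩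

lemma Link.symm (h : Link G S T u v) : Link G T S v u := fun x hx y hy =>
  ⟨(h y hy x hx).1.symm, by rw [G.adj_comm, (h y hy x hx).2, and_comm]⟩

namespace PS

lemma left_mem (h : PS G S u v) : u ∈ S := by cases h <;> simp

lemma right_mem (h : PS G S u v) : v ∈ S := by
  induction h with
  | single u => simp
  | cons _ _ _ _ ih => exact Set.mem_insert_of_mem _ ih

lemma glue (hS : PS G S u v) (hT : PS G T w z) (h : Link G S T v w) : PS G (S ∪ T) u z := by
  induction hS with
  | single u =>
    have := hT.left_mem
    rw [Set.singleton_union]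
    exact .cons hT (fun hu => (h u rfl u hu).1 rfl) (((h u rfl w this).2).2 ⟨rfl, rfl⟩)
      fun y hy e => (((h u rfl y hy).2).1 e).2
  | @cons S u v' v hS hu huv hn ih =>
    rw [Set.insert_union]
    have hv := hS.right_mem
    refine .cons (ih fun x hx y hy => h x (Set.mem_insert_of_mem _ hx) y hy) ?_ huv ?_
    · rintro (h1 | h1)
      · exact hu h1
      · exact (h u (Set.mem_insert _ _) u h1).1 rfl
    · rintro y (hy | hy) e
      · exact hn y hy e
      · have := (((h u (Set.mem_insert _ _) y hy).2).1 e).1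
        exact absurd (this ▸ hv) hu

lemma concat (h : PS G S u v) (hw : w ∉ S) (e : G.Adj v w) (hn : ∀ y ∈ S, G.Adj y w → y = v) :
    PS G (insert w S) u w := by
  have := h.glue (T := {w}) (.single w) (w := w) ?_
  · rwa [Set.union_singleton] at this
  · rintro x hx y rfl
    refine ⟨fun hxy => hw (hxy ▸ hx), fun e => ⟨hn x hx e, rfl⟩, fun e' => e'.1 ▸ e⟩

lemma symm (h : PS G S u v) : PS G S v u := by
  induction h with
  | single u => exact .single u
  | cons hS hu huv hn ih => exact ih.concat hu huv.symm fun y hy e => hn y hy e.symm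

lemma eq_singleton (h : PS G S u u) : S = {u} := by
  cases h with
  | single => rfl
  | cons hS hu _ _ => exact absurd hS.right_mem hu

/-- The first vertex of `A` on a path. -/
lemma first (h : PS G S u v) (hA : (S ∩ A).Nonempty) :
    ∃ z S₁, PS G S₁ u z ∧ S₁ ⊆ S ∧ (∀ x ∈ S₁, x ∈ A ↔ x = z) ∧
      ((z = v ∧ S₁ = S) ∨ ∃ w S₂, PS G S₂ w v ∧ S = S₁ ∪ S₂ ∧ Link G S₁ S₂ z w) := by
  induction h with
  | single u =>
    obtain ⟨x, rfl, hx⟩ := hA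
    exact ⟨x, {x}, .single x, subset_rfl, by simp [hx], .inl ⟨rfl, rfl⟩⟩
  | @cons S u w v hS hu huw hn ih =>
    by_cases hA' : u ∈ A
    · refine ⟨u, {u}, .single u, by simp, by simp [hA'], .inr ⟨w, S, hS, by simp, ?_⟩⟩
      rintro x rfl y hy
      exact ⟨fun e => hu (e ▸ hy), fun e => ⟨rfl, hn y hy e⟩, fun e => e.2 ▸ huw⟩
    · obtain ⟨z, S₁, h1, h2, h3, h4⟩ := ih (by
        obtain ⟨x, rfl | hx, hx'⟩ := hA
        · exact absurd hx' hA'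
        · exact ⟨x, hx, hx'⟩)
      refine ⟨z, insert u S₁, .cons h1 (fun h => hu (h2 h)) huw fun y hy => hn y (h2 hy),
        Set.insert_subset_insert h2, ?_, ?_⟩
      · rintro x (rfl | hx)
        · exact ⟨fun h => absurd h hA', fun h => absurd (h2 (h ▸ h1.right_mem)) hu⟩
        · exact h3 x hx
      · rcases h4 with ⟨rfl, rfl⟩ | ⟨w', S₂, g1, rfl, g3⟩
        · exact .inl ⟨rfl, rfl⟩
        · refine .inr ⟨w', S₂, g1, by rw [Set.insert_union], ?_⟩
          rintro x (rfl | hx) y hy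
          · refine ⟨fun e => hu (.inr (e ▸ hy)), fun e => ?_, fun e => ?_⟩
            · have := hn y (.inr hy) e
              have hw := h1.left_mem
              exact absurd this (g3 w hw y hy).1.symm
            · exact absurd (.inl (e.1 ▸ h1.right_mem)) hu
          · exact g3 x hx y hy

/-- The initial segment of a path that ends at a given vertex. -/
lemma initial (h : PS G S u v) (hz : z ∈ S) :
    ∃ S₁, PS G S₁ u z ∧ S₁ ⊆ S ∧ (z ≠ v → ∃ w S₂, PS G S₂ w v ∧ S = S₁ ∪ S₂ ∧ Link G S₁ S₂ z w) := by
  obtain ⟨z', S₁, h1, h2, h3, h4⟩ := h.first (A := {z}) ⟨z, hz, rfl⟩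
  obtain rfl : z' = z := (h3 z' h1.right_mem).2 rfl
  exact ⟨S₁, h1, h2, fun hne => h4.resolve_left fun e => hne e.1⟩

/-- A vertex splits a path into two paths that share this vertex. -/
lemma split (h : PS G S u v) (hz : z ∈ S) :
    ∃ S₁ S₂, PS G S₁ u z ∧ PS G S₂ z v ∧ S = S₁ ∪ S₂ ∧ Anti G (S₁ \ {z}) (S₂ \ {z}) := by
  obtain ⟨S₁, h1, h2, h3⟩ := h.initial hz
  by_cases hzv : z = v
  · subst hzv
    obtain ⟨z', S₁, h1, h2, h3, h4⟩ := h.first (A := {z}) ⟨z, hz, rfl⟩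
    exact ⟨S, {z}, h, .single z, by simp [hz], fun x _ y hy => absurd hy.1 hy.2⟩
  · obtain ⟨w, S₂, g1, g2, g3⟩ := h3 hzv
    have hz1 := h1.right_mem
    have := h1.right_mem
    refine ⟨S₁, insert z S₂, h1, .cons g1 (fun h => (g3 z hz1 z h).1 rfl)
      (((g3 z hz1 w g1.left_mem).2).2 ⟨rfl, rfl⟩) fun y hy e => (((g3 z hz1 y hy).2).1 e).2, ?_, ?_⟩
    · rw [g2]; ext x; simp only [Set.mem_union, Set.mem_insert_iff]; grind
    · rintro x ⟨hx, hx'⟩ y ⟨rfl | hy, hy'⟩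
      · exact absurd rfl hy'
      · exact ⟨(g3 x hx y hy).1, fun e => hx' (((g3 x hx y hy).2).1 e).1⟩

/-- The first and the last vertex of `A` on a path. -/
lemma two_ends (h : PS G S u v) (hA : (S ∩ A).Nonempty) :
    (∃ z S₁ S₂, PS G S₁ u z ∧ PS G S₂ z v ∧ S = S₁ ∪ S₂ ∧ Anti G (S₁ \ {z}) (S₂ \ {z}) ∧
      ∀ x ∈ S, x ∈ A ↔ x = z) ∨
    (∃ z z' S₁ S₂, PS G S₁ u z ∧ PS G S₂ z' v ∧ S = S₁ ∪ S₂ ∧ Link G S₁ S₂ z z' ∧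
      ∀ x ∈ S, x ∈ A ↔ (x = z ∨ x = z')) ∨
    ∃ z z' S₁ S₂, PS G S₁ u z ∧ PS G S₂ z' v ∧ S₁ ⊆ S ∧ S₂ ⊆ S ∧ Anti G S₁ S₂ ∧
      (∀ x ∈ S₁, x ∈ A ↔ x = z) ∧ (∀ x ∈ S₂, x ∈ A ↔ x = z') := by
  obtain ⟨z, S₁, h1, h2, h3, h4⟩ := h.first hA
  rcases h4 with ⟨rfl, rfl⟩ | ⟨w, S₂, g1, rfl, g3⟩
  · refine .inl ⟨z, S₁, {z}, h1, .single z, ?_, fun x _ y hy => absurd hy.1 hy.2, h3⟩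
    have := h1.right_mem
    simp [this]
  · by_cases hA2 : (S₂ ∩ A).Nonempty
    · right
      obtain ⟨z', S₃, k1, k2, k3, k4⟩ := g1.symm.first hA2
      rcases k4 with ⟨rfl, rfl⟩ | ⟨w', S₄, l1, rfl, l3⟩
      · left
        refine ⟨z, z', S₁, S₃, h1, g1, rfl, g3, ?_⟩
        rintro x (hx | hx)
        · have := (g3 x hx z' g1.left_mem).1
          simp [h3 x hx, this]
        · have := (g3 z h1.right_mem x hx).1.symm
          simp [k3 x hx, this]
      · right
        refine ⟨z, z', S₁, S₃, h1, k1.symm, Set.subset_union_left,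
          fun x hx => .inr (.inl hx), ?_, h3, k3⟩
        intro x hx y hy
        have g := g3 x hx y (.inl hy)
        refine ⟨g.1, fun e => ?_⟩
        have := ((g.2).1 e).2
        exact (l3 y hy w l1.right_mem).1 this
    · left
      have hno : ∀ x ∈ S₂, x ∉ A := fun x hx hx' => hA2 ⟨x, hx, hx'⟩
      have hz := h1.right_mem
      refine ⟨z, S₁, insert z S₂, h1, .cons g1 (fun h => (g3 z hz z h).1 rfl)
        (((g3 z hz w g1.left_mem).2).2 ⟨rfl, rfl⟩)
        fun y hy e => (((g3 z hz y hy).2).1 e).2, ?_, ?_, ?_⟩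
      · ext x; simp only [Set.mem_union, Set.mem_insert_iff]; grind
      · rintro x ⟨hx, hx'⟩ y ⟨rfl | hy, hy'⟩
        · exact absurd rfl hy'
        · exact ⟨(g3 x hx y hy).1, fun e => hx' (((g3 x hx y hy).2).1 e).1⟩
      · rintro x (hx | hx)
        · exact h3 x hx
        · exact ⟨fun h => absurd h (hno x hx), fun h => absurd rfl (g3 z hz x hx |>.1 |> fun k => h ▸ k)⟩

/-- Two adjacent vertices of a path split it into two paths. -/
lemma split_adj (h : PS G S u v) {a b : V} (ha : a ∈ S) (hb : b ∈ S) (e : G.Adj a b) :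
    ∃ S₁ S₂, S = S₁ ∪ S₂ ∧ ((PS G S₁ u a ∧ PS G S₂ b v ∧ Link G S₁ S₂ a b) ∨
      (PS G S₁ u b ∧ PS G S₂ a v ∧ Link G S₁ S₂ b a)) := by
  rcases h.two_ends (A := {a, b}) ⟨a, ha, by simp⟩ with ⟨z, S₁, S₂, h1, h2, h3, h4, h5⟩ |
    ⟨z, z', S₁, S₂, h1, h2, h3, h4, h5⟩ | ⟨z, z', S₁, S₂, h1, h2, h3, h3', h4, h5, h6⟩
  · have := (h5 a ha).1 (by simp)
    have := (h5 b hb).1 (by simp)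
    exact absurd e (by subst_vars; simp)
  · have e1 := (h5 a ha).1 (by simp)
    have e2 := (h5 b hb).1 (by simp)
    have := e.ne
    refine ⟨S₁, S₂, h3, ?_⟩
    grind
  · have e1 := (h5 z h1.right_mem).2 rfl
    have e2 := (h6 z' h2.left_mem).2 rfl
    have := h4 z h1.right_mem z' h2.left_mem
    have := e.symm
    grind

/-- The clause about `T = S` is the point: for a minimal path it says that vertices with a forbidden
property can only be its two ends. -/
lemma sub (h : PS G S u v) {a b : V} (ha : a ∈ S) (hb : b ∈ S) :
    ∃ T ⊆ S, PS G T a b ∧ (T = S → (a = u ∧ b = v) ∨ (a = v ∧ b = u)) := by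
  obtain ⟨S₁, S₂, h1, h2, h3, h4⟩ := h.split ha
  have key : ∀ {a b : V}, a ≠ v → b ∈ S → b ≠ a → ∀ {S₁ S₂ : Set V}, PS G S₁ u a →
      PS G S₂ a v → S = S₁ ∪ S₂ → Anti G (S₁ \ {a}) (S₂ \ {a}) → b ∈ S₁ →
      ∃ T ⊆ S, PS G T a b ∧ v ∉ T := by
    intro a b hav hb hba S₁ S₂ h1 h2 h3 h4 hb1
    obtain ⟨T, k1, k2, -⟩ := h1.symm.initial hb1
    refine ⟨T, fun x hx => h3 ▸ .inl (k2 hx), k1, fun hv => ?_⟩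
    exact (h4 v ⟨k2 hv, hav.symm⟩ v ⟨h2.right_mem, hav.symm⟩).1 rfl
  by_cases hab : b = a
  · subst hab
    refine ⟨{b}, by simpa using ha, .single b, fun e => ?_⟩
    have e1 : u ∈ ({b} : Set V) := e ▸ h.left_mem
    have e2 : v ∈ ({b} : Set V) := e ▸ h.right_mem
    exact .inl ⟨e1.symm, e2.symm⟩
  by_cases hb1 : b ∈ S₁
  · by_cases hav : a = v
    · subst hav
      obtain ⟨T, k1, k2, k3⟩ := h.symm.initial hb
      refine ⟨T, k2, k1, fun e => .inr ⟨rfl, ?_⟩⟩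
      by_contra hbu
      obtain ⟨w, S₂, k4, k5, k6⟩ := k3 hbu
      have hu : u ∈ T := e ▸ h.left_mem
      exact (k6 u hu u k4.right_mem).1 rfl
    · obtain ⟨T, k1, k2, k3⟩ := key hav hb hab h1 h2 h3 h4 hb1
      exact ⟨T, k1, k2, fun e => absurd (e ▸ h.right_mem) k3⟩
  · have hb2 : b ∈ S₂ := by rw [h3] at hb; exact hb.resolve_left hb1
    obtain ⟨T, k1, k2, k3⟩ := h2.initial hb2
    refine ⟨T, fun x hx => h3 ▸ .inr (k2 hx), k1, fun e => .inl ?_⟩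
    have hu : u ∈ T := e ▸ h.left_mem
    have hv : v ∈ T := e ▸ h.right_mem
    constructor
    · by_contra hau
      exact (h4 u ⟨h1.left_mem, fun e => hau e.symm⟩ u ⟨k2 hu, fun e => hau e.symm⟩).1 rfl
    · by_contra hbv
      obtain ⟨w, S₃, k4, k5, k6⟩ := k3 hbv
      exact (k6 v hv v k4.right_mem).1 rfl

/-- A path that ends in `S₂` and misses an end of the only edge between `S₁` and `S₂` stays
in `S₂`. -/
lemma subset_of_link (h : PS G S u v) {S₁ S₂ : Set V} {a b : V} (hS : S ⊆ S₁ ∪ S₂)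
    (hl : Link G S₁ S₂ a b) (hv : v ∈ S₂) (hb : a ∉ S ∨ b ∉ S) : S ⊆ S₂ := by
  induction h with
  | single u => simpa using hv
  | @cons S u w v hS' hu huw hn ih =>
    have ih' := ih (fun x hx => hS (.inr hx)) hv (hb.imp (fun h h' => h (.inr h')) fun h h' => h (.inr h'))
    refine Set.insert_subset ?_ ih'
    by_contra hu2
    have hu1 := (hS (Set.mem_insert u S)).resolve_right hu2
    have := (((hl u hu1 w (ih' hS'.left_mem)).2).1 huw)
    rcases hb with hb | hb
    · exact hb (this.1 ▸ .inl rfl)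
    · exact hb (this.2 ▸ .inr hS'.left_mem)

/-- An end of a path has exactly one neighbor on the path. -/
lemma exists_adj (h : PS G S u v) (hne : u ≠ v) : ∃ x ∈ S, G.Adj u x ∧ ∀ y ∈ S, G.Adj u y → y = x := by
  cases h with
  | single => exact absurd rfl hne
  | @cons S _ w _ hS hu huw hn =>
    refine ⟨w, .inr hS.left_mem, huw, ?_⟩
    rintro y (rfl | hy) e
    · exact absurd e (by simp)
    · exact hn y hy e

lemma exists_walk (h : PS G S u v) : ∃ p : G.Walk u v, IsInducedPath p ∧ verts p = S := by
  induction h with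
  | single u =>
    refine ⟨.nil, ⟨.nil, ?_⟩, by ext; simp [verts]⟩
    rw [SimpleGraph.Walk.isChordless_iff_forall_mem_edges]
    intro a b ha hb e
    simp only [SimpleGraph.Walk.support_nil, List.mem_singleton] at ha hb
    subst ha hb
    exact absurd e (by simp)
  | @cons S u w v hS hu huw hn ih =>
    obtain ⟨p, ⟨hp, hc⟩, rfl⟩ := ih
    refine ⟨.cons huw p, ⟨?_, ?_⟩, ?_⟩
    · rw [SimpleGraph.Walk.cons_isPath_iff]; exact ⟨hp, hu⟩
    · rw [SimpleGraph.Walk.isChordless_iff_forall_mem_edges] at hc ⊢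
      intro a b ha hb e
      rw [SimpleGraph.Walk.support_cons, List.mem_cons] at ha hb
      rw [SimpleGraph.Walk.edges_cons, List.mem_cons]
      rcases ha with rfl | ha <;> rcases hb with rfl | hb
      · exact absurd e (by simp)
      · left; rw [hn b hb e]
      · left; rw [hn a ha e.symm, Sym2.eq_swap]
      · right; exact hc ha hb e
    · ext x; simp [verts]

lemma of_isInducedPath {p : G.Walk u v} (h : IsInducedPath p) : PS G (verts p) u v := by
  obtain ⟨hp, hc⟩ := h
  induction p with
  | nil => convert PS.single (G := G) _; ext; simp [verts]
  | @cons u w v huw p ih =>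
    rw [SimpleGraph.Walk.cons_isPath_iff] at hp
    rw [SimpleGraph.Walk.isChordless_iff_forall_mem_edges] at hc
    have hv : verts (.cons huw p) = insert u (verts p) := by ext x; simp [verts]
    have key : ∀ y ∈ p.support, G.Adj u y → y = w := by
      intro y hy e
      have := hc (u' := u) (v' := y) (by simp) (by simp [hy]) e
      rw [SimpleGraph.Walk.edges_cons, List.mem_cons] at this
      rcases this with h | h
      · rcases Sym2.eq_iff.1 h with h | h
        · exact h.2
        · exact absurd h.1 huw.ne
      · exact absurd (SimpleGraph.Walk.fst_mem_support_of_mem_edges _ h) hp.2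
    rw [hv]
    refine .cons (ih hp.1 ?_) hp.2 huw key
    rw [SimpleGraph.Walk.isChordless_iff_forall_mem_edges]
    intro a b ha hb e
    have := hc (u' := a) (v' := b) (by simp [ha]) (by simp [hb]) e
    rw [SimpleGraph.Walk.edges_cons, List.mem_cons] at this
    rcases this with h | h
    · rw [Sym2.eq_iff] at h
      rcases h with ⟨rfl, -⟩ | ⟨-, rfl⟩
      · exact absurd ha hp.2
      · exact absurd hb hp.2
    · exact h

/-- When a vertex is prepended to an induced path, a shortcut from it to its neighbor closest to the
far end restores inducedness; if it already lies on the path, the path is cut there. -/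
lemma of_walk (p : G.Walk u v) : ∃ S ⊆ verts p, PS G S u v := by
  induction p with
  | nil => exact ⟨_, by simp [verts], .single _⟩
  | @cons u w v huw p ih =>
    obtain ⟨S, hS, h⟩ := ih
    have hv : verts (.cons huw p) = insert u (verts p) := by ext x; simp [verts]
    rw [hv]
    by_cases hu : u ∈ S
    · obtain ⟨S₁, S₂, -, h2, rfl, -⟩ := h.split hu
      exact ⟨S₂, fun x hx => .inr (hS (.inr hx)), h2⟩
    · obtain ⟨z, S₁, h1, h2, h3, -⟩ := h.symm.first (A := {y | G.Adj u y}) ⟨w, h.left_mem, huw⟩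
      exact ⟨insert u S₁, Set.insert_subset_insert (h2.trans hS),
        .cons h1.symm (fun h => hu (h2 h)) ((h3 z h1.right_mem).2 rfl) fun y hy e => (h3 y hy).1 e⟩

lemma trans (hS : PS G S u v) (hT : PS G T v w) : ∃ R ⊆ S ∪ T, PS G R u w := by
  obtain ⟨p, -, rfl⟩ := hS.exists_walk
  obtain ⟨q, -, rfl⟩ := hT.exists_walk
  obtain ⟨R, h1, h2⟩ := of_walk (p.append q)
  refine ⟨R, fun x hx => ?_, h2⟩
  have := h1 hx
  simpa [verts] using this

/-- The first vertex of a path that has a neighbor in `R`. -/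
lemma first_adj {R : Set V} (h : PS G S u v) (hu : u ∉ R) (hv : v ∈ R ∨ ∃ r ∈ R, G.Adj v r) :
    ∃ z S₁, PS G S₁ u z ∧ S₁ ⊆ S ∧ (∀ x ∈ S₁, x ∉ R) ∧
      ∀ x ∈ S₁, (∃ r ∈ R, G.Adj x r) ↔ x = z := by
  induction h with
  | single u =>
    refine ⟨u, {u}, .single u, subset_rfl, by simpa using hu, ?_⟩
    simpa using hv.resolve_left hu
  | @cons S u w v hS huS huw hn ih =>
    by_cases h : ∃ r ∈ R, G.Adj u r
    · exact ⟨u, {u}, .single u, by simp, by simpa using hu, by simpa using h⟩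
    · obtain ⟨z, S₁, h1, h2, h3, h4⟩ := ih (fun hw => h ⟨w, hw, huw⟩) hv
      refine ⟨z, insert u S₁, .cons h1 (fun h => huS (h2 h)) huw fun y hy => hn y (h2 hy),
        Set.insert_subset_insert h2, ?_, ?_⟩
      · rintro x (rfl | hx)
        · exact hu
        · exact h3 x hx
      · rintro x (rfl | hx)
        · exact ⟨fun h' => absurd h' h, fun e => absurd (h2 (e ▸ h1.right_mem)) huS⟩
        · exact h4 x hx

/-- A path that connects two anticomplete sets contains a minimal such path. -/
lemma connecting {R R' : Set V} (h : PS G S u v) (hR : Anti G R R') (hu : u ∈ R) (hv : v ∈ R') :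
    ∃ t t' T, PS G T t t' ∧ T ⊆ S ∧ (∀ x ∈ T, x ∉ R ∧ x ∉ R') ∧
      (∀ x ∈ T, (∃ r ∈ R, G.Adj x r) ↔ x = t) ∧ ∀ x ∈ T, (∃ r ∈ R', G.Adj x r) ↔ x = t' := by
  obtain ⟨z, S₁, h1, h2, h3, h4⟩ := h.first_adj (R := R') (fun hu' => (hR u hu u hu').1 rfl) (.inl hv)
  obtain ⟨r, hr, hzr⟩ := (h4 z h1.right_mem).2 rfl
  obtain ⟨t, T, k1, k2, k3, k4⟩ := h1.symm.first_adj (R := R)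
    (fun hz => (hR z hz r hr).2 hzr) (.inl hu)
  exact ⟨t, z, T, k1.symm, k2.trans h2, fun x hx => ⟨k3 x hx, h3 x (k2 hx)⟩, k4,
    fun x hx => h4 x (k2 hx)⟩

lemma of_preconnected {S : Set V} {u v : S} (h : (G.induce S).Reachable u v) :
    ∃ T ⊆ S, PS G T (u : V) v := by
  obtain ⟨p⟩ := h
  obtain ⟨T, h1, h2⟩ := of_walk (p.map (SimpleGraph.Embedding.induce S).toHom)
  refine ⟨T, fun x hx => ?_, h2⟩
  have := h1 hx
  simp only [verts, SimpleGraph.Walk.support_map, Set.mem_ofPred_eq, List.mem_map] at this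
  obtain ⟨y, -, rfl⟩ := this
  exact y.2

lemma reachable (h : PS G S u v) (hS : S ⊆ T) :
    (G.induce T).Reachable ⟨u, hS h.left_mem⟩ ⟨v, hS h.right_mem⟩ := by
  induction h with
  | single u => exact .refl _
  | @cons S u w v hS' hu huw hn ih =>
    have := ih fun x hx => hS (.inr hx)
    refine .trans (SimpleGraph.Adj.reachable ?_) this
    simpa using huw

/-- The vertices of an induced path, in their order. -/
lemma exists_fun (h : PS G S u v) : ∃ (n : ℕ) (f : ℕ → V), f 0 = u ∧ f n = v ∧
    (∀ x, x ∈ S ↔ ∃ i ≤ n, f i = x) ∧ (∀ i ≤ n, ∀ j ≤ n, f i = f j → i = j) ∧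
      ∀ i ≤ n, ∀ j ≤ n, G.Adj (f i) (f j) ↔ (i = j + 1 ∨ j = i + 1) := by
  induction h with
  | single u =>
    refine ⟨0, fun _ => u, rfl, rfl, ?_, ?_, ?_⟩
    · intro x; simp [eq_comm]
    · intro i hi j hj _; omega
    · intro i hi j hj
      obtain rfl : i = 0 := by omega
      obtain rfl : j = 0 := by omega
      simp
  | @cons S u w v hS hu huw hn ih =>
    obtain ⟨n, f, h0, h1, h2, h3, h4⟩ := ih
    have hf : ∀ i ≤ n, f i ∈ S := fun i hi => (h2 _).2 ⟨i, hi, rfl⟩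
    refine ⟨n + 1, fun i => Nat.casesOn i u f, rfl, h1, ?_, ?_, ?_⟩
    · intro x
      constructor
      · rintro (rfl | hx)
        · exact ⟨0, by omega, rfl⟩
        · obtain ⟨i, hi, rfl⟩ := (h2 x).1 hx
          exact ⟨i + 1, by omega, rfl⟩
      · rintro ⟨_ | i, hi, rfl⟩
        · exact .inl rfl
        · exact .inr (hf i (by omega))
    · rintro (_ | i) hi (_ | j) hj e
      · rfl
      · exact absurd (hf j (by omega)) (by simpa [← show u = f j from e] using hu)
      · exact absurd (hf i (by omega)) (by simpa [show f i = u from e] using hu)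
      · have := h3 i (by omega) j (by omega) e; omega
    · have key : ∀ j ≤ n, G.Adj u (f j) ↔ j = 0 := fun j hj =>
        ⟨fun e => h3 j hj 0 (by omega) (by rw [h0]; exact hn _ (hf j hj) e),
          fun e => by rw [e, h0]; exact huw⟩
      rintro (_ | i) hi (_ | j) hj
      · simp
      · simpa using key j (by omega)
      · simpa [G.adj_comm] using key i (by omega)
      · simpa using h4 i (by omega) j (by omega)

/-- Induced paths depend only on the graph induced on their vertex set. -/
lemma congr_graph {G' : SimpleGraph V} (h : PS G S u v)
    (hG : ∀ x ∈ S, ∀ y ∈ S, G.Adj x y ↔ G'.Adj x y) : PS G' S u v := by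
  induction h with
  | single u => exact .single u
  | @cons S u w v hS hu huw hn ih =>
    refine .cons (ih fun x hx y hy => hG x (.inr hx) y (.inr hy)) hu
      ((hG u (.inl rfl) w (.inr hS.left_mem)).1 huw) fun y hy e => hn y hy ?_
    exact (hG u (.inl rfl) y (.inr hy)).2 e

/-- A path together with a vertex whose neighbors on the path are its two ends is a hole. -/
lemma isHole_insert {t : V} (h : PS G S u v) (huv : u ≠ v) (hnadj : ¬ G.Adj u v) (ht : t ∉ S)
    (htS : ∀ x ∈ S, G.Adj t x ↔ (x = u ∨ x = v)) : IsHole G (insert t S) := by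
  obtain ⟨n, f, rfl, rfl, h2, h3, h4⟩ := h.exists_fun
  have hf : ∀ i ≤ n, f i ∈ S := fun i hi => (h2 _).2 ⟨i, hi, rfl⟩
  have hn : 2 ≤ n := by
    rcases n with _ | _ | n
    · exact absurd rfl huv
    · exact absurd ((h4 0 (by omega) 1 (by omega)).2 (by omega)) hnadj
    · omega
  have htf : ∀ i ≤ n, G.Adj t (f i) ↔ (i = 0 ∨ i = n) := fun i hi => by
    rw [htS _ (hf i hi)]
    constructor
    · rintro (e | e)
      · exact .inl (h3 _ hi _ (by omega) e)
      · exact .inr (h3 _ hi _ (by omega) e)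
    · rintro (rfl | rfl) <;> simp
  let g : Fin (n + 2) → (insert t S : Set V) := fun i =>
    if hi : i.val ≤ n then ⟨f i, .inr (hf i hi)⟩ else ⟨t, .inl rfl⟩
  have hg1 : ∀ i : Fin (n + 2), i.val ≤ n → (g i : V) = f i := fun i hi => by simp [g, hi]
  have hg2 : ∀ i : Fin (n + 2), ¬ i.val ≤ n → (g i : V) = t := fun i hi => by simp [g, hi]
  have hbij : Function.Bijective g := by
    constructor
    · intro i j e
      have e' := congrArg Subtype.val e
      by_cases hi : i.val ≤ n <;> by_cases hj : j.val ≤ n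
      · rw [hg1 i hi, hg1 j hj] at e'; exact Fin.ext (h3 _ hi _ hj e')
      · rw [hg1 i hi, hg2 j hj] at e'; exact absurd (e' ▸ hf _ hi) ht
      · rw [hg2 i hi, hg1 j hj] at e'; exact absurd (e' ▸ hf _ hj) ht
      · exact Fin.ext (by omega)
    · rintro ⟨x, rfl | hx⟩
      · exact ⟨⟨n + 1, by omega⟩, Subtype.ext (hg2 _ (by simp))⟩
      · obtain ⟨i, hi, rfl⟩ := (h2 x).1 hx
        exact ⟨⟨i, by omega⟩, Subtype.ext (hg1 _ (by simpa))⟩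
  refine ⟨n + 2, by omega, ⟨⟨Equiv.ofBijective g hbij, ?_⟩⟩⟩
  intro i j
  rw [SimpleGraph.cycleGraph_adj', SimpleGraph.induce_adj, Equiv.ofBijective_apply,
    Equiv.ofBijective_apply]
  have hsub : ∀ i j : Fin (n + 2), (i - j).val = if j.val ≤ i.val then i.val - j.val else
      n + 2 + i.val - j.val := by
    intro i j
    split_ifs with hij
    · exact Fin.coe_sub_iff_le.2 hij
    · exact Fin.coe_sub_iff_lt.2 (by omega)
  rw [hsub, hsub]
  by_cases hi : i.val ≤ n <;> by_cases hj : j.val ≤ n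
  · rw [hg1 i hi, hg1 j hj, h4 _ hi _ hj]
    split_ifs <;> omega
  · rw [hg1 i hi, hg2 j hj, G.adj_comm, htf _ hi]
    split_ifs <;> omega
  · rw [hg2 i hi, hg1 j hj, htf _ hj]
    split_ifs <;> omega
  · rw [hg2 i hi, hg2 j hj]
    simp only [SimpleGraph.irrefl, false_iff]
    split_ifs <;> omega

end PS

/-! ### Holes, thetas, near-prisms and hubs assembled from paths. -/

/-- The sets `S` and `T` are disjoint and `uw` and `vz` are the only edges that join them. -/
def Link2 (G : SimpleGraph V) (S T : Set V) (u w v z : V) : Prop :=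
  ∀ x ∈ S, ∀ y ∈ T, x ≠ y ∧ (G.Adj x y ↔ ((x = u ∧ y = w) ∨ (x = v ∧ y = z)))

lemma Link2.symm (h : Link2 G S T u w v z) : Link2 G T S w u z v := fun x hx y hy =>
  ⟨(h y hy x hx).1.symm, by rw [G.adj_comm, (h y hy x hx).2]; tauto⟩

/-- Without its first vertex, `T` continues `S` to one induced path, which that vertex closes to a
hole. If `T` is a single vertex, `u` and `v` must be nonadjacent, or the cycle could be a triangle.
-/
lemma PS.isHole_union (hS : PS G S u v) (hT : PS G T w z) (h : Link2 G S T u w v z)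
    (huv : u ≠ v) (hw : w ≠ z ∨ ¬ G.Adj u v) : IsHole G (S ∪ T) := by
  cases hT with
  | single w =>
    rw [Set.union_singleton]
    refine hS.isHole_insert huv (by simpa using hw) (fun hw => (h w hw w rfl).1 rfl) fun x hx => ?_
    rw [G.adj_comm, (h x hx w rfl).2]; simp
  | @cons T w w' z hT hwT hww' hn =>
    have hwz : w ≠ z := fun e => hwT (e ▸ hT.right_mem)
    have huS := hS.left_mem
    have hvS := hS.right_mem
    have hl : Link G S T v z := fun x hx y hy => by
      have := h x hx y (.inr hy)
      have : y ≠ w := fun e => hwT (e ▸ hy)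
      grind
    have hR := hS.glue hT.symm hl
    rw [Set.union_insert]
    have h' := hT.left_mem
    refine hR.isHole_insert (hl u huS w' h').1 (fun e => huv (((hl u huS w' h').2).1 e).1) ?_ ?_
    · rintro (hx | hx)
      · exact (h w hx w (.inl rfl)).1 rfl
      · exact hwT hx
    · rintro x (hx | hx)
      · have e := h x hx w (.inl rfl)
        have e' := h x hx w' (.inr h')
        rw [G.adj_comm, e.2]; grind
      · have := h u huS x (.inr hx)
        constructor
        · exact fun e => .inr (hn x hx e)
        · rintro (rfl | rfl)
          · exact absurd rfl this.1
          · exact hww'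

lemma C4FreeOddSignable.theta_false (hG : C4FreeOddSignable G) {c d : V} {S₁ S₂ S₃ : Set V}
    (h₁ : PS G S₁ c d) (h₂ : PS G S₂ c d) (h₃ : PS G S₃ c d) (hne : c ≠ d) (hadj : ¬ G.Adj c d)
    (h₁₂ : Anti G (S₁ \ {c, d}) (S₂ \ {c, d})) (h₁₃ : Anti G (S₁ \ {c, d}) (S₃ \ {c, d}))
    (h₂₃ : Anti G (S₂ \ {c, d}) (S₃ \ {c, d})) : False := by
  obtain ⟨p₁, hp₁, rfl⟩ := h₁.exists_walk
  obtain ⟨p₂, hp₂, rfl⟩ := h₂.exists_walk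
  obtain ⟨p₃, hp₃, rfl⟩ := h₃.exists_walk
  have hlen : ∀ p : G.Walk c d, 2 ≤ p.length := by
    intro p
    by_contra hlt
    have : p.length = 0 ∨ p.length = 1 := by omega
    rcases this with h | h
    · exact hne (SimpleGraph.Walk.eq_of_length_eq_zero h)
    · exact hadj (SimpleGraph.Walk.adj_of_length_eq_one h)
  refine hG.theta_free c d ![p₁, p₂, p₃] ⟨?_, fun i => hlen _, ?_⟩
  · intro i; fin_cases i <;> assumption
  · intro i j hij
    fin_cases i <;> fin_cases j <;> first
      | exact absurd rfl hij
      | exact h₁₂.anticomplete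
      | exact h₁₃.anticomplete
      | exact h₂₃.anticomplete
      | exact h₁₂.symm.anticomplete
      | exact h₁₃.symm.anticomplete
      | exact h₂₃.symm.anticomplete

/-- Only the path with index `2` may degenerate to a vertex. The two other paths must then have
length at least two for the unions to be holes, which is what `h2` ensures. -/
lemma exists_nearPrism {a b : Fin 3 → V} {A : Fin 3 → Set V} (hA : ∀ i, PS G (A i) (a i) (b i))
    (hL : ∀ i j, i < j → Link2 G (A i) (A j) (a i) (a j) (b i) (b j))
    (hne : ∀ i, i ≠ 2 → a i ≠ b i) (h2 : a 2 ≠ b 2 ∨ ∀ i, i ≠ 2 → ¬ G.Adj (a i) (b i)) :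
    ∃ P : ∀ i, G.Walk (a i) (b i), IsNearPrism G a b P ∧ ∀ i, verts (P i) = A i := by
  choose P hP hv using fun i => (hA i).exists_walk
  have hL' : ∀ i j, i ≠ j → Link2 G (A i) (A j) (a i) (a j) (b i) (b j) := fun i j hij => by
    rcases lt_or_gt_of_ne hij with h | h
    · exact hL i j h
    · exact (hL j i h).symm
  refine ⟨P, ⟨?_, ?_, hP, ?_⟩, hv⟩
  · exact fun i j hij => ((hL' i j hij _ (hA i).left_mem _ (hA j).left_mem).2).2 (.inl ⟨rfl, rfl⟩)
  · exact fun i j hij => ((hL' i j hij _ (hA i).right_mem _ (hA j).right_mem).2).2 (.inr ⟨rfl, rfl⟩)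
  · have key : ∀ i j, i ≠ j → i ≠ 2 → IsHole G (A i ∪ A j) := fun i j hij hi => by
      refine (hA i).isHole_union (hA j) (hL' i j hij) (hne i hi) ?_
      by_cases hj : j = 2
      · subst hj; exact h2.imp_right fun h => h i hi
      · exact .inl (hne j hj)
    intro i j hij
    rw [hv, hv]
    by_cases hi : i = 2
    · rw [Set.union_comm]; exact key j i hij.symm fun hj => hij (hi.trans hj.symm)
    · exact key i j hij hi

/-- If `F` is a single vertex, it has exactly four neighbors on the hole `A₁ ∪ A₂`, an even wheel.
Otherwise the two triangles are disjoint and the three paths form a prism. -/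
lemma C4FreeOddSignable.nearPrism_false (hG : C4FreeOddSignable G) {a₁ b₁ a₂ b₂ f g : V}
    {A₁ A₂ F : Set V} (h₁ : PS G A₁ a₁ b₁) (h₂ : PS G A₂ a₂ b₂) (hF : PS G F f g)
    (h₁₂ : Link2 G A₁ A₂ a₁ a₂ b₁ b₂) (h₁F : Link2 G A₁ F a₁ f b₁ g)
    (h₂F : Link2 G A₂ F a₂ f b₂ g) (hne₁ : a₁ ≠ b₁) (hne₂ : a₂ ≠ b₂) : False := by
  have ha₁ := h₁.left_mem
  have hb₁ := h₁.right_mem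
  have ha₂ := h₂.left_mem
  have hb₂ := h₂.right_mem
  have hf := hF.left_mem
  have hg := hF.right_mem
  by_cases hfg : f = g
  · subst hfg
    obtain rfl := hF.eq_singleton
    have hH := h₁.isHole_union h₂ h₁₂ hne₁ (.inl hne₂)
    have hN : G.neighborSet f ∩ (A₁ ∪ A₂) = {a₁, b₁, a₂, b₂} := by
      ext x
      simp only [Set.mem_inter_iff, SimpleGraph.mem_neighborSet, Set.mem_union,
        Set.mem_insert_iff, Set.mem_singleton_iff]
      constructor
      · rintro ⟨e, hx | hx⟩
        · have := ((h₁F x hx f rfl).2).1 e.symm; tauto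
        · have := ((h₂F x hx f rfl).2).1 e.symm; tauto
      · have k1 := fun x hx => (h₁F x hx f rfl).2
        have k2 := fun x hx => (h₂F x hx f rfl).2
        rintro (rfl | rfl | rfl | rfl)
        · exact ⟨((k1 _ ha₁).2 (by simp)).symm, .inl ha₁⟩
        · exact ⟨((k1 _ hb₁).2 (by simp)).symm, .inl hb₁⟩
        · exact ⟨((k2 _ ha₂).2 (by simp)).symm, .inr ha₂⟩
        · exact ⟨((k2 _ hb₂).2 (by simp)).symm, .inr hb₂⟩
    have hc : (G.neighborSet f ∩ (A₁ ∪ A₂)).ncard = 4 := by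
      rw [hN, Set.ncard_insert_of_notMem, Set.ncard_insert_of_notMem, Set.ncard_pair hne₂]
      · simp only [Set.mem_insert_iff, Set.mem_singleton_iff]
        have := (h₁₂ b₁ hb₁ a₂ ha₂).1; have := (h₁₂ b₁ hb₁ b₂ hb₂).1; tauto
      · simp only [Set.mem_insert_iff, Set.mem_singleton_iff]
        have := (h₁₂ a₁ ha₁ a₂ ha₂).1; have := (h₁₂ a₁ ha₁ b₂ hb₂).1; tauto
    exact hG.even_wheel_free _ f ⟨⟨hH, by omega⟩, by rw [hc]; decide⟩
  · obtain ⟨P, hP, -⟩ := exists_nearPrism (G := G) (a := ![a₁, a₂, f]) (b := ![b₁, b₂, g])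
      (A := ![A₁, A₂, F]) (by intro i; fin_cases i <;> assumption)
      (by intro i j hij; fin_cases i <;> fin_cases j <;> first | assumption | simp at hij)
      (by intro i hi; fin_cases i <;> assumption) (.inl hfg)
    refine hG.prism_free _ _ P ⟨hP, ?_⟩
    have e1 := (h₁₂ a₁ ha₁ b₂ hb₂).1
    have e2 := (h₁₂ b₁ hb₁ a₂ ha₂).1
    have e3 := (h₁F a₁ ha₁ g hg).1
    have e4 := (h₁F b₁ hb₁ f hf).1
    have e5 := (h₂F a₂ ha₂ g hg).1
    have e6 := (h₂F b₂ hb₂ f hf).1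
    intro i j
    fin_cases i <;> fin_cases j <;> first | assumption | exact Ne.symm (by assumption)

lemma isHub_of_isHole [Finite V] {H : Set V} {x p q r : V} (hH : IsHole G H) (hp : p ∈ H)
    (hq : q ∈ H) (hr : r ∈ H) (hxp : G.Adj x p) (hxq : G.Adj x q) (hxr : G.Adj x r)
    (hpq : p ≠ q) (hpr : p ≠ r) (hqr : q ≠ r) (npq : ¬ G.Adj p q) (npr : ¬ G.Adj p r)
    (nqr : ¬ G.Adj q r) : IsHub G x := by
  classical
  refine .inl ⟨H, ⟨hH, ?_⟩, ?_⟩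
  · have hsub : ({p, q, r} : Set V) ⊆ G.neighborSet x ∩ H := by
      rintro y (rfl | rfl | rfl)
      exacts [⟨hxp, hp⟩, ⟨hxq, hq⟩, ⟨hxr, hr⟩]
    have hc : ({p, q, r} : Set V).ncard = 3 := by
      rw [Set.ncard_insert_of_notMem (by simp [hpq, hpr]), Set.ncard_pair hqr]
    rw [← hc]
    exact Set.ncard_le_ncard hsub
  · let p' : (G.neighborSet x ∩ H : Set V) := ⟨p, hxp, hp⟩
    let q' : (G.neighborSet x ∩ H : Set V) := ⟨q, hxq, hq⟩
    let r' : (G.neighborSet x ∩ H : Set V) := ⟨r, hxr, hr⟩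
    have hI : (G.induce (G.neighborSet x ∩ H)).IsIndepSet
        (({p', q', r'} : Finset (G.neighborSet x ∩ H : Set V)) : Set _) := by
      have nqp : ¬ G.Adj q p := fun e => npq (G.adj_symm e)
      have nrp : ¬ G.Adj r p := fun e => npr (G.adj_symm e)
      have nrq : ¬ G.Adj r q := fun e => nqr (G.adj_symm e)
      intro y hy z hz _
      simp only [Finset.coe_insert, Finset.coe_singleton, Set.mem_insert_iff,
        Set.mem_singleton_iff] at hy hz
      rcases hy with rfl | rfl | rfl <;> rcases hz with rfl | rfl | rfl <;>
        simp [p', q', r', *]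
    have hc : ({p', q', r'} : Finset (G.neighborSet x ∩ H : Set V)).card = 3 := by
      rw [Finset.card_eq_three]
      exact ⟨p', q', r', fun e => hpq (congrArg Subtype.val e), fun e => hpr (congrArg Subtype.val e),
        fun e => hqr (congrArg Subtype.val e), rfl⟩
    rw [← hc]
    exact hI.card_le_indepNum

/-- How a path that ends at a vertex `d` attaches to a path `P` that `d` closes to a hole. -/
lemma C4FreeOddSignable.attach (hG : C4FreeOddSignable G) {P E : Set V} {p q d g : V}
    (hP : PS G P p q) (hd : d ∉ P) (hdP : ∀ x ∈ P, G.Adj d x ↔ (x = p ∨ x = q))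
    (hE : PS G E g d) (hgd : g ≠ d) (hEP : ∀ x ∈ E, x ∉ P)
    (hE2 : ∀ x ∈ E, x ≠ g → x ≠ d → ∀ y ∈ P, ¬ G.Adj x y) (hg : ∃ y ∈ P, G.Adj g y) :
    (∃ w, (w = p ∨ w = q) ∧ ∀ x ∈ P, G.Adj g x ↔ x = w) ∨
    (∃ z z' S₁ S₂, PS G S₁ p z ∧ PS G S₂ z' q ∧ P = S₁ ∪ S₂ ∧ Link G S₁ S₂ z z' ∧
      ∀ x ∈ P, G.Adj g x ↔ (x = z ∨ x = z')) ∨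
    (G.Adj g d ∧ ∃ z ∈ P, ∃ z' ∈ P, z ≠ z' ∧ ¬ G.Adj z z' ∧ G.Adj g z ∧ G.Adj g z') := by
  have hgE := hE.left_mem
  have hdE := hE.right_mem
  have hpP := hP.left_mem
  have hqP := hP.right_mem
  have hdp : G.Adj d p := (hdP p hpP).2 (.inl rfl)
  have hdq : G.Adj d q := (hdP q hqP).2 (.inr rfl)
  rcases hP.two_ends (A := {x | G.Adj g x}) hg with ⟨z, S₁, S₂, h1, h2, h3, h4, h5⟩ |
    ⟨z, z', S₁, S₂, h1, h2, h3, h4, h5⟩ | ⟨z, z', S₁, S₂, h1, h2, h3, h3', h4, h5, h6⟩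
  · left
    refine ⟨z, ?_, h5⟩
    by_contra hz
    push Not at hz
    have hz1 := h1.right_mem
    have hz2 := h2.left_mem
    have hp1 := h1.left_mem
    have hq2 := h2.right_mem
    have hS1 : S₁ ⊆ P := h3 ▸ Set.subset_union_left
    have hS2 : S₂ ⊆ P := h3 ▸ Set.subset_union_right
    have hzP := hS1 hz1
    have hq1 : q ∉ S₁ := fun hq => (h4 q ⟨hq, hz.2.symm⟩ q ⟨hq2, hz.2.symm⟩).1 rfl
    have hp2 : p ∉ S₂ := fun hp => (h4 p ⟨hp1, hz.1.symm⟩ p ⟨hp, hz.1.symm⟩).1 rfl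
    have hgz : G.Adj g z := (h5 z hzP).2 rfl
    have k1 : PS G (insert d S₁) z d := h1.symm.concat (fun h => hd (hS1 h)) hdp.symm fun y hy e =>
      ((hdP y (hS1 hy)).1 e.symm).resolve_right fun e => hq1 (e ▸ hy)
    have k2 : PS G (insert d S₂) z d := h2.concat (fun h => hd (hS2 h)) hdq.symm fun y hy e =>
      ((hdP y (hS2 hy)).1 e.symm).resolve_left fun e => hp2 (e ▸ hy)
    have hzd : ¬ G.Adj z d := fun e => by
      have := (hdP z hzP).1 e.symm; grind
    have k3 : PS G (insert z E) z d := .cons hE (fun h => hEP z h hzP) hgz.symm fun y hy e => by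
      by_contra hyg
      refine hE2 y hy hyg ?_ z hzP e.symm
      rintro rfl; exact hzd e
    have key : ∀ x ∈ P, x ≠ z → ∀ y ∈ E, y ≠ d → x ≠ y ∧ ¬ G.Adj x y := by
      intro x hx hxz y hy hyd
      refine ⟨fun e => hEP y hy (e ▸ hx), fun e => ?_⟩
      by_cases hyg : y = g
      · subst hyg; exact hxz ((h5 x hx).1 e.symm)
      · exact hE2 y hy hyg hyd x hx e.symm
    -- A unique neighbor `z` in the interior of `P` gives a theta with ends `z` and `d`: the two
    -- arcs of the hole and the path through `g`.
    refine hG.theta_false k1 k2 k3 (fun e => hd (e ▸ hzP)) hzd ?_ ?_ ?_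
    · intro x hx y hy; apply h4 <;> grind
    · intro x hx y hy; apply key <;> grind
    · intro x hx y hy; apply key <;> grind
  · exact .inr (.inl ⟨z, z', S₁, S₂, h1, h2, h3, h4, h5⟩)
  · right; right
    have hz1 := h1.right_mem
    have hz2 := h2.left_mem
    have hgz := (h5 z hz1).2 rfl
    have hgz' := (h6 z' hz2).2 rfl
    refine ⟨?_, z, h3 hz1, z', h3' hz2, (h4 z hz1 z' hz2).1, (h4 z hz1 z' hz2).2, hgz, hgz'⟩
    -- If `g` and `d` are nonadjacent, the routes from `g` to `d` through the first neighbor,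
    -- through the last neighbor, and along `E` form a theta.
    by_contra hgd'
    have hp1 := h1.left_mem
    have hq2 := h2.right_mem
    have hq1 : q ∉ S₁ := fun hq => (h4 q hq q hq2).1 rfl
    have hp2 : p ∉ S₂ := fun hp => (h4 p hp1 p hp).1 rfl
    have k1 : PS G (insert d S₁) z d := h1.symm.concat (fun h => hd (h3 h)) hdp.symm fun y hy e =>
      ((hdP y (h3 hy)).1 e.symm).resolve_right fun e => hq1 (e ▸ hy)
    have k2 : PS G (insert d S₂) z' d := h2.concat (fun h => hd (h3' h)) hdq.symm fun y hy e =>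
      ((hdP y (h3' hy)).1 e.symm).resolve_left fun e => hp2 (e ▸ hy)
    have hgP : g ∉ P := hEP g hgE
    have k1' : PS G (insert g (insert d S₁)) g d := .cons k1
      (by rintro (h | h); exacts [hgd h, hgP (h3 h)]) hgz (by
        rintro y (rfl | hy) e
        · exact absurd e hgd'
        · exact (h5 y hy).1 e)
    have k2' : PS G (insert g (insert d S₂)) g d := .cons k2
      (by rintro (h | h); exacts [hgd h, hgP (h3' h)]) hgz' (by
        rintro y (rfl | hy) e
        · exact absurd e hgd'
        · exact (h6 y hy).1 e)
    have key : ∀ x ∈ P, ∀ y ∈ E, y ≠ g → y ≠ d → x ≠ y ∧ ¬ G.Adj x y := fun x hx y hy hyg hyd =>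
      ⟨fun e => hEP y hy (e ▸ hx), fun e => hE2 y hy hyg hyd x hx e.symm⟩
    refine hG.theta_false k1' k2' hE hgd hgd' ?_ ?_ ?_
    · intro x hx y hy; apply h4 <;> grind
    · intro x hx y hy; apply key <;> grind
    · intro x hx y hy; apply key <;> grind

lemma PS.glue_vertex (hS : PS G S u v) (hT : PS G T v w)
    (h : ∀ x ∈ S, ∀ y ∈ T, x ≠ v → y ≠ v → x ≠ y ∧ ¬ G.Adj x y) : PS G (S ∪ T) u w := by
  have hv := hS.right_mem
  cases hT with
  | single v => rwa [Set.union_eq_self_of_subset_right (by simpa using hv)]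
  | @cons T v w' w hT hvT hvw' hn =>
    have : S ∪ insert v T = S ∪ T := by ext x; simp only [Set.mem_union, Set.mem_insert_iff]; grind
    rw [this]
    have hw' := hT.left_mem
    refine hS.glue hT fun x hx y hy => ?_
    have hyv : y ≠ v := fun e => hvT (e ▸ hy)
    by_cases hxv : x = v
    · subst hxv
      exact ⟨hyv.symm, fun e => ⟨rfl, hn y hy e⟩, fun e => e.2 ▸ hvw'⟩
    · have := h x hx y (.inr hy) hxv hyv
      exact ⟨this.1, fun e => absurd e this.2, fun e => absurd e.1 hxv⟩

/-! ### The rooted configuration left when the pyramid is cut at the roots. -/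

/-- Three disjoint paths `B i` from `x i` to `b i`; the triangle of the vertices `b i` consists of
the only edges between different paths. -/
structure Rungs (G : SimpleGraph V) (x : Fin 3 → V) (D : Set V) (B : Fin 3 → Set V)
    (b : Fin 3 → V) : Prop where
  path : ∀ i, PS G (B i) (x i) (b i)
  subset : ∀ i, B i ⊆ D ∪ {x i}
  link : ∀ i j, i ≠ j → Link G (B i) (B j) (b i) (b j)

/-- Three paths `Q i` from the neighbors `q i` of `a` to vertices `x i`; the set `D` of the other
vertices is attached to the paths only at the vertices `x i`. -/
structure Rooted (G : SimpleGraph V) (a : V) (q x : Fin 3 → V) (Q : Fin 3 → Set V) (D : Set V) :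
    Prop where
  free : C4FreeOddSignable G
  path : ∀ i, PS G (Q i) (q i) (x i)
  anti : ∀ i j, i ≠ j → Anti G (Q i) (Q j)
  apex : ∀ i, a ∉ Q i
  adj_apex : ∀ v, G.Adj a v ↔ ∃ i, v = q i
  mem_D : ∀ v, v ∈ D ↔ v ≠ a ∧ ∀ i, v ∉ Q i
  deg : ∀ i, ∀ v ∈ Q i, v ≠ x i → ∀ y ∈ D, ¬ G.Adj v y
  hub : ∀ i, ¬ IsHub G (x i)
  cross : ∀ v, ¬ IsCrossEdge G a v
  rungs : ∃ (B : Fin 3 → Set V) (b : Fin 3 → V), Rungs G x D B b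

namespace Rooted

variable {a : V} {q x : Fin 3 → V} {Q : Fin 3 → Set V} {D : Set V}

lemma mem_x (h : Rooted G a q x Q D) (i : Fin 3) : x i ∈ Q i := (h.path i).right_mem

lemma mem_q (h : Rooted G a q x Q D) (i : Fin 3) : q i ∈ Q i := (h.path i).left_mem

lemma not_mem_D (h : Rooted G a q x Q D) {i : Fin 3} {v : V} (hv : v ∈ Q i) : v ∉ D :=
  fun hD => ((h.mem_D v).1 hD).2 i hv

lemma x_not_mem_D (h : Rooted G a q x Q D) (i : Fin 3) : x i ∉ D := h.not_mem_D (h.mem_x i)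

lemma apex_not_mem_D (h : Rooted G a q x Q D) : a ∉ D := fun hD => ((h.mem_D a).1 hD).1 rfl

lemma not_adj_apex (h : Rooted G a q x Q D) (hv : v ∈ D) : ¬ G.Adj a v := fun e => by
  obtain ⟨i, rfl⟩ := (h.adj_apex v).1 e
  exact h.not_mem_D (h.mem_q i) hv

lemma x_ne (h : Rooted G a q x Q D) {i j : Fin 3} (hij : i ≠ j) : x i ≠ x j :=
  (h.anti i j hij _ (h.mem_x i) _ (h.mem_x j)).1

lemma x_not_adj (h : Rooted G a q x Q D) (i j : Fin 3) : ¬ G.Adj (x i) (x j) := by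
  by_cases hij : i = j
  · subst hij; simp
  · exact (h.anti i j hij _ (h.mem_x i) _ (h.mem_x j)).2

lemma adj_apex_Q (h : Rooted G a q x Q D) {i : Fin 3} (hv : v ∈ Q i) : G.Adj a v ↔ v = q i := by
  rw [h.adj_apex]
  constructor
  · rintro ⟨j, rfl⟩
    by_cases hij : i = j
    · rw [hij]
    · exact absurd rfl (h.anti i j hij _ hv _ (h.mem_q j)).1
  · exact fun e => ⟨i, e⟩

lemma Q_eq (h : Rooted G a q x Q D) {j : Fin 3} (hj : G.Adj a (x j)) : x j = q j ∧ Q j = {x j} := by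
  have e := (h.adj_apex_Q (h.mem_x j)).1 hj
  refine ⟨e, ?_⟩
  have := h.path j
  rw [← e] at this
  exact this.eq_singleton

/-- A path in `D` extended by the paths `Q i` and `Q k`. -/
lemma extend (h : Rooted G a q x Q D) {i k : Fin 3} (hik : i ≠ k) {P : Set V}
    (hP : PS G P (x i) (x k)) (hPD : P ⊆ D ∪ {x i, x k}) :
    PS G (Q i ∪ (P ∪ Q k)) (q i) (q k) := by
  have hxi := h.mem_x i
  have hxk := h.mem_x k
  have hD := fun i v hv => h.not_mem_D (i := i) (v := v) hv
  have ha := h.anti i k hik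
  have ha' := h.anti k i hik.symm
  have hdi := h.deg i
  have hdk := h.deg k
  refine (h.path i).glue_vertex (hP.glue_vertex (h.path k).symm ?_) ?_
  · intro u hu v hv hne hne'
    rcases hPD hu with hu | rfl | rfl
    · exact ⟨fun e => hD k v hv (e ▸ hu), fun e => hdk v hv hne' u hu e.symm⟩
    · exact ha _ hxi v hv
    · exact absurd rfl hne
  · rintro u hu v (hv | hv) hne hne'
    · rcases hPD hv with hv | rfl | rfl
      · exact ⟨fun e => hD i u hu (e ▸ hv), fun e => hdi u hu hne v hv e⟩
      · exact absurd rfl hne'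
      · exact ha u hu _ hxk
    · exact ha u hu v hv

/-! ### Induced paths between two roots that pass through the third. -/

/-- A pyramid in which `x j` is adjacent to the apex and to two consecutive vertices of the path
from `q i` to `q k`, together with a path that makes it a loaded pyramid. -/
lemma isHub_of_loaded (h : Rooted G a q x Q D) {i j k : Fin 3}
    (hik : i ≠ k) (haj : G.Adj a (x j)) {S₁ S₂ R : Set V} {w w' z p : V}
    (hS₁ : PS G S₁ (q i) w) (hS₂ : PS G S₂ w' (q k)) (hl : Link G S₁ S₂ w w')
    (hw : w ∈ D) (hw' : w' ∈ D) (haS₁ : a ∉ S₁) (haS₂ : a ∉ S₂)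
    (ha₁ : ∀ y ∈ S₁, G.Adj a y ↔ y = q i) (ha₂ : ∀ y ∈ S₂, G.Adj a y ↔ y = q k)
    (hx₁ : ∀ y ∈ S₁, G.Adj (x j) y ↔ y = w) (hx₂ : ∀ y ∈ S₂, G.Adj (x j) y ↔ y = w')
    (hxS₁ : x j ∉ S₁) (hxS₂ : x j ∉ S₂)
    (hR : PS G R z p) (hRD : R ⊆ D) (hxR : ∀ y ∈ R, G.Adj (x j) y ↔ y = z) (hRS₁ : Anti G R S₁)
    (hRS₂ : ∀ y ∈ R, y ∉ S₂) (hp : ∃ y ∈ S₂, y ≠ w' ∧ G.Adj p y)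
    (hRp : ∀ y ∈ R, y ≠ p → ∀ v ∈ S₂, v ≠ w' → ¬ G.Adj y v) : IsHub G (x j) := by
  have hwS := hS₁.right_mem
  have hwS' := hS₂.left_mem
  have haw := h.not_adj_apex hw
  have haw' := h.not_adj_apex hw'
  have hane : a ≠ x j := haj.ne
  have hq₁ := hS₁.left_mem
  have hq₂ := hS₂.right_mem
  have k1 : PS G (insert a S₁) a w := .cons hS₁ haS₁ ((ha₁ _ hq₁).2 rfl) fun y hy => (ha₁ y hy).1
  have k2 : PS G (insert a S₂) a w' :=
    .cons hS₂.symm haS₂ ((ha₂ _ hq₂).2 rfl) fun y hy => (ha₂ y hy).1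
  have k3 : PS G {a, x j} a (x j) := .cons (.single _) (by simpa using hane) haj (by simp)
  have h12 : IsHole G (insert a S₂ ∪ insert a S₁) := by
    have := (hS₁.glue hS₂ hl).isHole_insert (t := a) (by
      have := h.anti i k hik _ (h.mem_q i) _ (h.mem_q k); exact this.1) (by
      have := h.anti i k hik _ (h.mem_q i) _ (h.mem_q k); exact this.2)
      (by rintro (h | h); exacts [haS₁ h, haS₂ h]) (by
        rintro y (hy | hy)
        · rw [ha₁ y hy]
          exact ⟨.inl, fun e => e.resolve_right fun e => (hl y hy y (e ▸ hq₂)).1 rfl⟩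
        · rw [ha₂ y hy]
          exact ⟨.inr, fun e => e.resolve_left fun e => (hl y (e ▸ hq₁) y hy).1 rfl⟩)
    convert this using 1
    ext y; simp only [Set.mem_union, Set.mem_insert_iff]; tauto
  have h13 : ∀ {S : Set V} {w : V}, PS G (insert a S) a w → ¬ G.Adj a w → a ≠ w → x j ∉ S →
      (∀ y ∈ S, G.Adj (x j) y ↔ y = w) → a ∉ S → IsHole G (insert a S ∪ {a, x j}) := by
    intro S w k haw hne hx hxS haS
    have := k.isHole_insert (t := x j) hne haw (by
      rintro (h | h); exacts [hane h.symm, hx h]) (by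
        rintro y (rfl | hy)
        · exact ⟨fun _ => .inl rfl, fun _ => haj.symm⟩
        · rw [hxS y hy]
          exact ⟨.inr, fun e => e.resolve_left fun e => haS (e ▸ hy)⟩)
    convert this using 1
    ext y; simp only [Set.mem_union, Set.mem_insert_iff, Set.mem_singleton_iff]; tauto
  have g1 := h13 k1 haw (fun e => haS₁ (e ▸ hwS)) hxS₁ hx₁ haS₁
  have g2 := h13 k2 haw' (fun e => haS₂ (e ▸ hwS')) hxS₂ hx₂ haS₂
  have e1 : G.Adj (x j) w := (hx₁ w hwS).2 rfl
  have e2 : G.Adj (x j) w' := (hx₂ w' hwS').2 rfl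
  have e3 : G.Adj w w' := ((hl w hwS w' hwS').2).2 ⟨rfl, rfl⟩
  obtain ⟨p₁, hp₁, v₁⟩ := k1.exists_walk
  obtain ⟨p₂, hp₂, v₂⟩ := k2.exists_walk
  obtain ⟨p₃, hp₃, v₃⟩ := k3.exists_walk
  obtain ⟨r, hr, rfl⟩ := hR.exists_walk
  let P : ∀ i, G.Walk a ((![w', x j, w] : Fin 3 → V) i) := fun i => match i with
    | 0 => p₂
    | 1 => p₃
    | 2 => p₁
  have hz := hR.left_mem
  have hp' := hR.right_mem
  have haR : ∀ y ∈ verts r, a ≠ y ∧ ¬ G.Adj a y := fun y hy =>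
    ⟨fun e => h.apex_not_mem_D (e ▸ hRD hy), h.not_adj_apex (hRD hy)⟩
  have hxRne : ∀ y ∈ verts r, x j ≠ y := fun y hy e => h.x_not_mem_D j (e ▸ hRD hy)
  -- The base is ordered so that the corner `x j` has index `1`, the path through `S₂`, where `R`
  -- arrives, has index `0`, and the path through `S₁`, which `R` avoids, has index `2`.
  refine .inr ⟨a, ![w', x j, w], P, z, p, r, ?_, rfl⟩
  have hpyr : IsPyramid G a ![w', x j, w] P := by
    refine ⟨?_, ?_, ?_⟩
    · intro m n hmn
      fin_cases m <;> fin_cases n <;> first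
        | exact absurd rfl hmn
        | exact e1
        | exact e2
        | exact e3
        | exact e1.symm
        | exact e2.symm
        | exact e3.symm
    · intro m; fin_cases m <;> assumption
    · intro m n hmn
      fin_cases m <;> fin_cases n <;> first
        | exact absurd rfl hmn
        | (show IsHole G (verts p₂ ∪ verts p₃); rwa [v₂, v₃])
        | (show IsHole G (verts p₃ ∪ verts p₂); rwa [v₂, v₃, Set.union_comm])
        | (show IsHole G (verts p₁ ∪ verts p₃); rwa [v₁, v₃])
        | (show IsHole G (verts p₃ ∪ verts p₁); rwa [v₁, v₃, Set.union_comm])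
        | (show IsHole G (verts p₂ ∪ verts p₁); rwa [v₁, v₂])
        | (show IsHole G (verts p₁ ∪ verts p₂); rwa [v₁, v₂, Set.union_comm])
  refine ⟨hpyr, haj, hr, ((hxR z hz).2 rfl).symm, ?_, ?_, ?_, ?_⟩
  · obtain ⟨y, hy, hyw, e⟩ := hp
    refine ⟨y, ⟨?_, ?_⟩, e⟩
    · show y ∈ verts p₂
      rw [v₂]; exact .inr hy
    · rintro (rfl | e')
      · exact haS₂ hy
      · exact hyw e'
  · show Anticomplete G (verts p₁) (verts r)
    rw [v₁]
    refine Anti.anticomplete ?_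
    rintro y (rfl | hy) v hv
    · exact haR v hv
    · exact hRS₁.symm y hy v hv
  · show Anticomplete G {x j} (verts r \ {z})
    refine Anti.anticomplete ?_
    rintro y rfl v ⟨hv, hvz⟩
    exact ⟨hxRne v hv, fun e => hvz ((hxR v hv).1 e)⟩
  · show Anticomplete G (verts p₂ \ {w'}) (verts r \ {p})
    rw [v₂]
    refine Anti.anticomplete ?_
    rintro y ⟨rfl | hy, hyw⟩ v ⟨hv, hvp⟩
    · exact haR v hv
    · exact ⟨fun e => hRS₂ v hv (e ▸ hy), fun e => hRp v hv hvp y hy hyw e.symm⟩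


/-- The detour through `T`, closed by `a`, forms with `x j` a pyramid based at `w`, `w'`, `x j`. The
part `R'` cut off by the detour still contains the neighbor `z` of `x j`; following it from `z`
until it first sees `S₂ \ {w'}` gives the path that loads the pyramid. It stays away from `S₁`,
because `R`, `Q k` and `t'` all lie in `S₂`. -/
lemma isHub_of_side (h : Rooted G a q x Q D) {i j k : Fin 3}
    (hij : i ≠ j) (hik : i ≠ k) (hjk : j ≠ k) (haj : G.Adj a (x j))
    {R₁ T R R' S₁ S₂ : Set V} {w w' z t t' s v : V}
    (hR₁D : R₁ ⊆ D ∪ {x i}) (hxiR₁ : x i ∈ R₁) (hT : PS G T t t') (hTD : T ⊆ D)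
    (hR : PS G R (x k) s) (hR' : PS G R' v z) (hRR' : Link G R R' s v)
    (hRD : R ∪ R' ⊆ D ∪ {x k}) (hR₁R : Anti G R₁ (R ∪ R')) (hTR : ∀ y ∈ T, y ∉ R ∪ R')
    (hTR' : ∀ y ∈ T, (∃ r ∈ R ∪ R', G.Adj y r) → y = t') (ht's : ∀ y ∈ R, G.Adj t' y ↔ y = s)
    (hxR : ∀ y ∈ R ∪ R', G.Adj (x j) y ↔ y = z)
    (hS₁ : PS G S₁ (q i) w) (hS₂ : PS G S₂ w' (q k)) (hl : Link G S₁ S₂ w w')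
    (hS : ∀ y, y ∈ S₁ ∪ S₂ ↔ (y ∈ Q i ∨ y ∈ R₁ ∨ y ∈ T ∨ y ∈ R ∨ y ∈ Q k))
    (hx : ∀ y ∈ S₁ ∪ S₂, G.Adj (x j) y ↔ (y = w ∨ y = w')) : IsHub G (x j) := by
  have hD := fun i v hv => h.not_mem_D (i := i) (v := v) hv
  have haD := h.apex_not_mem_D
  have haQ := h.apex
  have hxj := h.mem_x j
  have hxk := h.mem_x k
  have hxi := h.mem_x i
  have hji := h.anti j i hij.symm _ hxj
  have hjk' := h.anti j k hjk _ hxj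
  have hki := h.anti k i hik.symm _ hxk
  have hxjD := h.x_not_mem_D j
  have hzR' := hR'.right_mem
  have hsR := hR.right_mem
  have hzR : z ∉ R := fun hz => (hRR' z hz z hzR').1 rfl
  have hmem : ∀ y ∈ S₁ ∪ S₂, y ∈ Q i ∨ y ∈ Q k ∨ y ∈ D := by
    intro y hy
    rcases (hS y).1 hy with hy | hy | hy | hy | hy
    · exact .inl hy
    · rcases hR₁D hy with hy | rfl
      exacts [.inr (.inr hy), .inl hxi]
    · exact .inr (.inr (hTD hy))
    · rcases hRD (.inl hy) with hy | rfl
      exacts [.inr (.inr hy), .inr (.inl hxk)]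
    · exact .inr (.inl hy)
  have hxjS : x j ∉ S₁ ∪ S₂ := fun hy => by
    rcases hmem _ hy with hy | hy | hy
    · exact (hji _ hy).1 rfl
    · exact (hjk' _ hy).1 rfl
    · exact hxjD hy
  have haS : a ∉ S₁ ∪ S₂ := fun hy => by
    rcases hmem _ hy with hy | hy | hy
    exacts [haQ i hy, haQ k hy, haD hy]
  have hwS := hS₁.right_mem
  have hwS' := hS₂.left_mem
  have hq₁ := hS₁.left_mem
  have hq₂ := hS₂.right_mem
  have hwD : ∀ y ∈ S₁ ∪ S₂, G.Adj (x j) y → y ∈ D := by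
    intro y hy e
    rcases hmem _ hy with hy | hy | hy
    · exact absurd e (hji _ hy).2
    · exact absurd e (hjk' _ hy).2
    · exact hy
  have haj' := h.Q_eq haj
  have hcov : ∀ m : Fin 3, m = i ∨ m = j ∨ m = k := by omega
  have hdisj : ∀ y ∈ S₁, y ∉ S₂ := fun y hy hy' => (hl y hy y hy').1 rfl
  have ha : ∀ y ∈ S₁ ∪ S₂, G.Adj a y ↔ (y = q i ∨ y = q k) := by
    intro y hy
    rw [h.adj_apex]
    constructor
    · rintro ⟨m, rfl⟩
      rcases hcov m with rfl | rfl | rfl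
      · exact .inl rfl
      · exact absurd (haj'.1 ▸ hy) hxjS
      · exact .inr rfl
    · rintro (rfl | rfl) <;> exact ⟨_, rfl⟩
  -- the part of the path from `s` to `q k` lies in `S₂`
  have hxw := (hx w (.inl hwS)).2 (.inl rfl)
  have hxw' := (hx w' (.inr hwS')).2 (.inr rfl)
  have hdk := h.deg k
  have hRk : PS G (R ∪ Q k) s (q k) := by
    refine hR.symm.glue_vertex (h.path k).symm fun y hy y' hy' hne hne' => ?_
    have hyD : y ∈ D := (hRD (.inl hy)).resolve_right hne
    exact ⟨fun e => hD k y' hy' (e ▸ hyD), fun e => hdk y' hy' hne' y hyD e.symm⟩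
  have hRkw : ∀ y ∈ R ∪ Q k, ¬ G.Adj (x j) y := by
    rintro y (hy | hy) e
    · exact hzR ((hxR y (.inl hy)).1 e ▸ hy)
    · exact (hjk' y hy).2 e
  have hRkS : R ∪ Q k ⊆ S₂ := by
    refine hRk.subset_of_link (fun y hy => (hS y).2 ?_) hl hq₂ (.inl fun hw => hRkw w hw hxw)
    rcases hy with hy | hy <;> simp [hy]
  have hsS := hRkS (.inl hsR)
  have ht' := hT.right_mem
  -- If `t'` were in `S₁`, its edge to `s ∈ S₂` would have to be `ww'`, making `s` a neighbor of `x
  -- j`.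
  have ht'S : t' ∈ S₂ := by
    have := (hS t').2 (.inr (.inr (.inl ht')))
    refine this.resolve_left fun h1 => ?_
    have := ((hl t' h1 s hsS).2.1 ((ht's s hsR).2 rfl)).2
    exact hRkw s (.inl hsR) (this ▸ hxw')
  -- an initial segment of the path from `z`
  have hsR' : s ≠ w' := fun e => hRkw s (.inl hsR) (e ▸ hxw')
  have hv := hR'.left_mem
  -- At the latest, `v` qualifies, as it is adjacent to `s`. The vertex `w'` is left out because the
  -- path that loads a pyramid may see this base vertex anywhere.
  obtain ⟨p, F, hF, hFR, hF1, -⟩ := hR'.symm.first (A := {y | ∃ y' ∈ S₂, y' ≠ w' ∧ G.Adj y y'})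
    ⟨v, hv, s, hsS, hsR', ((hRR' s hsR v hv).2.2 ⟨rfl, rfl⟩).symm⟩
  have hxkR := hR.left_mem
  have hFS : ∀ y ∈ F, y ∉ S₁ ∪ S₂ := by
    intro y hy hyS
    have hy' := hFR hy
    have hyR : y ∉ R := fun h => (hRR' y h y hy').1 rfl
    have hyD : y ∈ D := (hRD (.inr hy')).resolve_right fun e => hyR (e ▸ hxkR)
    rcases (hS y).1 hyS with h | h | h | h | h
    · exact hD i y h hyD
    · exact (hR₁R y h y (.inr hy')).1 rfl
    · exact hTR y h (.inr hy')
    · exact hyR h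
    · exact hD k y h hyD
  have hFD : F ⊆ D := by
    intro y hy
    have hyR : y ∉ R := fun h => (hRR' y h y (hFR hy)).1 rfl
    exact (hRD (.inr (hFR hy))).resolve_right fun e => hyR (e ▸ hxkR)
  have hdi := h.deg i
  refine h.isHub_of_loaded hik haj hS₁ hS₂ hl (hwD w (.inl hwS) hxw) (hwD w' (.inr hwS') hxw')
    (fun h => haS (.inl h)) (fun h => haS (.inr h)) ?_ ?_ ?_ ?_ (fun h => hxjS (.inl h))
    (fun h => hxjS (.inr h)) hF hFD (fun y hy => hxR y (.inr (hFR hy))) ?_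
    (fun y hy hy' => hFS y hy (.inr hy')) ((hF1 p hF.right_mem).2 rfl) ?_
  · intro y hy
    rw [ha y (.inl hy)]
    exact ⟨fun e => e.resolve_right fun e => hdisj y hy (e ▸ hq₂), .inl⟩
  · intro y hy
    rw [ha y (.inr hy)]
    exact ⟨fun e => e.resolve_left fun e => hdisj y (e ▸ hq₁) hy, .inr⟩
  · intro y hy
    rw [hx y (.inl hy)]
    exact ⟨fun e => e.resolve_right fun e => hdisj y hy (e ▸ hwS'), .inl⟩
  · intro y hy
    rw [hx y (.inr hy)]
    exact ⟨fun e => e.resolve_left fun e => hdisj y (e ▸ hwS) hy, .inr⟩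
  · intro y hy y' hy'
    refine ⟨fun e => hFS y hy (.inl (e ▸ hy')), fun e => ?_⟩
    have hyR' := hFR hy
    rcases (hS y').1 (.inl hy') with h1 | h1 | h1 | h1 | h1
    · by_cases hy'x : y' = x i
      · exact (hR₁R y' (hy'x ▸ hxiR₁) y (.inr hyR')).2 e.symm
      · exact hdi y' h1 hy'x y (hFD hy) e.symm
    · exact (hR₁R y' h1 y (.inr hyR')).2 e.symm
    · have := hTR' y' h1 ⟨y, .inr hyR', e.symm⟩
      exact hdisj y' hy' (this ▸ ht'S)
    · exact hdisj y' hy' (hRkS (.inl h1))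
    · exact hdisj y' hy' (hRkS (.inr h1))
  · intro y hy hyp y' hy' hyw e
    exact hyp ((hF1 y hy).1 ⟨y', hy', hyw, e⟩)


/-- A path `T` in `D` to the path from `z` to `x k` attaches to the path from `x i` to `y` at two
consecutive vertices, if `x j` has neighbors `a`, `y`, `z`, but none in `T`. -/
lemma attach_side (h : Rooted G a q x Q D) {i j k : Fin 3}
    (hij : i ≠ j) (hik : i ≠ k) (hjk : j ≠ k) (haj : G.Adj a (x j))
    {R R' T : Set V} {y z t t' : V} (hR : PS G R (x i) y) (hR' : PS G R' z (x k))
    (hRD : R ⊆ D ∪ {x i}) (hRD' : R' ⊆ D ∪ {x k}) (hRR' : Anti G R R')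
    (hxR : ∀ v ∈ R, G.Adj (x j) v ↔ v = y) (hxR' : ∀ v ∈ R', G.Adj (x j) v ↔ v = z)
    (hT : PS G T t t') (hTD : T ⊆ D) (hTR : ∀ v ∈ T, v ∉ R ∧ v ∉ R')
    (ht : ∀ v ∈ T, (∃ r ∈ R, G.Adj v r) ↔ v = t) (ht' : ∀ v ∈ T, (∃ r ∈ R', G.Adj v r) ↔ v = t')
    (hxT : ∀ v ∈ T, ¬ G.Adj (x j) v) (hty : ∃ r ∈ R, r ≠ y ∧ G.Adj t r)
    (hk : ¬ G.Adj a (x k) ∨ ∃ r ∈ R', r ≠ x k ∧ G.Adj t' r) :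
    ∃ r r' S₁ S₂, PS G S₁ y r ∧ PS G S₂ r' a ∧ (∀ v, v ∈ S₁ ∪ S₂ ↔ (v ∈ R ∨ v ∈ Q i ∨ v = a)) ∧
      Link G S₁ S₂ r r' ∧ r ∈ R ∧ r' ∈ R ∧ ∀ v ∈ S₁ ∪ S₂, G.Adj t v ↔ (v = r ∨ v = r') := by
  have hD := fun i v hv => h.not_mem_D (i := i) (v := v) hv
  have haD := h.apex_not_mem_D
  have hnaD : ∀ v ∈ D, ¬ G.Adj a v := fun v hv => h.not_adj_apex hv
  have hxj := h.mem_x j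
  have hxi := h.mem_x i
  have hji := h.anti j i hij.symm _ hxj
  have hjk' := h.anti j k hjk _ hxj
  have hxjD := h.x_not_mem_D j
  have hdi := h.deg i
  have hyR := hR.right_mem
  have hzR' := hR'.left_mem
  have hxiR := hR.left_mem
  have htT := hT.left_mem
  have htT' := hT.right_mem
  have haQ : ∀ {v}, v ∈ Q i → (G.Adj a v ↔ v = q i) := fun hv => h.adj_apex_Q hv
  have hane : ∀ m, a ≠ x m := fun m e => h.apex m (e ▸ h.mem_x m)
  -- the path closed by `x j` to a hole
  have k1 : PS G (R ∪ Q i) y (q i) := by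
    refine hR.symm.glue_vertex (h.path i).symm fun v hv v' hv' hne hne' => ?_
    have hvD : v ∈ D := (hRD hv).resolve_right hne
    exact ⟨fun e => hD i v' hv' (e ▸ hvD), fun e => hdi v' hv' hne' v hvD e.symm⟩
  have haRQ : a ∉ R ∪ Q i := by
    rintro (h1 | h1)
    · rcases hRD h1 with h2 | h2
      exacts [haD h2, hane i h2]
    · exact h.apex i h1
  have k2 : PS G (insert a (R ∪ Q i)) y a := by
    refine k1.concat haRQ ((haQ (h.mem_q i)).2 rfl).symm ?_
    rintro v (hv | hv) e
    · rcases hRD hv with h2 | h2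
      · exact absurd e.symm (hnaD v h2)
      · exact (haQ (by rw [h2]; exact hxi)).1 e.symm
    · exact (haQ hv).1 e.symm
  have hxjR : x j ∉ R ∪ Q i := by
    rintro (h1 | h1)
    · rcases hRD h1 with h2 | h2
      exacts [hxjD h2, h.x_ne hij.symm h2]
    · exact (hji _ h1).1 rfl
  have htD := hTD htT
  have htR : ∀ v ∈ insert a (R ∪ Q i), G.Adj t v → v ∈ R := by
    rintro v (rfl | hv | hv) e
    · exact absurd e.symm (hnaD t htD)
    · exact hv
    · by_cases hvx : v = x i
      · exact hvx ▸ hxiR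
      · exact absurd e.symm (hdi v hv hvx t htD)
  -- the path from `t` to `x j`
  obtain ⟨s, F, hF, hFR, hFs, hF'⟩ := hR'.first (A := {v | G.Adj t' v})
    (by obtain ⟨r, hr, e⟩ := (ht' t' htT').2 rfl; exact ⟨r, hr, e⟩)
  have k3 : PS G (T ∪ F) t z := by
    refine hT.glue hF.symm fun v hv v' hv' => ⟨fun e => (hTR v hv).2 (e ▸ hFR hv'), fun e => ?_, ?_⟩
    · obtain rfl := (ht' v hv).1 ⟨v', hFR hv', e⟩
      exact ⟨rfl, (hFs v' hv').1 e⟩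
    · rintro ⟨rfl, rfl⟩
      exact (hFs _ hv').2 rfl
  have hxjF : x j ∉ T ∪ F := by
    rintro (h1 | h1)
    · exact hxjD (hTD h1)
    · rcases hRD' (hFR h1) with h2 | h2
      exacts [hxjD h2, h.x_ne hjk h2]
  have hzF := hF.left_mem
  have k4 : PS G (insert (x j) (T ∪ F)) t (x j) := by
    refine k3.concat hxjF ((hxR' z hzR').2 rfl).symm ?_
    rintro v (hv | hv) e
    · exact absurd e.symm (hxT v hv)
    · exact (hxR' v (hFR hv)).1 e.symm
  have hxkR' := hR'.right_mem
  have hdQ : ∀ v ∈ R', ∀ v' ∈ Q i, v ≠ v' ∧ ¬ G.Adj v v' := by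
    intro v hv v' hv'
    rcases hRD' hv with h2 | h2
    · refine ⟨fun e => hD i v' hv' (e ▸ h2), fun e => ?_⟩
      by_cases hvx : v' = x i
      · exact (hRR' v' (hvx ▸ hxiR) v hv).2 e.symm
      · exact hdi v' hv' hvx v h2 e.symm
    · rw [h2]; exact h.anti k i hik.symm _ (h.mem_x k) v' hv'
  have m1 : x j ∉ insert a (R ∪ Q i) := by
    rintro (h1 | h1)
    exacts [hane j h1.symm, hxjR h1]
  have m2 : ∀ v ∈ insert a (R ∪ Q i), G.Adj (x j) v ↔ (v = y ∨ v = a) := by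
    rintro v (rfl | hv | hv)
    · exact ⟨fun _ => .inr rfl, fun _ => haj.symm⟩
    · rw [hxR v hv]
      exact ⟨.inl, fun e => e.resolve_right fun e => haRQ (.inl (e ▸ hv))⟩
    · refine ⟨fun e => absurd e (hji v hv).2, ?_⟩
      rintro (rfl | rfl)
      · exact absurd ((hxR _ hyR).2 rfl) (hji _ hv).2
      · exact absurd (.inr hv) haRQ
  have m3 : t ≠ x j := by
    exact fun e => hxjD (e ▸ htD)
  have m4 : ∀ v ∈ insert (x j) (T ∪ F), v ∉ insert a (R ∪ Q i) := by
    rintro v (rfl | hv | hv) hv'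
    · rcases hv' with h1 | h1
      exacts [hane j h1.symm, hxjR h1]
    · rcases hv' with rfl | h1 | h1
      exacts [haD (hTD hv), (hTR v hv).1 h1, hD i v h1 (hTD hv)]
    · rcases hv' with rfl | h1 | h1
      · rcases hRD' (hFR hv) with h2 | h2
        exacts [haD h2, hane k h2]
      · exact (hRR' v h1 v (hFR hv)).1 rfl
      · exact (hdQ v (hFR hv) v h1).1 rfl
  have m5 : ∀ v ∈ insert (x j) (T ∪ F), v ≠ t → v ≠ x j →
      ∀ y' ∈ insert a (R ∪ Q i), ¬ G.Adj v y' := by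
    rintro v (rfl | hv | hv) hvt hvx y' hy' e
    · exact hvx rfl
    · have hvD := hTD hv
      rcases hy' with rfl | h1 | h1
      · exact hnaD v hvD e.symm
      · exact hvt ((ht v hv).1 ⟨y', h1, e⟩)
      · by_cases hvx : y' = x i
        · exact hvt ((ht v hv).1 ⟨y', hvx ▸ hxiR, e⟩)
        · exact hdi y' h1 hvx v hvD e.symm
    · rcases hy' with rfl | h1 | h1
      · rcases hRD' (hFR hv) with h2 | h2
        · exact hnaD v h2 e.symm
        · obtain rfl : v = x k := h2
          rcases hk with hk | ⟨r, hr, hrk, hrt⟩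
          · exact hk e.symm
          · rcases hF' with ⟨rfl, rfl⟩ | ⟨w, S₂, g1, g2, g3⟩
            · exact hrk ((hFs r hr).1 hrt)
            · exact (g3 _ hv _ g1.right_mem).1 rfl
      · exact (hRR' y' h1 v (hFR hv)).2 e.symm
      · exact (hdQ v (hFR hv) y' h1).2 e
  have m6 : ∃ v ∈ insert a (R ∪ Q i), G.Adj t v := by
    obtain ⟨r, hr, -, e⟩ := hty
    exact ⟨r, .inr (.inl hr), e⟩
  -- A single neighbor at `y` or `a` contradicts `hty`, and the third outcome needs `t` adjacent to
  -- `x j`. Two consecutive neighbors remain.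
  rcases h.free.attach k2 m1 m2 k4 m3 m4 m5 m6 with
    ⟨w, hw, h1⟩ | ⟨r, r', S₁, S₂, h1, h2, h3, h4, h5⟩ | ⟨h1, -⟩
  · exfalso
    obtain ⟨r, hr, hry, e⟩ := hty
    have := (h1 r (.inr (.inl hr))).1 e
    rcases hw with rfl | rfl
    · exact hry this
    · exact haRQ (.inl (this ▸ hr))
  · have hr := (h5 r (h3 ▸ .inl h1.right_mem)).2 (.inl rfl)
    have hr' := (h5 r' (h3 ▸ .inr h2.left_mem)).2 (.inr rfl)
    refine ⟨r, r', S₁, S₂, h1, h2, fun v => ?_, h4, htR r (h3 ▸ .inl h1.right_mem) hr,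
      htR r' (h3 ▸ .inr h2.left_mem) hr', h3 ▸ h5⟩
    rw [← h3]; simp only [Set.mem_union, Set.mem_insert_iff]; tauto
  · exact absurd h1.symm (hxT t htT)


/-- Once the edge between `a` and `x j` is deleted, the path from `r'` to `s'` through `a`, the path
from `r` to `s` through `x j`, and `T` form a near-prism with triangles `r' r t` and `s' s t'`. Both
`a` and `x j` are interior. Since `T` may be one vertex, a prism cannot be promised. -/
lemma isCrossEdge_of_sides (h : Rooted G a q x Q D) {i j k : Fin 3}
    (hij : i ≠ j) (hik : i ≠ k) (hjk : j ≠ k) (haj : G.Adj a (x j))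
    {R R' T S₁ S₂ S₃ S₄ : Set V} {y z t t' r r' s s' : V} (hyR : y ∈ R) (hzR' : z ∈ R')
    (hxiR : x i ∈ R) (hxkR' : x k ∈ R')
    (hRD : R ⊆ D ∪ {x i}) (hRD' : R' ⊆ D ∪ {x k}) (hRR' : Anti G R R')
    (hxR : ∀ v ∈ R, G.Adj (x j) v ↔ v = y) (hxR' : ∀ v ∈ R', G.Adj (x j) v ↔ v = z)
    (hT : PS G T t t') (hTD : T ⊆ D) (hTR : ∀ v ∈ T, v ∉ R ∧ v ∉ R')
    (ht : ∀ v ∈ T, (∃ r ∈ R, G.Adj v r) ↔ v = t) (ht' : ∀ v ∈ T, (∃ r ∈ R', G.Adj v r) ↔ v = t')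
    (hxT : ∀ v ∈ T, ¬ G.Adj (x j) v)
    (h₁ : PS G S₁ y r) (h₂ : PS G S₂ r' a) (h₁₂ : ∀ v, v ∈ S₁ ∪ S₂ ↔ (v ∈ R ∨ v ∈ Q i ∨ v = a))
    (hl : Link G S₁ S₂ r r') (hr : r ∈ R) (hr' : r' ∈ R)
    (htS : ∀ v ∈ S₁ ∪ S₂, G.Adj t v ↔ (v = r ∨ v = r'))
    (h₃ : PS G S₃ z s) (h₄ : PS G S₄ s' a) (h₃₄ : ∀ v, v ∈ S₃ ∪ S₄ ↔ (v ∈ R' ∨ v ∈ Q k ∨ v = a))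
    (hl' : Link G S₃ S₄ s s') (hs : s ∈ R') (hs' : s' ∈ R')
    (htS' : ∀ v ∈ S₃ ∪ S₄, G.Adj t' v ↔ (v = s ∨ v = s')) : IsCrossEdge G a (x j) := by
  have hD := fun i v hv => h.not_mem_D (i := i) (v := v) hv
  have haD := h.apex_not_mem_D
  have hnaD : ∀ v ∈ D, ¬ G.Adj a v := fun v hv => h.not_adj_apex hv
  have hxj := h.mem_x j
  have hji := h.anti j i hij.symm _ hxj
  have hjk' := h.anti j k hjk _ hxj
  have hxjD := h.x_not_mem_D j
  have hdi := h.deg i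
  have hdk := h.deg k
  have hane : ∀ m, a ≠ x m := fun m e => h.apex m (e ▸ h.mem_x m)
  have haR : a ∉ R := fun h1 => (hRD h1).elim haD (hane i)
  have haR' : a ∉ R' := fun h1 => (hRD' h1).elim haD (hane k)
  have hxjR : x j ∉ R := fun h1 => (hRD h1).elim hxjD (h.x_ne hij.symm)
  have hxjR' : x j ∉ R' := fun h1 => (hRD' h1).elim hxjD (h.x_ne hjk)
  have htT := hT.left_mem
  have htT' := hT.right_mem
  have haQ := h.apex
  have hyS := h₁.left_mem
  have hrS := h₁.right_mem
  have hrS' := h₂.left_mem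
  have haS₂ := h₂.right_mem
  have hzS := h₃.left_mem
  have hsS := h₃.right_mem
  have hsS' := h₄.left_mem
  have haS₄ := h₄.right_mem
  have hQR : ∀ v ∈ Q i, ∀ v' ∈ R', v ≠ v' ∧ ¬ G.Adj v v' := by
    intro v hv v' hv'
    rcases hRD' hv' with h2 | h2
    · refine ⟨fun e => hD i v hv (e ▸ h2), fun e => ?_⟩
      by_cases hvx : v = x i
      · exact (hRR' v (hvx ▸ hxiR) v' hv').2 e
      · exact hdi v hv hvx v' h2 e
    · rw [h2]; exact h.anti i k hik v hv _ (h.mem_x k)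
  have hQR' : ∀ v ∈ Q k, ∀ v' ∈ R, v ≠ v' ∧ ¬ G.Adj v v' := by
    intro v hv v' hv'
    rcases hRD hv' with h2 | h2
    · refine ⟨fun e => hD k v hv (e ▸ h2), fun e => ?_⟩
      by_cases hvx : v = x k
      · exact (hRR' v' hv' v (hvx ▸ hxkR')).2 e.symm
      · exact hdk v hv hvx v' h2 e
    · rw [h2]; exact h.anti k i hik.symm v hv _ (h.mem_x i)
  have hQQ := h.anti i k hik
  -- between the two sides there are no edges, apart from those at `a`
  have hsides : ∀ v ∈ S₁ ∪ S₂, ∀ v' ∈ S₃ ∪ S₄, v ≠ a → v' ≠ a → v ≠ v' ∧ ¬ G.Adj v v' := by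
    intro v hv v' hv' hva hva'
    rcases (h₁₂ v).1 hv with h1 | h1 | h1
    · rcases (h₃₄ v').1 hv' with h2 | h2 | h2
      · exact hRR' v h1 v' h2
      · exact ⟨(hQR' v' h2 v h1).1.symm, fun e => (hQR' v' h2 v h1).2 e.symm⟩
      · exact absurd h2 hva'
    · rcases (h₃₄ v').1 hv' with h2 | h2 | h2
      · exact hQR v h1 v' h2
      · exact hQQ v h1 v' h2
      · exact absurd h2 hva'
    · exact absurd h1 hva
  have hra : r ≠ a := fun e => haR (e ▸ hr)
  have hra' : r' ≠ a := fun e => haR (e ▸ hr')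
  have hsa : s ≠ a := fun e => haR' (e ▸ hs)
  have hsa' : s' ≠ a := fun e => haR' (e ▸ hs')
  have haS₁ : a ∉ S₁ := fun h1 => (hl a h1 a haS₂).1 rfl
  have haS₃ : a ∉ S₃ := fun h1 => (hl' a h1 a haS₄).1 rfl
  -- only `a` and `y`, `z` are adjacent to `x j`
  have hxS : ∀ v ∈ S₁ ∪ S₂, x j ≠ v ∧ (G.Adj (x j) v ↔ (v = y ∨ v = a)) := by
    intro v hv
    rcases (h₁₂ v).1 hv with h1 | h1 | h1
    · refine ⟨fun e => hxjR (e ▸ h1), ?_⟩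
      rw [hxR v h1]
      exact ⟨.inl, fun e => e.resolve_right fun e => haR (e ▸ h1)⟩
    · refine ⟨(hji v h1).1, fun e => absurd e (hji v h1).2, ?_⟩
      rintro (rfl | rfl)
      · exact absurd ((hxR _ hyR).2 rfl) (hji _ h1).2
      · exact absurd h1 (haQ i)
    · subst h1; exact ⟨(hane j).symm, fun _ => .inr rfl, fun _ => haj.symm⟩
  have hxS' : ∀ v ∈ S₃ ∪ S₄, x j ≠ v ∧ (G.Adj (x j) v ↔ (v = z ∨ v = a)) := by
    intro v hv
    rcases (h₃₄ v).1 hv with h1 | h1 | h1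
    · refine ⟨fun e => hxjR' (e ▸ h1), ?_⟩
      rw [hxR' v h1]
      exact ⟨.inl, fun e => e.resolve_right fun e => haR' (e ▸ h1)⟩
    · refine ⟨(hjk' v h1).1, fun e => absurd e (hjk' v h1).2, ?_⟩
      rintro (rfl | rfl)
      · exact absurd ((hxR' _ hzR').2 rfl) (hjk' _ h1).2
      · exact absurd h1 (haQ k)
    · subst h1; exact ⟨(hane j).symm, fun _ => .inr rfl, fun _ => haj.symm⟩
  have hTS : ∀ v ∈ T, ∀ v' ∈ S₁ ∪ S₂, v ≠ v' ∧ (G.Adj v v' → v = t) := by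
    intro v hv v' hv'
    have hvD := hTD hv
    rcases (h₁₂ v').1 hv' with h1 | h1 | rfl
    · exact ⟨fun e => (hTR v hv).1 (e ▸ h1), fun e => (ht v hv).1 ⟨v', h1, e⟩⟩
    · refine ⟨fun e => hD i v' h1 (e ▸ hvD), fun e => ?_⟩
      by_cases hvx : v' = x i
      · exact (ht v hv).1 ⟨v', hvx ▸ hxiR, e⟩
      · exact absurd e.symm (hdi v' h1 hvx v hvD)
    · exact ⟨fun e => haD (e ▸ hvD), fun e => absurd e.symm (hnaD v hvD)⟩
  have hTS' : ∀ v ∈ T, ∀ v' ∈ S₃ ∪ S₄, v ≠ v' ∧ (G.Adj v v' → v = t') := by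
    intro v hv v' hv'
    have hvD := hTD hv
    rcases (h₃₄ v').1 hv' with h1 | h1 | rfl
    · exact ⟨fun e => (hTR v hv).2 (e ▸ h1), fun e => (ht' v hv).1 ⟨v', h1, e⟩⟩
    · refine ⟨fun e => hD k v' h1 (e ▸ hvD), fun e => ?_⟩
      by_cases hvx : v' = x k
      · exact (ht' v hv).1 ⟨v', hvx ▸ hxkR', e⟩
      · exact absurd e.symm (hdk v' h1 hvx v hvD)
    · exact ⟨fun e => haD (e ▸ hvD), fun e => absurd e.symm (hnaD v hvD)⟩
  -- the three paths
  have k1 : PS G (S₂ ∪ S₄) r' s' := h₂.glue_vertex h₄.symm fun v hv v' hv' hva hva' =>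
    hsides v (.inr hv) v' (.inr hv') hva hva'
  have k2 : PS G (insert (x j) S₃) (x j) s := .cons h₃ (fun h => (hxS' _ (.inl h)).1 rfl)
    ((hxS' z (.inl hzS)).2.2 (.inl rfl)) fun v hv e =>
      ((hxS' v (.inl hv)).2.1 e).resolve_right fun e => haS₃ (e ▸ hv)
  have k3 : PS G (S₁ ∪ insert (x j) S₃) r s := by
    refine h₁.symm.glue k2 ?_
    rintro v hv v' (rfl | hv')
    · refine ⟨(hxS v (.inl hv)).1.symm, ?_⟩
      rw [G.adj_comm, (hxS v (.inl hv)).2]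
      exact ⟨fun e => ⟨e.resolve_right fun e => haS₁ (e ▸ hv), rfl⟩, fun e => .inl e.1⟩
    · have := hsides v (.inl hv) v' (.inl hv') (fun e => haS₁ (e ▸ hv)) (fun e => haS₃ (e ▸ hv'))
      exact ⟨this.1, fun e => absurd e this.2, fun e => absurd e.2 fun e => (hxS' v' (.inl hv')).1 e.symm⟩
  set G' := G.deleteEdges {s(a, x j)} with hG'
  have hadj : ∀ v v', G'.Adj v v' ↔ (G.Adj v v' ∧ ¬ ((v = a ∧ v' = x j) ∨ (v = x j ∧ v' = a))) := by
    intro v v'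
    rw [hG', SimpleGraph.deleteEdges_adj, Set.mem_singleton_iff, Sym2.eq_iff]
  have hxA : x j ∉ S₂ ∪ S₄ := by
    rintro (h1 | h1)
    exacts [(hxS _ (.inr h1)).1 rfl, (hxS' _ (.inr h1)).1 rfl]
  have haA : a ∉ S₁ ∪ insert (x j) S₃ := by
    rintro (h1 | h1 | h1)
    exacts [haS₁ h1, hane j h1, haS₃ h1]
  have haT : a ∉ T := fun h => haD (hTD h)
  have c1 : PS G' (S₂ ∪ S₄) r' s' := k1.congr_graph fun v hv v' hv' => by
    rw [hadj]; exact ⟨fun e => ⟨e, by rintro (⟨-, rfl⟩ | ⟨rfl, -⟩); exacts [hxA hv', hxA hv]⟩, And.left⟩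
  have c2 : PS G' (S₁ ∪ insert (x j) S₃) r s := k3.congr_graph fun v hv v' hv' => by
    rw [hadj]; exact ⟨fun e => ⟨e, by rintro (⟨rfl, -⟩ | ⟨-, rfl⟩); exacts [haA hv, haA hv']⟩, And.left⟩
  have c3 : PS G' T t t' := hT.congr_graph fun v hv v' hv' => by
    rw [hadj]; exact ⟨fun e => ⟨e, by rintro (⟨rfl, -⟩ | ⟨-, rfl⟩); exacts [haT hv, haT hv']⟩, And.left⟩
  have hrs := hRR' r hr s hs
  have hrs' := hRR' r' hr' s' hs'
  have hyS₂ : y ∉ S₂ := fun h1 => (hl y hyS y h1).1 rfl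
  have hzS₄ : z ∉ S₄ := fun h1 => (hl' z hzS z h1).1 rfl
  have l12 : Link2 G' (S₂ ∪ S₄) (S₁ ∪ insert (x j) S₃) r' r s' s := by
    have n1 : ∀ v ∈ S₁, v ≠ s := fun v hv e => haS₁ (by
      have := hsides v (.inl hv) s (.inl hsS) (fun e => haS₁ (e ▸ hv)) hsa; exact absurd e this.1)
    have n2 : ∀ v ∈ S₃, v ≠ r := fun v hv e => (hsides r (.inl hrS) v (.inl hv) hra
      (fun e => haS₃ (e ▸ hv))).1 e.symm
    have n3 : x j ≠ r := (hxS r (.inl hrS)).1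
    have n4 : x j ≠ s := (hxS' s (.inl hsS)).1
    have n5 : ∀ v ∈ S₂, v ≠ s' := fun v hv e => by
      by_cases hva : v = a
      · exact hsa' (e ▸ hva)
      · exact (hsides v (.inr hv) s' (.inr hsS') hva hsa').1 e
    have n6 : ∀ v ∈ S₄, v ≠ r' := fun v hv e => by
      by_cases hva : v = a
      · exact hra' (e ▸ hva)
      · exact (hsides r' (.inr hrS') v (.inr hv) hra' hva).1 e.symm
    rintro v (hv | hv) v' (hv' | rfl | hv')
    · have := hl.symm v hv v' hv'
      rw [hadj, this.2]
      have := n1 v' hv'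
      have : v' ≠ a := fun e => haS₁ (e ▸ hv')
      have : v' ≠ x j := fun e => (hxS v' (.inl hv')).1 e.symm
      grind
    · have := hxS v (.inr hv)
      rw [hadj, G.adj_comm, this.2]
      have : v ≠ y := fun e => hyS₂ (e ▸ hv)
      grind
    · have hva' : v' ≠ a := fun e => haS₃ (e ▸ hv')
      have hne : v' ≠ x j := fun e => (hxS' v' (.inl hv')).1 e.symm
      have m1 := n2 v' hv'
      have m2 := n5 v hv
      rw [hadj]
      by_cases hva : v = a
      · subst hva
        have := hl' v' hv' v haS₄
        have e2 := this.2
        rw [G.adj_comm] at e2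
        refine ⟨this.1.symm, fun e => ?_, ?_⟩
        · exact absurd (e2.1 e.1).2.symm hsa'
        · rintro (⟨-, e⟩ | ⟨e, -⟩)
          exacts [absurd e m1, absurd e m2]
      · have := hsides v (.inr hv) v' (.inl hv') hva hva'
        exact ⟨this.1, fun e => absurd e.1 this.2, by
          rintro (⟨-, e⟩ | ⟨e, -⟩)
          exacts [absurd e m1, absurd e m2]⟩
    · have hva' : v' ≠ a := fun e => haS₁ (e ▸ hv')
      have hne : v' ≠ x j := fun e => (hxS v' (.inl hv')).1 e.symm
      have m1 := n1 v' hv'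
      have m2 := n6 v hv
      rw [hadj]
      by_cases hva : v = a
      · subst hva
        have := hl v' hv' v haS₂
        have e2 := this.2
        rw [G.adj_comm] at e2
        refine ⟨this.1.symm, fun e => ?_, ?_⟩
        · exact absurd (e2.1 e.1).2.symm hra'
        · rintro (⟨e, -⟩ | ⟨-, e⟩)
          exacts [absurd e m2, absurd e m1]
      · have := hsides v' (.inl hv') v (.inr hv) hva' hva
        exact ⟨this.1.symm, fun e => absurd e.1.symm this.2, by
          rintro (⟨e, -⟩ | ⟨-, e⟩)
          exacts [absurd e m2, absurd e m1]⟩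
    · have := hxS' v (.inr hv)
      rw [hadj, G.adj_comm, this.2]
      have : v ≠ z := fun e => hzS₄ (e ▸ hv)
      grind
    · have := hl'.symm v hv v' hv'
      rw [hadj, this.2]
      have := n2 v' hv'
      have : v' ≠ a := fun e => haS₃ (e ▸ hv')
      have : v' ≠ x j := fun e => (hxS' v' (.inl hv')).1 e.symm
      grind
  have hTG : ∀ v ∈ T, ∀ v', v' ≠ a → v' ∉ T → (G'.Adj v' v ↔ G.Adj v v') := by
    intro v hv v' hva hvT
    have : v ≠ a := fun e => haT (e ▸ hv)
    rw [hadj, G.adj_comm]; grind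
  have l13 : Link2 G' (S₂ ∪ S₄) T r' t s' t' := by
    have n1 : ∀ v ∈ S₂, v ≠ r := fun v hv e => (hl r hrS v hv).1 e.symm
    have n2 : ∀ v ∈ S₄, v ≠ s := fun v hv e => (hl' s hsS v hv).1 e.symm
    rintro v (hv | hv) v' hv'
    · have m1 := hTS v' hv' v (.inr hv)
      have m2 := htS v (.inr hv)
      have m3 := n1 v hv
      have m4 : v = s' → False := fun e => by
        by_cases hva : v = a
        · exact hsa' (e ▸ hva)
        · exact (hsides v (.inr hv) s' (.inr hsS') hva hsa').1 e
      refine ⟨m1.1.symm, ?_⟩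
      have : v' ≠ a := fun e => haT (e ▸ hv')
      have : v' ≠ x j := fun e => hxjD (e ▸ hTD hv')
      rw [hadj, G.adj_comm]
      grind
    · have m1 := hTS' v' hv' v (.inr hv)
      have m2 := htS' v (.inr hv)
      have m3 := n2 v hv
      have m4 : v = r' → False := fun e => by
        by_cases hva : v = a
        · exact hra' (e ▸ hva)
        · exact (hsides r' (.inr hrS') v (.inr hv) hra' hva).1 e.symm
      refine ⟨m1.1.symm, ?_⟩
      have : v' ≠ a := fun e => haT (e ▸ hv')
      have : v' ≠ x j := fun e => hxjD (e ▸ hTD hv')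
      rw [hadj, G.adj_comm]
      grind
  have l23 : Link2 G' (S₁ ∪ insert (x j) S₃) T r t s t' := by
    rintro v hv v' hv'
    have n0 : v' ≠ a := fun e => haT (e ▸ hv')
    have n0' : v' ≠ x j := fun e => hxjD (e ▸ hTD hv')
    rcases hv with hv | rfl | hv
    · have m1 := hTS v' hv' v (.inl hv)
      have m2 := htS v (.inl hv)
      have m3 : v ≠ r' := (hl v hv r' hrS').1
      have m4 : v = s → False := fun e =>
        (hsides v (.inl hv) s (.inl hsS) (fun e => haS₁ (e ▸ hv)) hsa).1 e
      refine ⟨m1.1.symm, ?_⟩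
      rw [hadj, G.adj_comm]
      grind
    · have n3 : x j ≠ r := (hxS r (.inl hrS)).1
      have n4 : x j ≠ s := (hxS' s (.inl hsS)).1
      have := hxT v' hv'
      rw [hadj]
      grind
    · have m1 := hTS' v' hv' v (.inl hv)
      have m2 := htS' v (.inl hv)
      have m3 : v ≠ s' := (hl' v hv s' hsS').1
      have m4 : v = r → False := fun e =>
        (hsides r (.inl hrS) v (.inl hv) hra (fun e => haS₃ (e ▸ hv))).1 e.symm
      refine ⟨m1.1.symm, ?_⟩
      rw [hadj, G.adj_comm]
      grind
  obtain ⟨P, hP, hv⟩ := exists_nearPrism (G := G') (a := ![r', r, t]) (b := ![s', s, t'])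
    (A := ![S₂ ∪ S₄, S₁ ∪ insert (x j) S₃, T]) (by intro i; fin_cases i <;> assumption)
    (by intro i j hij; fin_cases i <;> fin_cases j <;> first | assumption | simp at hij)
    (by intro i hi; fin_cases i; exacts [hrs'.1, hrs.1, absurd rfl hi])
    (.inr (by
      intro i hi
      fin_cases i
      exacts [fun e => hrs'.2 ((hadj _ _).1 e).1, fun e => hrs.2 ((hadj _ _).1 e).1, absurd rfl hi]))
  refine ⟨haj, _, _, P, hP, 0, 1, by decide, ?_, ?_⟩
  · refine ⟨by rw [hv]; exact .inl haS₂, ?_⟩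
    rintro (h1 | h1)
    exacts [hra' h1.symm, hsa' h1.symm]
  · refine ⟨by rw [hv]; exact .inr (.inl rfl), ?_⟩
    rintro (h1 | h1)
    exacts [(hxS r (.inl hrS)).1 h1, (hxS' s (.inl hsS)).1 h1]

end Rooted

lemma PS.eq_of_subset (hT : PS G T u v) (hS : PS G S u v) (h : T ⊆ S) : T = S := by
  induction hS generalizing T with
  | single u => exact hT.eq_singleton
  | @cons S u w v hS hu huw hn ih =>
    have huv : u ≠ v := fun e => hu (e ▸ hS.right_mem)
    cases hT with
    | single => exact absurd rfl huv
    | @cons T _ w' _ hT huT huw' hn' =>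
      have hTS : T ⊆ S := fun x hx => (h (.inr hx)).resolve_left fun e => huT (e ▸ hx)
      obtain rfl := hn w' (hTS hT.left_mem) huw'
      rw [ih hT hTS]

lemma or_reverse {p₁ p₂ p₃ p₄ p₅ : Prop} :
    (p₁ ∨ p₂ ∨ p₃ ∨ p₄ ∨ p₅) ↔ (p₅ ∨ p₄ ∨ p₃ ∨ p₂ ∨ p₁) := by tauto

namespace Rooted

variable {a : V} {q x : Fin 3 → V} {Q : Fin 3 → Set V} {D : Set V}

/-- If an induced path from `x i` to `x k` passes through `x j`, then every other path from
`x i` to `x k` avoids its neighborhood. -/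
lemma exceptional_middle [Finite V] (h : Rooted G a q x Q D) {i j k : Fin 3}
    (hij : i ≠ j) (hik : i ≠ k) (hjk : j ≠ k) (haj : G.Adj a (x j))
    {R R' X : Set V} {y z : V} (hR : PS G R (x i) y) (hR' : PS G R' z (x k))
    (hRD : R ⊆ D ∪ {x i}) (hRD' : R' ⊆ D ∪ {x k}) (hRR' : Anti G R R')
    (hxR : ∀ v ∈ R, G.Adj (x j) v ↔ v = y) (hxR' : ∀ v ∈ R', G.Adj (x j) v ↔ v = z)
    (hX : PS G X (x i) (x k)) (hXD : X ⊆ D ∪ {x i, x k}) :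
    G.Adj a (x i) ∧ G.Adj a (x k) ∧ ∀ v ∈ X, v ≠ x i → v ≠ x k → v ∉ R ∧ v ∉ R' ∧
      ¬ G.Adj (x j) v ∧ (∀ r ∈ R, G.Adj v r → r = x i) ∧ ∀ r ∈ R', G.Adj v r → r = x k := by
  have hxiR := hR.left_mem
  have hxkR' := hR'.right_mem
  have hyR := hR.right_mem
  have hzR' := hR'.left_mem
  -- `T` is a minimal bridge inside `X` between the two sides of `x j`. With `R₁` and `R₃`, the
  -- parts of the sides from the roots to the first contact with `T`, it gives an induced path
  -- between the roots that bypasses `x j`.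
  obtain ⟨t, t', T, hT, hTX, hTR, ht, ht'⟩ := hX.connecting hRR' hxiR hxkR'
  have hTD : T ⊆ D := by
    intro v hv
    rcases hXD (hTX hv) with h1 | rfl | rfl
    exacts [h1, absurd hxiR (hTR _ hv).1, absurd hxkR' (hTR _ hv).2]
  have htT := hT.left_mem
  have htT' := hT.right_mem
  obtain ⟨r, R₁, hR₁, hR₁R, hr, hR₁'⟩ := hR.first (A := {v | G.Adj t v})
    (by obtain ⟨r, hr, e⟩ := (ht t htT).2 rfl; exact ⟨r, hr, e⟩)
  obtain ⟨s, R₃, hR₃, hR₃R, hs, hR₃'⟩ := hR'.symm.first (A := {v | G.Adj t' v})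
    (by obtain ⟨r, hr, e⟩ := (ht' t' htT').2 rfl; exact ⟨r, hr, e⟩)
  have hD := fun i v hv => h.not_mem_D (i := i) (v := v) hv
  have haD := h.apex_not_mem_D
  have hxj := h.mem_x j
  have hji := h.anti j i hij.symm _ hxj
  have hjk' := h.anti j k hjk _ hxj
  have hxjD := h.x_not_mem_D j
  have hxjR : x j ∉ R := fun h1 => (hRD h1).elim hxjD (h.x_ne hij.symm)
  have hxjR' : x j ∉ R' := fun h1 => (hRD' h1).elim hxjD (h.x_ne hjk)
  have hrR := hR₁.right_mem
  have hsR := hR₃.right_mem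
  have htr := (hr r hrR).2 rfl
  have hts := (hs s hsR).2 rfl
  by_cases hpos : ∃ v ∈ R₁ ∪ (T ∪ R₃), G.Adj (x j) v
  · exfalso
    refine h.hub j ?_
    have k1 : PS G (T ∪ R₃) t (x k) := by
      refine hT.glue hR₃.symm fun v hv v' hv' => ⟨fun e => (hTR v hv).2 (e ▸ hR₃R hv'), fun e => ?_, ?_⟩
      · obtain rfl := (ht' v hv).1 ⟨v', hR₃R hv', e⟩
        exact ⟨rfl, (hs v' hv').1 e⟩
      · rintro ⟨rfl, rfl⟩; exact hts
    have k2 : PS G (R₁ ∪ (T ∪ R₃)) (x i) (x k) := by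
      refine hR₁.glue k1 ?_
      rintro v hv v' (hv' | hv')
      · refine ⟨fun e => (hTR v' hv').1 (e ▸ hR₁R hv), fun e => ?_, ?_⟩
        · obtain rfl := (ht v' hv').1 ⟨v, hR₁R hv, e.symm⟩
          exact ⟨(hr v hv).1 e.symm, rfl⟩
        · rintro ⟨rfl, rfl⟩; exact htr.symm
      · have := hRR' v (hR₁R hv) v' (hR₃R hv')
        refine ⟨this.1, fun e => absurd e this.2, fun e => ?_⟩
        exact absurd (e.2 ▸ hR₃R hv') (hTR t htT).2
    have hBD : R₁ ∪ (T ∪ R₃) ⊆ D ∪ {x i, x k} := by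
      rintro v (hv | hv | hv)
      · rcases hRD (hR₁R hv) with h1 | h1
        exacts [.inl h1, .inr (.inl h1)]
      · exact .inl (hTD hv)
      · rcases hRD' (hR₃R hv) with h1 | h1
        exacts [.inl h1, .inr (.inr h1)]
    have k3 := h.extend hik k2 hBD
    obtain ⟨P, hP⟩ : ∃ P, P = Q i ∪ (R₁ ∪ (T ∪ R₃) ∪ Q k) := ⟨_, rfl⟩
    rw [← hP] at k3
    have hPmem : ∀ v ∈ P, v ∈ Q i ∨ v ∈ Q k ∨ v ∈ D := by
      rw [hP]
      rintro v (hv | hv | hv)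
      · exact .inl hv
      · rcases hBD hv with h1 | rfl | rfl
        exacts [.inr (.inr h1), .inl (h.mem_x i), .inr (.inl (h.mem_x k))]
      · exact .inr (.inl hv)
    have hxjP : x j ∉ P := fun h1 => by
      rcases hPmem _ h1 with h2 | h2 | h2
      exacts [(hji _ h2).1 rfl, (hjk' _ h2).1 rfl, hxjD h2]
    have hqi := h.mem_q i
    have hqk := h.mem_q k
    have hxD : ∀ v ∈ P, G.Adj (x j) v → v ∈ D := fun v hv e => by
      rcases hPmem _ hv with h2 | h2 | h2
      exacts [absurd e (hji _ h2).2, absurd e (hjk' _ h2).2, h2]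
    have m1 : a ∉ P := fun h1 => by
      rcases hPmem _ h1 with h2 | h2 | h2
      exacts [h.apex _ h2, h.apex _ h2, haD h2]
    have m2 : ∀ v ∈ P, G.Adj a v ↔ (v = q i ∨ v = q k) := by
      intro v hv
      rcases hPmem v hv with h1 | h1 | h1
      · rw [h.adj_apex_Q h1]
        exact ⟨.inl, fun e => e.resolve_right fun e => (h.anti i k hik v h1 _ hqk).1 e⟩
      · rw [h.adj_apex_Q h1]
        exact ⟨.inr, fun e => e.resolve_left fun e => (h.anti k i hik.symm v h1 _ hqi).1 e⟩
      · refine ⟨fun e => absurd e (h.not_adj_apex h1), ?_⟩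
        rintro (rfl | rfl)
        exacts [absurd h1 (hD _ _ hqi), absurd h1 (hD _ _ hqk)]
    have hane : x j ≠ a := fun e => h.apex j (e ▸ hxj)
    have k4 : PS G {x j, a} (x j) a := .cons (.single a) (by simpa using hane) haj.symm (by simp)
    -- The bypass is closed to a hole by `a`, and `x j` is adjacent to `a` with a further neighbor
    -- on it. One neighbor at `q i` or `q k` is impossible, two consecutive ones load a pyramid with
    -- corner `x j`, and two nonadjacent ones form with `a` the stable triple of a proper wheel.
    rcases h.free.attach k3 m1 m2 k4 hane
      (by rintro v (rfl | rfl); exacts [hxjP, m1])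
      (by rintro v (rfl | rfl) h1 h2; exacts [absurd rfl h1, absurd rfl h2])
      (by obtain ⟨v, hv, e⟩ := hpos; exact ⟨v, hP ▸ .inr (.inl hv), e⟩) with
      ⟨w, hw, h1⟩ | ⟨w, w', S₁, S₂, h1, h2, h3, h4, h5⟩ | ⟨-, v, hv, v', hv', hne, hnadj, e, e'⟩
    · rcases hw with rfl | rfl
      · exact absurd ((h1 _ (hP ▸ .inl hqi)).2 rfl) (hji _ hqi).2
      · exact absurd ((h1 _ (hP ▸ .inr (.inr hqk))).2 rfl) (hjk' _ hqk).2
    · have hmem : ∀ v, v ∈ S₁ ∪ S₂ ↔ (v ∈ Q i ∨ v ∈ R₁ ∨ v ∈ T ∨ v ∈ R₃ ∨ v ∈ Q k) := by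
        intro v; rw [← h3, hP]; simp only [Set.mem_union, or_assoc]
      rw [h3] at h5
      have hww' := ((h4 w h1.right_mem w' h2.left_mem).2).2 ⟨rfl, rfl⟩
      -- The neighbors of `x j` on the bypass are adjacent while `y` and `z` are not, so one of `y`
      -- and `z` was cut off by the bypass. Its side supplies the loading path.
      by_cases hz : z ∈ R₃
      · have hy : y ∉ R₁ := by
          intro hy
          have e1 := (h5 y ((hmem y).2 (.inr (.inl hy)))).1 ((hxR y hyR).2 rfl)
          have e2 := (h5 z ((hmem z).2 (.inr (.inr (.inr (.inl hz)))))).1 ((hxR' z hzR').2 rfl)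
          have e3 := hRR' y hyR z hzR'
          rcases e1 with rfl | rfl <;> rcases e2 with rfl | rfl
          exacts [e3.1 rfl, e3.2 hww', e3.2 hww'.symm, e3.1 rfl]
        rcases hR₁' with ⟨rfl, rfl⟩ | ⟨p, F, g1, rfl, g3⟩
        · exact absurd hrR hy
        · refine h.isHub_of_side (i := k) (j := j) (k := i) (R₁ := R₃) (w := w') (w' := w)
            (S₁ := S₂) (S₂ := S₁) hjk.symm hik.symm hij.symm haj (hR₃R.trans hRD') hR₃.left_mem
            hT.symm hTD hR₁ g1 g3 hRD
            (fun v hv v' hv' => hRR'.symm v (hR₃R hv) v' hv') (fun v hv => (hTR v hv).1)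
            (fun v hv => (ht v hv).1) hr hxR h2.symm h1.symm h4.symm ?_ ?_
          · intro v; rw [Set.union_comm, hmem]; exact or_reverse
          · intro v hv; rw [h5 v (by rwa [Set.union_comm])]; exact or_comm
      · rcases hR₃' with ⟨rfl, rfl⟩ | ⟨p, F, g1, rfl, g3⟩
        · exact absurd hsR hz
        · exact h.isHub_of_side (i := i) (j := j) (k := k) (R₁ := R₁) (w := w) (w' := w')
            hij hik hjk haj (hR₁R.trans hRD) hR₁.left_mem hT hTD hR₃ g1 g3 hRD'
            (fun v hv v' hv' => hRR' v (hR₁R hv) v' hv') (fun v hv => (hTR v hv).2)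
            (fun v hv => (ht' v hv).1) hs hxR' h1 h2 h4 hmem h5
    · refine isHub_of_isHole (k3.isHole_insert (t := a) (h.anti i k hik _ hqi _ hqk).1
        (h.anti i k hik _ hqi _ hqk).2 m1 m2) (.inl rfl) (.inr hv) (.inr hv') haj.symm e e' ?_ ?_ hne
        (h.not_adj_apex (hxD v hv e)) (h.not_adj_apex (hxD v' hv' e')) hnadj
      exacts [fun e => m1 (e ▸ hv), fun e => m1 (e ▸ hv')]
  · have hxT : ∀ v ∈ T, ¬ G.Adj (x j) v := fun v hv e => hpos ⟨v, .inr (.inl hv), e⟩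
    have hry : r ≠ y := by
      rintro rfl; exact hpos ⟨r, .inl hrR, (hxR r (hR₁R hrR)).2 rfl⟩
    have hsz : s ≠ z := by
      rintro rfl; exact hpos ⟨s, .inr (.inr hsR), (hxR' s (hR₃R hsR)).2 rfl⟩
    have c1 := h.attach_side hij hik hjk haj hR hR' hRD hRD' hRR' hxR hxR' hT hTD hTR ht ht' hxT
      ⟨r, hR₁R hrR, hry, htr⟩
    have c2 := h.attach_side hjk.symm hik.symm hij.symm haj hR'.symm hR.symm hRD' hRD hRR'.symm
      hxR' hxR hT.symm hTD (fun v hv => (hTR v hv).symm) ht' ht hxT ⟨s, hR₃R hsR, hsz, hts⟩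
    -- Two contacts on one side cannot both be the root, so a good attachment on one side provides
    -- the extra condition needed to treat the other.
    have two : ∀ {c : V} {A B R : Set V} {p p' e e' t x : V}, PS G A e p → PS G B p' e' →
        Link G A B p p' → p ∈ R → p' ∈ R → (∀ v ∈ A ∪ B, G.Adj t v ↔ (v = p ∨ v = p')) →
        (¬ G.Adj c x ∨ ∃ r ∈ R, r ≠ x ∧ G.Adj t r) := by
      intro c A B R p p' e e' t x hA hB hl hp hp' ht
      right
      have m1 := (hl p hA.right_mem p' hB.left_mem).1
      by_cases hpx : p = x
      · exact ⟨p', hp', fun e => m1 (hpx.trans e.symm), (ht p' (.inr hB.left_mem)).2 (.inr rfl)⟩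
      · exact ⟨p, hp, hpx, (ht p (.inl hA.right_mem)).2 (.inl rfl)⟩
    by_cases hk : ¬ G.Adj a (x k) ∨ ∃ r ∈ R', r ≠ x k ∧ G.Adj t' r
    · exfalso
      obtain ⟨p, p', S₁, S₂, g1, g2, g3, g4, g5, g6, g7⟩ := c1 hk
      obtain ⟨s, s', S₃, S₄, l1, l2, l3, l4, l5, l6, l7⟩ := c2 (two g1 g2 g4 g5 g6 g7)
      exact h.cross _ (h.isCrossEdge_of_sides hij hik hjk haj hyR hzR' hxiR hxkR' hRD hRD' hRR'
        hxR hxR' hT hTD hTR ht ht' hxT g1 g2 g3 g4 g5 g6 g7 l1 l2 l3 l4 l5 l6 l7)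
    · by_cases hi : ¬ G.Adj a (x i) ∨ ∃ r ∈ R, r ≠ x i ∧ G.Adj t r
      · exfalso
        obtain ⟨s, s', S₃, S₄, l1, l2, l3, l4, l5, l6, l7⟩ := c2 hi
        exact hk (two l1 l2 l4 l5 l6 l7)
      -- The surviving case: both outer roots are adjacent to `a`, and `T` touches the two sides
      -- only in these roots.
      · push Not at hi hk
        refine ⟨hi.1, hk.1, ?_⟩
        have ti : G.Adj t (x i) := by
          have : r = x i := by by_contra hne; exact hi.2 r (hR₁R hrR) hne htr
          exact this ▸ htr
        have tk : G.Adj t' (x k) := by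
          have : s = x k := by by_contra hne; exact hk.2 s (hR₃R hsR) hne hts
          exact this ▸ hts
        have k1 : PS G (insert (x k) T) t (x k) := hT.concat (fun h => (hTR _ h).2 hxkR') tk
          fun v hv e => (ht' v hv).1 ⟨_, hxkR', e⟩
        have k2 : PS G (insert (x i) (insert (x k) T)) (x i) (x k) := by
          refine .cons k1 ?_ ti.symm ?_
          · rintro (h1 | h1)
            exacts [h.x_ne hik h1, (hTR _ h1).1 hxiR]
          · rintro v (rfl | hv) e
            · exact absurd e (h.x_not_adj _ _)
            · exact (ht v hv).1 ⟨_, hxiR, e.symm⟩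
        -- Here `T` with the two roots is already an induced path inside `X` with the same ends,
        -- hence it is all of `X`, and what is known of `T` holds for the interior of `X`.
        have hTX' := k2.eq_of_subset hX (by
          rintro v (rfl | rfl | hv)
          exacts [hX.left_mem, hX.right_mem, hTX hv])
        intro v hv hvi hvk
        rw [← hTX'] at hv
        have hvT := (hv.resolve_left hvi).resolve_left hvk
        refine ⟨(hTR v hvT).1, (hTR v hvT).2, hxT v hvT, fun r₀ hr₀ e => ?_, fun r₀ hr₀ e => ?_⟩
        · obtain rfl := (ht v hvT).1 ⟨r₀, hr₀, e⟩
          by_contra hne; exact hi.2 r₀ hr₀ hne e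
        · obtain rfl := (ht' v hvT).1 ⟨r₀, hr₀, e⟩
          by_contra hne; exact hk.2 r₀ hr₀ hne e

end Rooted

lemma PS.exists_cons (h : PS G S u v) (hne : u ≠ v) : ∃ w T, PS G T w v ∧ u ∉ T ∧ S = insert u T ∧
    ∀ y ∈ T, G.Adj u y ↔ y = w := by
  cases h with
  | single => exact absurd rfl hne
  | @cons T _ w _ hT huT huw hn =>
    exact ⟨w, T, hT, huT, rfl, fun y hy => ⟨hn y hy, fun e => e ▸ huw⟩⟩

namespace Rooted

variable {a : V} {q x : Fin 3 → V} {Q : Fin 3 → Set V} {D : Set V}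

/-- No induced path from `x i` to `x k` passes through `x j`, if `x j` is adjacent to the apex. -/
lemma no_middle [Finite V] (h : Rooted G a q x Q D) {i j k : Fin 3}
    (hij : i ≠ j) (hik : i ≠ k) (hjk : j ≠ k) (haj : G.Adj a (x j))
    {R R' : Set V} {y z : V} (hR : PS G R (x i) y) (hR' : PS G R' z (x k))
    (hRD : R ⊆ D ∪ {x i}) (hRD' : R' ⊆ D ∪ {x k}) (hRR' : Anti G R R')
    (hxR : ∀ v ∈ R, G.Adj (x j) v ↔ v = y) (hxR' : ∀ v ∈ R', G.Adj (x j) v ↔ v = z) : False := by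
  obtain ⟨B, b, hB, hBD, hl⟩ := h.rungs
  have hX : ∀ m n, m ≠ n → PS G (B m ∪ B n) (x m) (x n) ∧ B m ∪ B n ⊆ D ∪ {x m, x n} := by
    refine fun m n hmn => ⟨(hB m).glue (hB n).symm (hl m n hmn), ?_⟩
    rintro v (hv | hv)
    · exact (hBD m hv).imp id .inl
    · exact (hBD n hv).imp id .inr
  obtain ⟨hXik, hXikD⟩ := hX i k hik
  obtain ⟨hXjk, hXjkD⟩ := hX j k hjk
  -- Comparison with the path formed by the rungs `i` and `k` leaves only the exceptional case, so
  -- `x i` is adjacent to `a` too.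
  obtain ⟨hai, -, hex⟩ := h.exceptional_middle hij hik hjk haj hR hR' hRD hRD' hRR' hxR hxR' hXik hXikD
  have hxD := h.x_not_mem_D
  have hyR := hR.right_mem
  have hyx : x i ≠ y := fun e => h.x_not_adj j i ((hxR _ (e ▸ hyR)).2 e)
  obtain ⟨y₀, R₀, hR₀, hxR₀, rfl, hn₀⟩ := hR.exists_cons hyx
  obtain ⟨t₀, X₀, hX₀, hxX₀, hXeq, hnX⟩ := hXik.exists_cons (h.x_ne hik)
  have hR₀D : R₀ ⊆ D := fun v hv => (hRD (.inr hv)).resolve_right fun e => hxR₀ (e ▸ hv)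
  have hX₀X : ∀ v ∈ X₀, v ∈ B i ∪ B k ∧ v ≠ x i := fun v hv =>
    ⟨hXeq ▸ .inr hv, fun e => hxX₀ (e ▸ hv)⟩
  have hxjR₀ : x j ∉ R₀ := fun h1 => hxD j (hR₀D h1)
  have hyR₀ := hR₀.right_mem
  have hy₀R₀ := hR₀.left_mem
  have k1 : PS G (insert (x j) R₀) (x j) y₀ := .cons hR₀.symm hxjR₀ ((hxR y (.inr hyR₀)).2 rfl)
    fun v hv e => (hxR v (.inr hv)).1 e
  have hX₀D : X₀ ⊆ D ∪ {x k} := fun v hv => by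
    have := hX₀X v hv
    rcases hXikD this.1 with h1 | h1 | h1
    exacts [.inl h1, absurd h1 this.2, .inr h1]
  have hxkR' := hR'.right_mem
  have hanti : Anti G (insert (x j) R₀) X₀ := by
    rintro v hv v' hv'
    by_cases hk : v' = x k
    · subst hk
      rcases hv with rfl | hv
      exacts [⟨h.x_ne hjk, h.x_not_adj _ _⟩, hRR' v (.inr hv) _ hxkR']
    · have := hX₀X v' hv'
      obtain ⟨e1, e2, e3, e4, e5⟩ := hex v' this.1 this.2 hk
      rcases hv with rfl | hv
      · refine ⟨fun e => ?_, e3⟩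
        exact hxD j ((hX₀D (e ▸ hv')).resolve_right (h.x_ne hjk))
      · exact ⟨fun e => e1 (e ▸ .inr hv), fun e => hxR₀ (e4 v (.inr hv) e.symm ▸ hv)⟩
  -- Going from `x j` back along `R` to `x i` and on along these two rungs to `x k` is again
  -- induced, now with `x i` in the middle. It is compared with the path formed by the rungs `j` and
  -- `k`. The edge between `b i` and `b j` will contradict one of the two resulting anticompleteness
  -- statements.
  obtain ⟨-, -, hex'⟩ := h.exceptional_middle hij.symm hjk hik hai k1 hX₀
    (by rintro v (rfl | hv); exacts [.inr rfl, .inl (hR₀D hv)]) hX₀D hanti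
    (by
      rintro v (rfl | hv)
      · exact ⟨fun e => absurd e (h.x_not_adj _ _), fun e => absurd (e ▸ hy₀R₀) hxjR₀⟩
      · exact hn₀ v hv) hnX hXjk hXjkD
  have hbi := (hB i).right_mem
  have hbj := (hB j).right_mem
  have hadj : G.Adj (b j) (b i) := (hl j i hij.symm _ hbj _ hbi).2.2 ⟨rfl, rfl⟩
  have hbik : b i ≠ x k := fun e => (hBD i (e ▸ hbi)).elim (hxD k) (h.x_ne hik.symm)
  have hbjk : b j ≠ x k := fun e => (hBD j (e ▸ hbj)).elim (hxD k) (h.x_ne hjk.symm)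
  by_cases hj : b j = x j
  · by_cases hi : b i = x i
    · rw [hi, hj] at hadj; exact h.x_not_adj _ _ hadj
    · exact (hex (b i) (.inl hbi) hi hbik).2.2.1 (hj ▸ hadj)
  · obtain ⟨-, -, e3, -, e5⟩ := hex' (b j) (.inl hbj) hj hbjk
    by_cases hi : b i = x i
    · exact e3 (hi ▸ hadj.symm)
    · have : b i ∈ B i ∪ B k := .inl hbi
      rw [hXeq] at this
      exact hbik (e5 _ (this.resolve_left hi) hadj)

/-- A path from `x i` attaches to a path from `x j` to `x k` at two consecutive vertices. -/
lemma attach_path [Finite V] (h : Rooted G a q x Q D) {i j k : Fin 3}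
    (hij : i ≠ j) (hik : i ≠ k) (hjk : j ≠ k) {P E : Set V} {g : V}
    (hP : PS G P (x j) (x k)) (hPD : P ⊆ D ∪ {x j, x k}) (hE : PS G E g (x i))
    (hED : E ⊆ D ∪ {x i}) (hg : g ≠ x i) (hEP : ∀ v ∈ E, v ∉ P)
    (hEP' : ∀ v ∈ E, v ≠ g → ∀ y ∈ P, ¬ G.Adj v y) (hgP : ∃ y ∈ P, G.Adj g y) :
    ∃ z z' S₁ S₂, PS G S₁ (x j) z ∧ PS G S₂ z' (x k) ∧ P = S₁ ∪ S₂ ∧ Link G S₁ S₂ z z' ∧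
      ∀ v ∈ P, G.Adj g v ↔ (v = z ∨ v = z') := by
  have hD := fun i v hv => h.not_mem_D (i := i) (v := v) hv
  have hgE := hE.left_mem
  have hgD : g ∈ D := (hED hgE).resolve_right hg
  have hane : ∀ m, a ≠ x m := fun m e => h.apex m (e ▸ h.mem_x m)
  have haP : a ∉ P := fun h1 => by
    rcases hPD h1 with h2 | h2 | h2
    exacts [h.apex_not_mem_D h2, hane j h2, hane k h2]
  -- A unique neighbor at `q j` has to be the root `x j` itself, adjacent to `a`. Then `E` followed
  -- by `P` runs from `x i` to `x k` through `x j`.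
  have key : ∀ {j k : Fin 3}, i ≠ j → i ≠ k → j ≠ k → PS G P (x j) (x k) → P ⊆ D ∪ {x j, x k} →
      ∀ w, w = q j → (∀ v ∈ Q j ∪ (P ∪ Q k), G.Adj g v ↔ v = w) → False := by
    intro j k hij hik hjk hP hPD w hw hgw
    have hjP := hP.left_mem
    obtain ⟨y, hy, e⟩ := hgP
    have hyw := (hgw y (.inr (.inl hy))).1 e
    have hyj : y = x j := by
      have hyQ : y ∈ Q j := by rw [hyw, hw]; exact h.mem_q j
      rcases hPD hy with h2 | h2 | h2
      · exact absurd h2 (hD j y hyQ)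
      · exact h2
      · exact absurd h2 (h.anti j k hjk y hyQ _ (h.mem_x k)).1
    have haj : G.Adj a (x j) := (h.adj_apex _).2 ⟨j, by rw [← hyj, hyw, hw]⟩
    obtain ⟨z₀, P₀, hP₀, hxP₀, rfl, hn₀⟩ := hP.exists_cons (h.x_ne hjk)
    have hgx : ∀ v ∈ insert (x j) P₀, G.Adj g v ↔ v = x j := fun v hv => by
      rw [hgw v (.inr (.inl hv)), ← hyw, hyj]
    refine h.no_middle hij hik hjk haj hE.symm hP₀ hED ?_ ?_ ?_ hn₀
    · intro v hv
      rcases hPD (.inr hv) with h2 | h2 | h2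
      exacts [.inl h2, absurd (h2 ▸ hv) hxP₀, .inr h2]
    · intro v hv v' hv'
      refine ⟨fun e => hEP v hv (.inr (e ▸ hv')), fun e' => ?_⟩
      by_cases hvg : v = g
      · subst hvg
        exact hxP₀ ((hgx v' (.inr hv')).1 e' ▸ hv')
      · exact hEP' v hv hvg v' (.inr hv') e'
    · intro v hv
      constructor
      · intro e
        by_contra hvg
        exact hEP' v hv hvg _ (.inl rfl) e.symm
      · rintro rfl
        exact ((hgx _ (.inl rfl)).2 rfl).symm
  have hPmem : ∀ v ∈ Q j ∪ (P ∪ Q k), v ∈ Q j ∨ v ∈ Q k ∨ v ∈ D := by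
    rintro v (hv | hv | hv)
    · exact .inl hv
    · rcases hPD hv with h1 | rfl | rfl
      exacts [.inr (.inr h1), .inl (h.mem_x j), .inr (.inl (h.mem_x k))]
    · exact .inr (.inl hv)
  have hqj := h.mem_q j
  have hqk := h.mem_q k
  have haP' : a ∉ Q j ∪ (P ∪ Q k) := fun h1 => by
    rcases hPmem _ h1 with h2 | h2 | h2
    exacts [h.apex _ h2, h.apex _ h2, h.apex_not_mem_D h2]
  have m2 : ∀ v ∈ Q j ∪ (P ∪ Q k), G.Adj a v ↔ (v = q j ∨ v = q k) := by
    intro v hv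
    rcases hPmem v hv with h1 | h1 | h1
    · rw [h.adj_apex_Q h1]
      exact ⟨.inl, fun e => e.resolve_right fun e => (h.anti j k hjk v h1 _ hqk).1 e⟩
    · rw [h.adj_apex_Q h1]
      exact ⟨.inr, fun e => e.resolve_left fun e => (h.anti k j hjk.symm v h1 _ hqj).1 e⟩
    · refine ⟨fun e => absurd e (h.not_adj_apex h1), ?_⟩
      rintro (rfl | rfl)
      exacts [absurd h1 (hD _ _ hqj), absurd h1 (hD _ _ hqk)]
  have haE : a ∉ E ∪ Q i := by
    rintro (h1 | h1)
    exacts [(hED h1).elim h.apex_not_mem_D (hane i), h.apex i h1]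
  have k1 : PS G (E ∪ Q i) g (q i) := by
    refine hE.glue_vertex (h.path i).symm fun v hv v' hv' hne hne' => ?_
    have hvD : v ∈ D := (hED hv).resolve_right hne
    exact ⟨fun e => hD i v' hv' (e ▸ hvD), fun e => h.deg i v' hv' hne' v hvD e.symm⟩
  have k2 : PS G (insert a (E ∪ Q i)) g a := by
    refine k1.concat haE ((h.adj_apex_Q (h.mem_q i)).2 rfl).symm ?_
    rintro v (hv | hv) e
    · rcases hED hv with h1 | rfl
      · exact absurd e.symm (h.not_adj_apex h1)
      · exact (h.adj_apex_Q (h.mem_x i)).1 e.symm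
    · exact (h.adj_apex_Q hv).1 e.symm
  have hxjP := hP.left_mem
  have hxkP := hP.right_mem
  have hxiE := hE.right_mem
  have hEQ : ∀ v ∈ E, ∀ m, m ≠ i → v ∉ Q m := fun v hv m hm h1 => by
    rcases hED hv with h2 | h2
    · exact hD m v h1 h2
    · exact (h.anti m i hm v h1 _ (h.mem_x i)).1 h2
  have hxiP : x i ∉ P := fun h1 => hEP _ hxiE h1
  have hQP : ∀ v ∈ Q i, ∀ y ∈ Q j ∪ (P ∪ Q k), v = x i ∨ (v ≠ y ∧ ¬ G.Adj v y) := by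
    intro v hv y hy
    by_cases hvx : v = x i
    · exact .inl hvx
    · right
      rcases hPmem y hy with h1 | h1 | h1
      · exact h.anti i j hij v hv y h1
      · exact h.anti i k hik v hv y h1
      · exact ⟨fun e => hD i v hv (e ▸ h1), h.deg i v hv hvx y h1⟩
  have hEP₂ : ∀ v ∈ E, v ∉ Q j ∪ (P ∪ Q k) := by
    rintro v hv (h1 | h1 | h1)
    exacts [hEQ v hv j hij.symm h1, hEP v hv h1, hEQ v hv k hik.symm h1]
  have hadjQ : ∀ v ∈ E, v ≠ g → ∀ m, m ≠ i → (∀ y ∈ Q m, y = x m → y ∈ P) → ∀ y ∈ Q m,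
      ¬ G.Adj v y := by
    intro v hv hvg m hm hmP y hy e
    by_cases hyx : y = x m
    · exact hEP' v hv hvg y (hmP y hy hyx) e
    · rcases hED hv with h2 | rfl
      · exact h.deg m y hy hyx v h2 e.symm
      · exact (h.anti m i hm y hy _ (h.mem_x i)).2 e.symm
  have m4 : ∀ v ∈ insert a (E ∪ Q i), v ∉ Q j ∪ (P ∪ Q k) := by
    rintro v (rfl | hv | hv) h1
    · exact haP' h1
    · exact hEP₂ v hv h1
    · rcases hQP v hv v h1 with rfl | h2
      exacts [hEP₂ _ hxiE h1, h2.1 rfl]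
  have hE₂ : ∀ v ∈ E, v ≠ g → ∀ y ∈ Q j ∪ (P ∪ Q k), ¬ G.Adj v y := by
    rintro v hv hvg y (h1 | h1 | h1)
    · exact hadjQ v hv hvg j hij.symm (fun y _ e => e ▸ hxjP) y h1
    · exact hEP' v hv hvg y h1
    · exact hadjQ v hv hvg k hik.symm (fun y _ e => e ▸ hxkP) y h1
  have m5 : ∀ v ∈ insert a (E ∪ Q i), v ≠ g → v ≠ a → ∀ y ∈ Q j ∪ (P ∪ Q k), ¬ G.Adj v y := by
    rintro v (rfl | hv | hv) hvg hva y hy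
    · exact absurd rfl hva
    · exact hE₂ v hv hvg y hy
    · rcases hQP v hv y hy with rfl | h2
      exacts [hE₂ _ hxiE hvg y hy, h2.2]
  -- The hole consists of `a`, `Q j`, `P` and `Q k`; the attaching path runs from `g` through `E`
  -- and `Q i` to `a`. The third outcome fails because `g ∈ D` misses `a`.
  rcases h.free.attach (h.extend hjk hP hPD) haP' m2 k2 (fun e => haE (.inl (e ▸ hgE))) m4 m5
    (by obtain ⟨y, hy, e⟩ := hgP; exact ⟨y, .inr (.inl hy), e⟩) with
    ⟨w, hw, h1⟩ | ⟨w, w', S₁, S₂, h1, h2, h3, h4, h5⟩ | ⟨h1, -⟩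
  · exfalso
    rcases hw with hw | hw
    · exact key hij hik hjk hP hPD w hw h1
    · refine key hik hij hjk.symm hP.symm (by rwa [Set.pair_comm]) w hw fun v hv => h1 v ?_
      rcases hv with hv | hv | hv
      exacts [.inr (.inr hv), .inr (.inl hv), .inl hv]
  · have hmemP : ∀ v ∈ Q j ∪ (P ∪ Q k), G.Adj g v → v ∈ P := by
      rintro v (hv | hv | hv) e
      · by_cases hvx : v = x j
        · exact hvx ▸ hxjP
        · exact absurd e.symm (h.deg j v hv hvx g hgD)
      · exact hv
      · by_cases hvx : v = x k
        · exact hvx ▸ hxkP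
        · exact absurd e.symm (h.deg k v hv hvx g hgD)
    have hw₁ : w ∈ Q j ∪ (P ∪ Q k) := h3 ▸ .inl h1.right_mem
    have hw₂ : w' ∈ Q j ∪ (P ∪ Q k) := h3 ▸ .inr h2.left_mem
    have hww' := (h4 w h1.right_mem w' h2.left_mem).2.2 ⟨rfl, rfl⟩
    obtain ⟨T₁, T₂, hT, ⟨g1, g2, g3⟩ | ⟨g1, g2, g3⟩⟩ := hP.split_adj
      (hmemP w hw₁ ((h5 w hw₁).2 (.inl rfl))) (hmemP w' hw₂ ((h5 w' hw₂).2 (.inr rfl))) hww'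
    · exact ⟨w, w', T₁, T₂, g1, g2, hT, g3, fun v hv => h5 v (.inr (.inl hv))⟩
    · exact ⟨w', w, T₁, T₂, g1, g2, hT, g3, fun v hv => by rw [h5 v (.inr (.inl hv)), or_comm]⟩
  · exact absurd h1.symm (h.not_adj_apex hgD)

end Rooted

/-! ### Connectors between rungs. -/

/-- A path `F` in `D`, disjoint from the paths `B i`, such that only its ends `f` and `g` together
have neighbors in two different paths `B i`, apart from the vertices `b i`. -/
structure Connector (G : SimpleGraph V) (D : Set V) (B : Fin 3 → Set V) (b : Fin 3 → V)
    (F : Set V) (f g : V) : Prop where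
  path : PS G F f g
  subset : F ⊆ D
  disj : ∀ m, ∀ v ∈ F, v ∉ B m
  min : ∀ m n, m ≠ n → ∀ v ∈ F, ∀ w ∈ F, ∀ p ∈ B m, ∀ p' ∈ B n, G.Adj v p → G.Adj w p' →
    ¬ (p = b m ∧ p' = b n) → (v = f ∧ w = g) ∨ (v = g ∧ w = f)

lemma Connector.symm {D : Set V} {B : Fin 3 → Set V} {b : Fin 3 → V} {F : Set V} {f g : V}
    (h : Connector G D B b F f g) : Connector G D B b F g f :=
  ⟨h.path.symm, h.subset, h.disj, fun m n hmn v hv w hw p hp p' hp' e e' hne =>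
    (h.min m n hmn v hv w hw p hp p' hp' e e' hne).symm⟩

/-- A path that is attached to a path `B` by one of its ends extends along `B`. -/
lemma PS.extend_to_end {F B : Set V} {f g x b : V} (hF : PS G F f g) (hB : PS G B x b)
    (hFB : ∀ v ∈ F, v ∉ B) (hu : u ∈ B) (hub : u ≠ b) (hfu : G.Adj f u)
    (hn : ∀ v ∈ F, v ≠ f → ∀ p ∈ B, p ≠ b → ¬ G.Adj v p) :
    ∃ E, PS G E g x ∧ F ⊆ E ∧ E ⊆ F ∪ (B \ {b}) := by
  obtain ⟨y, Y, hY, hYB, hy, hY'⟩ := hB.first (A := {p | G.Adj f p}) ⟨u, hu, hfu⟩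
  have hbY : b ∉ Y := by
    intro hbY
    rcases hY' with ⟨rfl, rfl⟩ | ⟨w, Z, hZ, rfl, hl⟩
    · exact hub ((hy u hu).1 hfu)
    · exact (hl b hbY b hZ.right_mem).1 rfl
  refine ⟨F ∪ Y, hF.symm.glue hY.symm ?_, Set.subset_union_left, ?_⟩
  · intro v hv v' hv'
    refine ⟨fun e => hFB v hv (e ▸ hYB hv'), fun e => ?_, ?_⟩
    · have hvf : v = f := by
        by_contra hvf
        exact hn v hv hvf v' (hYB hv') (fun e => hbY (e ▸ hv')) e
      subst hvf
      exact ⟨rfl, (hy v' hv').1 e⟩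
    · rintro ⟨rfl, rfl⟩; exact (hy _ hv').2 rfl
  · rintro v (hv | hv)
    exacts [.inl hv, .inr ⟨hYB hv, fun e => hbY (e ▸ hv)⟩]

namespace Rooted

variable {a : V} {q x : Fin 3 → V} {Q : Fin 3 → Set V} {D : Set V} {B : Fin 3 → Set V}
  {b : Fin 3 → V} {F : Set V} {f g : V}

/-- A connector does not attach to consecutive vertices of two rungs at both of its ends. -/
lemma two_edges_false (h : Rooted G a q x Q D) (hB : Rungs G x D B b)
    (hF : Connector G D B b F f g) {i j : Fin 3} (hij : i ≠ j) {Y₁ Y₂ Z₁ Z₂ : Set V} {y y' z z' : V}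
    (hY₁ : PS G Y₁ (x i) y) (hY₂ : PS G Y₂ y' (b i)) (hY : B i = Y₁ ∪ Y₂) (hlY : Link G Y₁ Y₂ y y')
    (hZ₁ : PS G Z₁ (x j) z) (hZ₂ : PS G Z₂ z' (b j)) (hZ : B j = Z₁ ∪ Z₂) (hlZ : Link G Z₁ Z₂ z z')
    (hf : ∀ v ∈ F, ∀ p ∈ B i, G.Adj v p ↔ (v = f ∧ (p = y ∨ p = y')))
    (hg : ∀ v ∈ F, ∀ p ∈ B j, G.Adj v p ↔ (v = g ∧ (p = z ∨ p = z'))) : False := by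
  have hD := fun i v hv => h.not_mem_D (i := i) (v := v) hv
  have haD := h.apex_not_mem_D
  have hane : ∀ m, a ≠ x m := fun m e => h.apex m (e ▸ h.mem_x m)
  have hYB₁ : Y₁ ⊆ B i := hY ▸ Set.subset_union_left
  have hYB₂ : Y₂ ⊆ B i := hY ▸ Set.subset_union_right
  have hZB₁ : Z₁ ⊆ B j := hZ ▸ Set.subset_union_left
  have hZB₂ : Z₂ ⊆ B j := hZ ▸ Set.subset_union_right
  have hy := hY₁.right_mem
  have hz := hZ₁.right_mem
  have hy' := hY₂.left_mem
  have hz' := hZ₂.left_mem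
  have hbi := hY₂.right_mem
  have hbj := hZ₂.right_mem
  have hxi := hY₁.left_mem
  have hxj := hZ₁.left_mem
  have hl := hB.link i j hij
  have hYD : Y₁ ⊆ D ∪ {x i} := hYB₁.trans (hB.subset i)
  have hZD : Z₁ ⊆ D ∪ {x j} := hZB₁.trans (hB.subset j)
  have hBQ : ∀ {i j : Fin 3}, i ≠ j → ∀ {C : Set V}, x j ∈ C → C ⊆ D ∪ {x j} →
      (∀ v ∈ C, v ≠ x i ∧ ¬ G.Adj v (x i)) → Anti G C (Q i) := by
    intro i j hij C _ hC hCx v hv v' hv'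
    by_cases hvx : v' = x i
    · exact hvx ▸ hCx v hv
    · rcases hC hv with h1 | rfl
      · exact ⟨fun e => hD i v' hv' (e ▸ h1), fun e => h.deg i v' hv' hvx v h1 e.symm⟩
      · exact h.anti j i hij.symm _ (h.mem_x j) v' hv'
  have hbY₁ : b i ∉ Y₁ := fun h1 => (hlY _ h1 _ hbi).1 rfl
  have hbZ₁ : b j ∉ Z₁ := fun h1 => (hlZ _ h1 _ hbj).1 rfl
  have hYZ : ∀ v ∈ Y₁, ∀ v' ∈ B j, v ≠ v' ∧ ¬ G.Adj v v' := fun v hv v' hv' =>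
    ⟨(hl v (hYB₁ hv) v' hv').1, fun e => hbY₁ (((hl v (hYB₁ hv) v' hv').2.1 e).1 ▸ hv)⟩
  have hZY : ∀ v ∈ Z₁, ∀ v' ∈ B i, v ≠ v' ∧ ¬ G.Adj v v' := fun v hv v' hv' =>
    ⟨(hl v' hv' v (hZB₁ hv)).1.symm,
      fun e => hbZ₁ (((hl v' hv' v (hZB₁ hv)).2.1 e.symm).2 ▸ hv)⟩
  have hY₂Z₁ : ∀ v ∈ Y₂, ∀ v' ∈ Z₁, v ≠ v' ∧ ¬ G.Adj v v' := fun v hv v' hv' =>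
    ⟨(hZY v' hv' v (hYB₂ hv)).1.symm, fun e => (hZY v' hv' v (hYB₂ hv)).2 e.symm⟩
  -- the vertices of the rungs other than the `x`'s are in `D`
  have hY₂D : Y₂ ⊆ D := fun v hv => (hB.subset i (hYB₂ hv)).resolve_right fun e =>
    (hlY _ hxi v hv).1 (show x i = v from e.symm)
  have hZ₂D : Z₂ ⊆ D := fun v hv => (hB.subset j (hZB₂ hv)).resolve_right fun e =>
    (hlZ _ hxj v hv).1 (show x j = v from e.symm)
  have hDQ : ∀ {C : Set V}, C ⊆ D → ∀ m, (∀ v ∈ C, v ≠ x m ∧ ¬ G.Adj v (x m)) → Anti G C (Q m) := by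
    intro C hC m hCx v hv v' hv'
    by_cases hvx : v' = x m
    · exact hvx ▸ hCx v hv
    · exact ⟨fun e => hD m v' hv' (e ▸ hC hv), fun e => h.deg m v' hv' hvx v (hC hv) e.symm⟩
  have hY₁Qj : Anti G Y₁ (Q j) := hBQ hij.symm hxi hYD fun v hv => hYZ v hv _ (hZB₁ hxj)
  have hZ₁Qi : Anti G Z₁ (Q i) := hBQ hij hxj hZD fun v hv => hZY v hv _ (hYB₁ hxi)
  have hQij := h.anti i j hij
  have haY : a ∉ Y₁ ∪ Q i := by
    rintro (h1 | h1)
    exacts [(hYD h1).elim haD (hane i), h.apex i h1]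
  have haZ : a ∉ Z₁ ∪ Q j := by
    rintro (h1 | h1)
    exacts [(hZD h1).elim haD (hane j), h.apex j h1]
  have glueQ : ∀ {i : Fin 3} {C : Set V} {y : V}, PS G C (x i) y → C ⊆ D ∪ {x i} →
      PS G (C ∪ Q i) y (q i) ∧ ∀ v ∈ C ∪ Q i, G.Adj a v ↔ v = q i := by
    intro i C y hC hCD
    refine ⟨hC.symm.glue_vertex (h.path i).symm fun v hv v' hv' hne hne' => ?_, ?_⟩
    · have hvD : v ∈ D := (hCD hv).resolve_right hne
      exact ⟨fun e => hD i v' hv' (e ▸ hvD), fun e => h.deg i v' hv' hne' v hvD e.symm⟩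
    · rintro v (hv | hv)
      · rcases hCD hv with h1 | rfl
        · exact ⟨fun e => absurd e (h.not_adj_apex h1), fun e => absurd h1 (hD i v (e ▸ h.mem_q i))⟩
        · exact h.adj_apex_Q (h.mem_x i)
      · exact h.adj_apex_Q hv
  obtain ⟨k1, haY'⟩ := glueQ hY₁ hYD
  obtain ⟨k2, haZ'⟩ := glueQ hZ₁ hZD
  have k3 : PS G (insert a (Y₁ ∪ Q i)) y a := k1.concat haY ((haY' _ (.inr (h.mem_q i))).2 rfl).symm
    fun v hv e => (haY' v hv).1 e.symm
  have k4 : PS G (insert a (Y₁ ∪ Q i) ∪ (Z₁ ∪ Q j)) y z := by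
    refine k3.glue k2.symm ?_
    rintro v (rfl | hv | hv) v' hv'
    · exact ⟨fun e => haZ (e ▸ hv'), by rw [haZ' v' hv']; simp⟩
    · have hva : v ≠ a := fun e => haY (e ▸ .inl hv)
      have : v ≠ v' ∧ ¬ G.Adj v v' := by
        rcases hv' with h1 | h1
        exacts [hYZ v hv v' (hZB₁ h1), hY₁Qj v hv v' h1]
      exact ⟨this.1, fun e => absurd e this.2, fun e => absurd e.1 hva⟩
    · have hva : v ≠ a := fun e => haY (e ▸ .inr hv)
      have : v ≠ v' ∧ ¬ G.Adj v v' := by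
        rcases hv' with h1 | h1
        exacts [⟨(hZ₁Qi v' h1 v hv).1.symm, fun e => (hZ₁Qi v' h1 v hv).2 e.symm⟩, hQij v hv v' h1]
      exact ⟨this.1, fun e => absurd e this.2, fun e => absurd e.1 hva⟩
  have k5 : PS G (Y₂ ∪ Z₂) y' z' := hY₂.glue hZ₂.symm fun v hv v' hv' => hl v (hYB₂ hv) v' (hZB₂ hv')
  have haY₂ : ∀ v ∈ Y₂ ∪ Z₂, a ≠ v ∧ ¬ G.Adj a v := by
    rintro v (hv | hv)
    · exact ⟨fun e => haD (e ▸ hY₂D hv), h.not_adj_apex (hY₂D hv)⟩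
    · exact ⟨fun e => haD (e ▸ hZ₂D hv), h.not_adj_apex (hZ₂D hv)⟩
  have hlY' : ∀ v ∈ Q i, ∀ v' ∈ Y₂, v ≠ v' ∧ (G.Adj v v' ↔ (v = y ∧ v' = y')) := by
    intro v hv v' hv'
    refine ⟨fun e => hD i v hv (e ▸ hY₂D hv'), ?_⟩
    by_cases hvx : v = x i
    · exact (hlY v (hvx ▸ hxi) v' hv').2
    · refine ⟨fun e => absurd e (h.deg i v hv hvx v' (hY₂D hv')), ?_⟩
      rintro ⟨rfl, rfl⟩
      exact absurd ((hYD hy).resolve_right hvx) (hD i v hv)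
  have hlZ' : ∀ v ∈ Q j, ∀ v' ∈ Z₂, v ≠ v' ∧ (G.Adj v v' ↔ (v = z ∧ v' = z')) := by
    intro v hv v' hv'
    refine ⟨fun e => hD j v hv (e ▸ hZ₂D hv'), ?_⟩
    by_cases hvx : v = x j
    · exact (hlZ v (hvx ▸ hxj) v' hv').2
    · refine ⟨fun e => absurd e (h.deg j v hv hvx v' (hZ₂D hv')), ?_⟩
      rintro ⟨rfl, rfl⟩
      exact absurd ((hZD hz).resolve_right hvx) (hD j v hv)
  have hQZ₂ : Anti G Z₂ (Q i) := hDQ hZ₂D i fun v hv =>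
    ⟨(hYZ _ hxi v (hZB₂ hv)).1.symm, fun e => (hYZ _ hxi v (hZB₂ hv)).2 e.symm⟩
  have hQY₂ : Anti G Y₂ (Q j) := hDQ hY₂D j fun v hv => hY₂Z₁ v hv _ hxj
  have n1 : ∀ v ∈ insert a (Y₁ ∪ Q i), v ≠ z := by
    rintro v (rfl | hv | hv) rfl
    · exact haZ (.inl hz)
    · exact (hYZ v hv v (hZB₁ hz)).1 rfl
    · exact (hZ₁Qi v hz v hv).1 rfl
  have n2 : ∀ v ∈ Z₁ ∪ Q j, v ≠ y := by
    rintro v (hv | hv) rfl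
    · exact (hZY v hv v (hYB₁ hy)).1 rfl
    · exact (hY₁Qj v hy v hv).1 rfl
  have n3 : ∀ v ∈ Y₂, v ≠ z' := fun v hv e => (hl v (hYB₂ hv) z' (hZB₂ hz')).1 e
  have n4 : ∀ v ∈ Z₂, v ≠ y' := fun v hv e => (hl y' (hYB₂ hy') v (hZB₂ hv)).1 e.symm
  -- The near-prism has triangles `y y' f` and `z z' g`. Its paths are the route through the roots
  -- and the apex, the route through the edge between `b i` and `b j`, and `F`.
  have l12 : Link2 G (insert a (Y₁ ∪ Q i) ∪ (Z₁ ∪ Q j)) (Y₂ ∪ Z₂) y y' z z' := by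
    have mk : ∀ {v v' : V}, (v ≠ v' ∧ ¬ G.Adj v v') → (v ≠ y ∨ v' ≠ y') → (v ≠ z ∨ v' ≠ z') →
        v ≠ v' ∧ (G.Adj v v' ↔ ((v = y ∧ v' = y') ∨ (v = z ∧ v' = z'))) := by
      intro v v' h1 h2 h3; refine ⟨h1.1, ?_⟩; simp only [h1.2, false_iff]; tauto
    have hay : a ≠ y := fun e => haY (e ▸ .inl hy)
    rintro v (hv | hv) v' hv'
    · have hvz := n1 v hv
      rcases hv' with hv' | hv'
      · have : v ≠ v' ∧ (G.Adj v v' ↔ (v = y ∧ v' = y')) := by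
          rcases hv with rfl | hv | hv
          · have := haY₂ v' (.inl hv')
            simp [this.1, this.2, hay]
          · exact hlY v hv v' hv'
          · exact hlY' v hv v' hv'
        simp [this.1, this.2, hvz]
      · have hvy := n4 v' hv'
        refine mk ?_ (.inr hvy) (.inl hvz)
        rcases hv with rfl | hv | hv
        · exact haY₂ v' (.inr hv')
        · exact hYZ v hv v' (hZB₂ hv')
        · exact ⟨(hQZ₂ v' hv' v hv).1.symm, fun e => (hQZ₂ v' hv' v hv).2 e.symm⟩
    · have hvy := n2 v hv
      rcases hv' with hv' | hv'
      · refine mk ?_ (.inl hvy) (.inr (n3 v' hv'))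
        rcases hv with hv | hv
        · exact hZY v hv v' (hYB₂ hv')
        · exact ⟨(hQY₂ v' hv' v hv).1.symm, fun e => (hQY₂ v' hv' v hv).2 e.symm⟩
      · have : v ≠ v' ∧ (G.Adj v v' ↔ (v = z ∧ v' = z')) := by
          rcases hv with hv | hv
          · exact hlZ v hv v' hv'
          · exact hlZ' v hv v' hv'
        simp [this.1, this.2, hvy]
  have hFB := hF.disj
  have hFD := hF.subset
  have hfB : ∀ v ∈ F, ∀ p ∈ B i, p ≠ v ∧ (G.Adj p v ↔ ((p = y ∧ v = f) ∨ (p = y' ∧ v = f))) := by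
    intro v hv p hp
    refine ⟨fun e => hFB i v hv (e ▸ hp), ?_⟩
    rw [G.adj_comm, hf v hv p hp]; tauto
  have hgB : ∀ v ∈ F, ∀ p ∈ B j, p ≠ v ∧ (G.Adj p v ↔ ((p = z ∧ v = g) ∨ (p = z' ∧ v = g))) := by
    intro v hv p hp
    refine ⟨fun e => hFB j v hv (e ▸ hp), ?_⟩
    rw [G.adj_comm, hg v hv p hp]; tauto
  have hFQi : ∀ v ∈ F, ∀ p ∈ Q i, p ≠ v ∧ (G.Adj p v ↔ (p = y ∧ v = f)) := by
    intro v hv p hp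
    by_cases hpx : p = x i
    · have := hfB v hv p (hYB₁ (hpx ▸ hxi))
      have hp' : p ≠ y' := fun e => (hlY p (hpx ▸ hxi) y' hy').1 e
      simpa [hp'] using this
    · refine ⟨fun e => hD i p hp (e ▸ hFD hv), fun e => absurd e (h.deg i p hp hpx v (hFD hv)), ?_⟩
      rintro ⟨rfl, -⟩
      exact absurd ((hYD hy).resolve_right hpx) (hD i p hp)
  have hFQj : ∀ v ∈ F, ∀ p ∈ Q j, p ≠ v ∧ (G.Adj p v ↔ (p = z ∧ v = g)) := by
    intro v hv p hp
    by_cases hpx : p = x j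
    · have := hgB v hv p (hZB₁ (hpx ▸ hxj))
      have hp' : p ≠ z' := fun e => (hlZ p (hpx ▸ hxj) z' hz').1 e
      simpa [hp'] using this
    · refine ⟨fun e => hD j p hp (e ▸ hFD hv), fun e => absurd e (h.deg j p hp hpx v (hFD hv)), ?_⟩
      rintro ⟨rfl, -⟩
      exact absurd ((hZD hz).resolve_right hpx) (hD j p hp)
  have l13 : Link2 G (insert a (Y₁ ∪ Q i) ∪ (Z₁ ∪ Q j)) F y f z g := by
    rintro v (hv | hv) v' hv'
    · have hvz := n1 v hv
      have : v ≠ v' ∧ (G.Adj v v' ↔ (v = y ∧ v' = f)) := by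
        rcases hv with rfl | hv | hv
        · have hay : v ≠ y := fun e => haY (e ▸ .inl hy)
          have := h.not_adj_apex (hFD hv')
          exact ⟨fun e => haD (e ▸ hFD hv'), fun e => absurd e this, fun e => absurd e.1 hay⟩
        · have := hfB v' hv' v (hYB₁ hv)
          have hvy : v ≠ y' := (hlY v hv y' hy').1
          simpa [hvy] using this
        · exact hFQi v' hv' v hv
      simp [this.1, this.2, hvz]
    · have hvy := n2 v hv
      have : v ≠ v' ∧ (G.Adj v v' ↔ (v = z ∧ v' = g)) := by
        rcases hv with hv | hv
        · have := hgB v' hv' v (hZB₁ hv)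
          have hvz : v ≠ z' := (hlZ v hv z' hz').1
          simpa [hvz] using this
        · exact hFQj v' hv' v hv
      simp [this.1, this.2, hvy]
  have l23 : Link2 G (Y₂ ∪ Z₂) F y' f z' g := by
    rintro v (hv | hv) v' hv'
    · have := hfB v' hv' v (hYB₂ hv)
      have hvy : v ≠ y := fun e => (hlY y hy v hv).1 e.symm
      simpa [hvy, n3 v hv] using this
    · have := hgB v' hv' v (hZB₂ hv)
      have hvz : v ≠ z := fun e => (hlZ z hz v hv).1 e.symm
      simpa [hvz, n4 v hv] using this
  exact h.free.nearPrism_false k4 k5 hF.path l12 l13 l23 (hYZ y hy z (hZB₁ hz)).1 (n3 y' hy')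

end Rooted

end EvenHole

namespace EvenHole

variable {V : Type*}
variable {G : SimpleGraph V} {S T : Set V} {u v w z : V}

namespace Rooted

variable {a : V} {q x : Fin 3 → V} {Q : Fin 3 → Set V} {D : Set V} {B : Fin 3 → Set V}
  {b : Fin 3 → V} {F : Set V} {f g : V}

/-- Minimality leaves only `g` to see the rungs `j` and `k`. Since `u` is not `b i`, the connector
extends along rung `i` to `x i` without using `b i`, and `attach_path` applies to the path formed by
the other two rungs. -/
lemma attach_others [Finite V] (h : Rooted G a q x Q D) (hB : Rungs G x D B b)
    (hF : Connector G D B b F f g) {i j k : Fin 3} (hij : i ≠ j) (hik : i ≠ k) (hjk : j ≠ k)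
    (hu : u ∈ B i) (hub : u ≠ b i) (hfu : G.Adj f u) (hg : ∃ p ∈ B j ∪ B k, G.Adj g p) :
    (∃ E, PS G E g (x i) ∧ F ⊆ E ∧ E ⊆ F ∪ (B i \ {b i})) ∧
    (∃ z z', z ≠ z' ∧ G.Adj z z' ∧ z ∈ B j ∪ B k ∧ z' ∈ B j ∪ B k ∧
      ∀ p ∈ B j ∪ B k, G.Adj g p ↔ (p = z ∨ p = z')) ∧
    ∀ v ∈ F, ∀ p ∈ B j ∪ B k, G.Adj v p → v = g := by
  have hfF := hF.path.left_mem
  have hgF := hF.path.right_mem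
  have hFjk : ∀ v ∈ F, ∀ p ∈ B j ∪ B k, G.Adj v p → v = g := by
    intro v hv p hp e
    rcases hp with hp | hp
    · rcases hF.min i j hij f hfF v hv u hu p hp hfu e (fun h => hub h.1) with h1 | h1
      exacts [h1.2, h1.2.trans h1.1]
    · rcases hF.min i k hik f hfF v hv u hu p hp hfu e (fun h => hub h.1) with h1 | h1
      exacts [h1.2, h1.2.trans h1.1]
  obtain ⟨p', hp', hgp'⟩ := hg
  obtain ⟨E, hE, hFE, hEF⟩ := hF.path.extend_to_end (hB.path i) (hF.disj i) hu hub hfu (by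
    intro v hv hvf p hp hpb e
    rcases hp' with hp' | hp'
    · rcases hF.min i j hij v hv g hgF p hp p' hp' e hgp' (fun h => hpb h.1) with h1 | h1
      exacts [hvf h1.1, hvf (h1.1.trans h1.2)]
    · rcases hF.min i k hik v hv g hgF p hp p' hp' e hgp' (fun h => hpb h.1) with h1 | h1
      exacts [hvf h1.1, hvf (h1.1.trans h1.2)])
  refine ⟨⟨E, hE, hFE, hEF⟩, ?_, hFjk⟩
  have hBE : ∀ v ∈ B i, v ≠ b i → ∀ p ∈ B j ∪ B k, v ≠ p ∧ ¬ G.Adj v p := by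
    rintro v hv hvb p (hp | hp)
    · exact ⟨(hB.link i j hij v hv p hp).1, fun e => hvb ((hB.link i j hij v hv p hp).2.1 e).1⟩
    · exact ⟨(hB.link i k hik v hv p hp).1, fun e => hvb ((hB.link i k hik v hv p hp).2.1 e).1⟩
  obtain ⟨z, z', S₁, S₂, h1, h2, h3, h4, h5⟩ := h.attach_path hij hik hjk
    ((hB.path j).glue (hB.path k).symm (hB.link j k hjk))
    (by
      rintro v (hv | hv)
      exacts [(hB.subset j hv).imp id .inl, (hB.subset k hv).imp id .inr]) hE
    (by
      intro v hv
      rcases hEF hv with h1 | h1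
      exacts [.inl (hF.subset h1), hB.subset i h1.1])
    (fun e => h.x_not_mem_D i (e ▸ hF.subset hgF))
    (by
      intro v hv hp
      rcases hEF hv with h1 | h1
      · rcases hp with hp | hp
        exacts [hF.disj j v h1 hp, hF.disj k v h1 hp]
      · exact (hBE v h1.1 h1.2 v hp).1 rfl)
    (by
      intro v hv hvg p hp e
      rcases hEF hv with h1 | h1
      · exact hvg (hFjk v h1 p hp e)
      · exact (hBE v h1.1 h1.2 p hp).2 e) ⟨p', hp', hgp'⟩
  have := h4 z h1.right_mem z' h2.left_mem
  exact ⟨z, z', this.1, this.2.2 ⟨rfl, rfl⟩, h3 ▸ .inl h1.right_mem, h3 ▸ .inr h2.left_mem, h5⟩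

/-- One of `z`, `z'` differs from `b j`, so `attach_others` also applies to the reversed connector.
Because `u` is in rung `i` and is not `b i`, both neighbors of `f` lie there, and `two_edges_false`
finishes. -/
lemma not_both_in_rung [Finite V] (h : Rooted G a q x Q D) (hB : Rungs G x D B b)
    (hF : Connector G D B b F f g) {i j k : Fin 3} (hij : i ≠ j) (hik : i ≠ k) (hjk : j ≠ k)
    (hu : u ∈ B i) (hub : u ≠ b i) (hfu : G.Adj f u)
    (hFj : ∀ v ∈ F, ∀ p ∈ B j, G.Adj v p → v = g) {z z' : V} (hzz' : z ≠ z') (hadj : G.Adj z z')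
    (hz : z ∈ B j) (hz' : z' ∈ B j) (hgz : ∀ p ∈ B j, G.Adj g p ↔ (p = z ∨ p = z')) : False := by
  have hgF := hF.path.right_mem
  obtain ⟨z₁, hz₁, hz₁b, hgz₁⟩ : ∃ z₁ ∈ B j, z₁ ≠ b j ∧ G.Adj g z₁ := by
    by_cases hzb : z = b j
    · exact ⟨z', hz', fun e => hzz' (hzb.trans e.symm), (hgz z' hz').2 (.inr rfl)⟩
    · exact ⟨z, hz, hzb, (hgz z hz).2 (.inl rfl)⟩
  obtain ⟨-, ⟨y, y', -, hyy', hy, hy', hfy⟩, hFi⟩ := h.attach_others hB hF.symm hij.symm hjk hik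
    hz₁ hz₁b hgz₁ ⟨u, .inl hu, hfu⟩
  have hl := hB.link i k hik
  have huk : u ∉ B k := fun h1 => (hl u hu u h1).1 rfl
  have huy := (hfy u (.inl hu)).1 hfu
  have hyi : y ∈ B i ∧ y' ∈ B i := by
    rcases hy with hy | hy <;> rcases hy' with hy' | hy'
    · exact ⟨hy, hy'⟩
    · have := (hl y hy y' hy').2.1 hyy'
      rcases huy with rfl | rfl
      exacts [absurd this.1 hub, absurd hy' huk]
    · have := (hl y' hy' y hy).2.1 hyy'.symm
      rcases huy with rfl | rfl
      exacts [absurd hy huk, absurd this.1 hub]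
    · rcases huy with rfl | rfl
      exacts [absurd hy huk, absurd hy' huk]
  have hf' : ∀ v ∈ F, ∀ p ∈ B i, G.Adj v p ↔ (v = f ∧ (p = y ∨ p = y')) := by
    intro v hv p hp
    constructor
    · intro e
      obtain rfl := hFi v hv p (.inl hp) e
      exact ⟨rfl, (hfy p (.inl hp)).1 e⟩
    · rintro ⟨rfl, e⟩; exact (hfy p (.inl hp)).2 e
  have hg' : ∀ v ∈ F, ∀ p ∈ B j, G.Adj v p ↔ (v = g ∧ (p = z ∨ p = z')) := by
    intro v hv p hp
    constructor
    · intro e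
      obtain rfl := hFj v hv p hp e
      exact ⟨rfl, (hgz p hp).1 e⟩
    · rintro ⟨rfl, e⟩; exact (hgz p hp).2 e
  have hf'' : ∀ v ∈ F, ∀ p ∈ B i, G.Adj v p ↔ (v = f ∧ (p = y' ∨ p = y)) := fun v hv p hp => by
    rw [hf' v hv p hp, or_comm (a := p = y)]
  have hg'' : ∀ v ∈ F, ∀ p ∈ B j, G.Adj v p ↔ (v = g ∧ (p = z' ∨ p = z)) := fun v hv p hp => by
    rw [hg' v hv p hp, or_comm (a := p = z)]
  obtain ⟨Y₁, Y₂, hY, ⟨g1, g2, g3⟩ | ⟨g1, g2, g3⟩⟩ := (hB.path i).split_adj hyi.1 hyi.2 hyy' <;>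
  obtain ⟨Z₁, Z₂, hZ, ⟨k1, k2, k3⟩ | ⟨k1, k2, k3⟩⟩ := (hB.path j).split_adj hz hz' hadj
  · exact h.two_edges_false hB hF hij g1 g2 hY g3 k1 k2 hZ k3 hf' hg'
  · exact h.two_edges_false hB hF hij g1 g2 hY g3 k1 k2 hZ k3 hf' hg''
  · exact h.two_edges_false hB hF hij g1 g2 hY g3 k1 k2 hZ k3 hf'' hg'
  · exact h.two_edges_false hB hF hij g1 g2 hY g3 k1 k2 hZ k3 hf'' hg''

/-- The two neighbors of `g` are adjacent and not in a common rung, and the only edge between the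
rungs `j` and `k` joins `b j` to `b k`. -/
lemma connector_end [Finite V] (h : Rooted G a q x Q D) (hB : Rungs G x D B b)
    (hF : Connector G D B b F f g) {i j k : Fin 3} (hij : i ≠ j) (hik : i ≠ k) (hjk : j ≠ k)
    (hu : u ∈ B i) (hub : u ≠ b i) (hfu : G.Adj f u) (hg : ∃ p ∈ B j ∪ B k, G.Adj g p) :
    (∃ E, PS G E g (x i) ∧ F ⊆ E ∧ E ⊆ F ∪ (B i \ {b i})) ∧
      ∀ p ∈ B j ∪ B k, G.Adj g p ↔ (p = b j ∨ p = b k) := by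
  obtain ⟨hE, ⟨z, z', hzz', hadj, hz, hz', hgz⟩, hFjk⟩ :=
    h.attach_others hB hF hij hik hjk hu hub hfu hg
  refine ⟨hE, ?_⟩
  have hl := hB.link j k hjk
  rcases hz with hz | hz <;> rcases hz' with hz' | hz'
  · exact (h.not_both_in_rung hB hF hij hik hjk hu hub hfu (fun v hv p hp => hFjk v hv p (.inl hp))
      hzz' hadj hz hz' fun p hp => hgz p (.inl hp)).elim
  · obtain ⟨rfl, rfl⟩ := (hl z hz z' hz').2.1 hadj
    exact hgz
  · obtain ⟨rfl, rfl⟩ := (hl z' hz' z hz).2.1 hadj.symm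
    exact fun p hp => by rw [hgz p hp, or_comm]
  · exact (h.not_both_in_rung hB hF hik hij hjk.symm hu hub hfu
      (fun v hv p hp => hFjk v hv p (.inr hp)) hzz' hadj hz hz' fun p hp => hgz p (.inr hp)).elim

end Rooted

/-! ### Strips and their maximality. -/

/-- Disjoint sets `M i` with subsets `A i`, where the sets `A i` are complete to each other, there
are no other edges between the sets `M i`, and every vertex of `M i` is on a path from `x i`
to `A i`. -/
structure Strips (G : SimpleGraph V) (x : Fin 3 → V) (D : Set V) (M A : Fin 3 → Set V) :
    Prop where
  subset : ∀ i, M i ⊆ D ∪ {x i}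
  sub : ∀ i, A i ⊆ M i
  nonempty : ∀ i, (A i).Nonempty
  rung : ∀ i, ∀ v ∈ M i, ∃ S u, PS G S (x i) u ∧ S ⊆ M i ∧ v ∈ S ∧ ∀ p ∈ S, p ∈ A i ↔ p = u
  adj : ∀ i j, i ≠ j → ∀ u ∈ M i, ∀ v ∈ M j, u ≠ v ∧ (G.Adj u v ↔ (u ∈ A i ∧ v ∈ A j))

namespace Strips

variable {x : Fin 3 → V} {D : Set V} {M A : Fin 3 → Set V}

lemma rungs (h : Strips G x D M A) {B : Fin 3 → Set V} {b : Fin 3 → V}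
    (hB : ∀ i, PS G (B i) (x i) (b i)) (hBM : ∀ i, B i ⊆ M i)
    (hb : ∀ i, ∀ p ∈ B i, p ∈ A i ↔ p = b i) : Rungs G x D B b := by
  refine ⟨hB, fun i => (hBM i).trans (h.subset i), fun i j hij u hu v hv => ?_⟩
  rw [← hb i u hu, ← hb j v hv]
  exact h.adj i j hij u (hBM i hu) v (hBM j hv)

/-- `E` serves as the rung for every new vertex; it must avoid the old `A i` so that it meets the
new end set only in `g`. -/
lemma enlarge (h : Strips G x D M A) (i : Fin 3) {F E : Set V} {g : V} (hg : g ∈ F) (hF : F ⊆ D)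
    (hFM : ∀ v ∈ F, ∀ m, v ∉ M m)
    (hadj : ∀ m, m ≠ i → ∀ v ∈ F, ∀ p ∈ M m, G.Adj v p ↔ (v = g ∧ p ∈ A m))
    (hE : PS G E g (x i)) (hFE : F ⊆ E) (hEF : E ⊆ F ∪ (M i \ A i)) :
    Strips G x D (Function.update M i (M i ∪ F)) (Function.update A i (insert g (A i))) := by
  have hFA : ∀ v ∈ F, ∀ m, v ∉ A m := fun v hv m hA => hFM v hv m (h.sub m hA)
  constructor
  · intro m
    rcases eq_or_ne m i with rfl | hm
    · rw [Function.update_self]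
      exact Set.union_subset (h.subset m) (hF.trans Set.subset_union_left)
    · rw [Function.update_of_ne hm]; exact h.subset m
  · intro m
    rcases eq_or_ne m i with rfl | hm
    · rw [Function.update_self, Function.update_self]
      exact Set.insert_subset (.inr hg) ((h.sub m).trans Set.subset_union_left)
    · rw [Function.update_of_ne hm, Function.update_of_ne hm]; exact h.sub m
  · intro m
    rcases eq_or_ne m i with rfl | hm
    · rw [Function.update_self]; exact Set.insert_nonempty _ _
    · rw [Function.update_of_ne hm]; exact h.nonempty m
  · intro m v hv
    rcases eq_or_ne m i with rfl | hm
    · rw [Function.update_self] at *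
      rw [Function.update_self]
      rcases hv with hv | hv
      · obtain ⟨S, u, h1, h2, h3, h4⟩ := h.rung m v hv
        refine ⟨S, u, h1, h2.trans Set.subset_union_left, h3, fun p hp => ?_⟩
        rw [← h4 p hp, Set.mem_insert_iff, or_iff_right]
        rintro rfl
        exact hFM p hg m (h2 hp)
      · refine ⟨E, g, hE.symm, fun p hp => (hEF hp).symm.imp And.left id, hFE hv, fun p hp => ?_⟩
        rw [Set.mem_insert_iff, or_iff_left_iff_imp]
        intro hA
        rcases hEF hp with h1 | h1
        exacts [absurd hA (hFA p h1 m), absurd hA h1.2]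
    · rw [Function.update_of_ne hm] at *
      rw [Function.update_of_ne hm]
      exact h.rung m v hv
  · have key : ∀ m, m ≠ i → ∀ v ∈ M i ∪ F, ∀ p ∈ M m,
        v ≠ p ∧ (G.Adj v p ↔ (v ∈ insert g (A i) ∧ p ∈ A m)) := by
      rintro m hm v (hv | hv) p hp
      · have := h.adj i m hm.symm v hv p hp
        refine ⟨this.1, this.2.trans ?_⟩
        rw [Set.mem_insert_iff, or_iff_right]
        rintro rfl
        exact hFM v hg i hv
      · refine ⟨fun e => hFM v hv m (e ▸ hp), (hadj m hm v hv p hp).trans ?_⟩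
        rw [Set.mem_insert_iff, or_iff_left (hFA v hv i)]
    intro m n hmn u hu v hv
    rcases eq_or_ne m i with rfl | hm
    · rw [Function.update_self] at hu ⊢
      rw [Function.update_of_ne hmn.symm] at hv ⊢
      exact key n hmn.symm u hu v hv
    · rw [Function.update_of_ne hm] at hu ⊢
      rcases eq_or_ne n i with rfl | hn
      · rw [Function.update_self] at hv ⊢
        have := key m hm v hv u hu
        exact ⟨this.1.symm, by rw [G.adj_comm, this.2, and_comm]⟩
      · rw [Function.update_of_ne hn] at hv ⊢
        exact h.adj m n hmn u hu v hv

end Strips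

namespace Rooted

variable {a : V} {q x : Fin 3 → V} {Q : Fin 3 → Set V} {D : Set V} {M A : Fin 3 → Set V}

lemma exists_third {i j : Fin 3} (hij : i ≠ j) : ∃ k, i ≠ k ∧ j ≠ k ∧ ∀ m, m ≠ i → m = j ∨ m = k := by
  revert i j; decide

lemma exists_maximal_strips [Finite V] (h : Rooted G a q x Q D) :
    ∃ M A, Strips G x D M A ∧ ∀ M' A', Strips G x D M' A' →
      (⋃ i, M' i).ncard ≤ (⋃ i, M i).ncard := by
  obtain ⟨B, b, hB⟩ := h.rungs
  have h₀ : Strips G x D B fun i => {b i} := by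
    refine ⟨hB.subset, fun i => ?_, fun i => ⟨b i, rfl⟩, fun i v hv => ?_, hB.link⟩
    · simpa using (hB.path i).right_mem
    · exact ⟨B i, b i, hB.path i, subset_rfl, hv, fun p _ => Iff.rfl⟩
  have : Nonempty {p : (Fin 3 → Set V) × (Fin 3 → Set V) // Strips G x D p.1 p.2} :=
    ⟨⟨(B, fun i => {b i}), h₀⟩⟩
  obtain ⟨⟨p, hp⟩, hmax⟩ := Finite.exists_max
    fun p : {p : (Fin 3 → Set V) × (Fin 3 → Set V) // Strips G x D p.1 p.2} => (⋃ i, p.1.1 i).ncard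
  exact ⟨p.1, p.2, hp, fun M' A' h' => hmax ⟨(M', A'), h'⟩⟩

/-- A path outside the strips attaches to a single strip or to the sets `A i` only. -/
lemma strips_local [Finite V] (h : Rooted G a q x Q D) (hM : Strips G x D M A)
    (hmax : ∀ M' A', Strips G x D M' A' → (⋃ i, M' i).ncard ≤ (⋃ i, M i).ncard)
    {F : Set V} {f g : V} (hF : PS G F f g) (hFD : F ⊆ D) (hFM : ∀ v ∈ F, ∀ m, v ∉ M m)
    {i j : Fin 3} (hij : i ≠ j) (hu : u ∈ M i) (huA : u ∉ A i) (hv : v ∈ M j) (hfu : G.Adj f u)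
    (hgv : G.Adj g v) : False := by
  -- The condition on the contacts is symmetric in the two ends, so it passes to subpaths in either
  -- direction. A minimal member is then oriented so that `f` sees a vertex outside `A i`.
  let Bad : Set (Set V) := {F | ∃ f g i j u v, PS G F f g ∧ F ⊆ D ∧ (∀ v ∈ F, ∀ m, v ∉ M m) ∧
    i ≠ j ∧ u ∈ M i ∧ v ∈ M j ∧ ¬ (u ∈ A i ∧ v ∈ A j) ∧ G.Adj f u ∧ G.Adj g v}
  obtain ⟨F, hFmin⟩ := (Set.toFinite Bad).exists_minimal
    ⟨F, f, g, i, j, u, v, hF, hFD, hFM, hij, hu, hv, fun h => huA h.1, hfu, hgv⟩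
  obtain ⟨f, g, i, j, u, v, hF, hFD, hFM, hij, hu, huA, hv, hfu, hgv⟩ : ∃ f g i j u v,
      PS G F f g ∧ F ⊆ D ∧ (∀ v ∈ F, ∀ m, v ∉ M m) ∧ i ≠ j ∧ u ∈ M i ∧ u ∉ A i ∧ v ∈ M j ∧
        G.Adj f u ∧ G.Adj g v := by
    obtain ⟨f, g, i, j, u, v, hF, hFD, hFM, hij, hu, hv, hA, hfu, hgv⟩ := hFmin.prop
    by_cases huA : u ∈ A i
    · exact ⟨g, f, j, i, v, u, hF.symm, hFD, hFM, hij.symm, hv, fun h => hA ⟨huA, h⟩, hu, hgv, hfu⟩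
    · exact ⟨f, g, i, j, u, v, hF, hFD, hFM, hij, hu, huA, hv, hfu, hgv⟩
  have hmin : ∀ m n, m ≠ n → ∀ v ∈ F, ∀ w ∈ F, ∀ p ∈ M m, ∀ p' ∈ M n, G.Adj v p → G.Adj w p' →
      ¬ (p ∈ A m ∧ p' ∈ A n) → (v = f ∧ w = g) ∨ (v = g ∧ w = f) := by
    intro m n hmn v hv w hw p hp p' hp' e e' hA
    obtain ⟨T, hT, hTP, hTF⟩ := hF.sub hv hw
    have hTB : T ∈ Bad := ⟨v, w, m, n, p, p', hTP, hT.trans hFD, fun v hv => hFM v (hT hv), hmn, hp,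
      hp', hA, e, e'⟩
    exact hTF (hT.antisymm (hFmin.le_of_le hTB hT))
  obtain ⟨k, hik, hjk, hk⟩ := exists_third hij
  have hfF := hF.left_mem
  have hgF := hF.right_mem
  obtain ⟨Si, bi, hSi, hSiM, huSi, hbi⟩ := hM.rung i u hu
  -- The rung through `u` is kept fixed while the other two are arbitrary. Varying them one at a
  -- time turns the statement about single rungs into one about all of `M j` and `M k`.
  have key : ∀ Sj bj Sk bk, PS G Sj (x j) bj → Sj ⊆ M j → (∀ p ∈ Sj, p ∈ A j ↔ p = bj) →
      PS G Sk (x k) bk → Sk ⊆ M k → (∀ p ∈ Sk, p ∈ A k ↔ p = bk) →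
      (∃ p ∈ Sj ∪ Sk, G.Adj g p) → (∃ E, PS G E g (x i) ∧ F ⊆ E ∧ E ⊆ F ∪ (Si \ {bi})) ∧
        ∀ p ∈ Sj ∪ Sk, G.Adj g p ↔ (p = bj ∨ p = bk) := by
    intro Sj bj Sk bk h1 h2 h3 h4 h5 h6 h7
    let B : Fin 3 → Set V := fun m => if m = i then Si else if m = j then Sj else Sk
    let b : Fin 3 → V := fun m => if m = i then bi else if m = j then bj else bk
    have eB : B i = Si ∧ B j = Sj ∧ B k = Sk := by simp [B, hij.symm, hik.symm, hjk.symm]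
    have eb : b i = bi ∧ b j = bj ∧ b k = bk := by simp [b, hij.symm, hik.symm, hjk.symm]
    have hall : ∀ P : Fin 3 → Prop, P i → P j → P k → ∀ m, P m := by
      intro P hi hj hk' m
      by_cases hm : m = i
      · exact hm ▸ hi
      · rcases hk m hm with rfl | rfl
        exacts [hj, hk']
    have hBM : ∀ m, B m ⊆ M m := hall _ (eB.1 ▸ hSiM) (eB.2.1 ▸ h2) (eB.2.2 ▸ h5)
    have hbA : ∀ m, ∀ p ∈ B m, p ∈ A m ↔ p = b m := by
      refine hall _ ?_ ?_ ?_
      · rw [eB.1, eb.1]; exact hbi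
      · rw [eB.2.1, eb.2.1]; exact h3
      · rw [eB.2.2, eb.2.2]; exact h6
    have hR : Rungs G x D B b := hM.rungs (by
      refine hall _ ?_ ?_ ?_
      · rw [eB.1, eb.1]; exact hSi
      · rw [eB.2.1, eb.2.1]; exact h1
      · rw [eB.2.2, eb.2.2]; exact h4) hBM hbA
    have hC : Connector G D B b F f g := by
      refine ⟨hF, hFD, fun m v hv hvB => hFM v hv m (hBM m hvB), ?_⟩
      intro m n hmn v hv w hw p hp p' hp' e e' hne
      rw [← hbA m p hp, ← hbA n p' hp'] at hne
      exact hmin m n hmn v hv w hw p (hBM m hp) p' (hBM n hp') e e' hne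
    have := h.connector_end hR hC hij hik hjk (u := u) (eB.1 ▸ huSi)
      (by rw [eb.1]; exact fun e => huA ((hbi u huSi).2 e)) hfu (by rw [eB.2.1, eB.2.2]; exact h7)
    rwa [eB.1, eB.2.1, eB.2.2, eb.1, eb.2.1, eb.2.2] at this
  obtain ⟨Sj, bj, hSj, hSjM, hvSj, hbj⟩ := hM.rung j v hv
  obtain ⟨ck, hck⟩ := hM.nonempty k
  obtain ⟨Sk, bk, hSk, hSkM, hcSk, hbk⟩ := hM.rung k ck (hM.sub k hck)
  obtain ⟨⟨E, hE, hFE, hEF⟩, hgS⟩ := key Sj bj Sk bk hSj hSjM hbj hSk hSkM hbk ⟨v, .inl hvSj, hgv⟩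
  have hgbj : G.Adj g bj := (hgS bj (.inl hSj.right_mem)).2 (.inl rfl)
  have hgbk : G.Adj g bk := (hgS bk (.inr hSk.right_mem)).2 (.inr rfl)
  have hgj : ∀ p ∈ M j, G.Adj g p ↔ p ∈ A j := by
    intro p hp
    obtain ⟨S, b', h1, h2, h3, h4⟩ := hM.rung j p hp
    have := (key S b' Sk bk h1 h2 h4 hSk hSkM hbk ⟨bk, .inr hSk.right_mem, hgbk⟩).2 p (.inl h3)
    rw [this, h4 p h3, or_iff_left]
    rintro rfl
    exact (hM.adj j k hjk p hp p (hSkM hSk.right_mem)).1 rfl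
  have hgk : ∀ p ∈ M k, G.Adj g p ↔ p ∈ A k := by
    intro p hp
    obtain ⟨S, b', h1, h2, h3, h4⟩ := hM.rung k p hp
    have := (key Sj bj S b' hSj hSjM hbj h1 h2 h4 ⟨bj, .inl hSj.right_mem, hgbj⟩).2 p (.inr h3)
    rw [this, h4 p h3, or_iff_right]
    rintro rfl
    exact (hM.adj j k hjk p (hSjM hSj.right_mem) p hp).1 rfl
  have hadj : ∀ m, m ≠ i → ∀ v ∈ F, ∀ p ∈ M m, G.Adj v p ↔ (v = g ∧ p ∈ A m) := by
    intro m hm v hv p hp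
    have hg : G.Adj g p ↔ p ∈ A m := by
      rcases hk m hm with rfl | rfl
      exacts [hgj p hp, hgk p hp]
    constructor
    · intro e
      have : v = g := by
        rcases hmin i m hm.symm f hfF v hv u hu p hp hfu e (fun h => huA h.1) with h1 | h1
        exacts [h1.2, h1.2.trans h1.1]
      subst this
      exact ⟨rfl, hg.1 e⟩
    · rintro ⟨rfl, e⟩; exact hg.2 e
  have hnew := hM.enlarge i hgF hFD hFM hadj hE hFE (by
    intro p hp
    rcases hEF hp with h1 | h1
    · exact .inl h1
    · exact .inr ⟨hSiM h1.1, fun hA => h1.2 ((hbi p h1.1).1 hA)⟩)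
  have hlt : (⋃ m, M m).ncard < (⋃ m, Function.update M i (M i ∪ F) m).ncard := by
    refine Set.ncard_lt_ncard ⟨?_, fun hsub => ?_⟩
    · intro p hp
      obtain ⟨m, hm⟩ := Set.mem_iUnion.1 hp
      refine Set.mem_iUnion.2 ⟨m, ?_⟩
      by_cases hmi : m = i
      · subst hmi; rw [Function.update_self]; exact .inl hm
      · rwa [Function.update_of_ne hmi]
    · have : g ∈ ⋃ m, M m := hsub (Set.mem_iUnion.2 ⟨i, by rw [Function.update_self]; exact .inr hgF⟩)
      obtain ⟨m, hm⟩ := Set.mem_iUnion.1 this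
      exact hFM g hgF m hm
  exact absurd (hmax _ _ hnew) (not_le.2 hlt)

end Rooted

/-! ### The separation obtained from maximal strips. -/

/-- A partition of `D` and the vertices `x i` into sets `N i ∋ x i` and `C`, such that the
sets `A i ⊆ N i` are complete to each other, and all other edges are inside one set, or join `C`
to some `A i`. -/
structure Separation (G : SimpleGraph V) (x : Fin 3 → V) (D : Set V) (N A : Fin 3 → Set V)
    (C : Set V) : Prop where
  cover : ∀ v, (v ∈ D ∨ ∃ i, v = x i) → v ∈ C ∨ ∃ i, v ∈ N i
  subset : ∀ i, N i ⊆ D ∪ {x i}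
  mem : ∀ i, x i ∈ N i
  sub : ∀ i, A i ⊆ N i
  disj : ∀ i, ∀ v ∈ N i, v ∉ C
  adj : ∀ i j, i ≠ j → ∀ u ∈ N i, ∀ v ∈ N j, u ≠ v ∧ (G.Adj u v ↔ (u ∈ A i ∧ v ∈ A j))
  adj_C : ∀ i, ∀ u ∈ N i, ∀ v ∈ C, G.Adj u v → u ∈ A i

/-- Each `N i` is `M i` with everything reachable outside the strips from a neighbor of `M i \ A i`.
By `strips_local`, the added parts of different strips are disjoint and unattached to other strips.
The unreached vertices form `C`, which can see only the sets `A i`. -/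
lemma Rooted.exists_separation [Finite V] {a : V} {q x : Fin 3 → V} {Q : Fin 3 → Set V} {D : Set V}
    (h : Rooted G a q x Q D) : ∃ N A C, Separation G x D N A C := by
  obtain ⟨M, A, hM, hmax⟩ := h.exists_maximal_strips
  have hloc := fun {F f g i j u v} => h.strips_local hM hmax (F := F) (f := f) (g := g) (i := i)
    (j := j) (u := u) (v := v)
  let W : Set V := {v | v ∈ D ∧ ∀ m, v ∉ M m}
  let L : Fin 3 → Set V := fun i => {v | ∃ F g u, PS G F g v ∧ F ⊆ W ∧ u ∈ M i ∧ u ∉ A i ∧ G.Adj g u}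
  have hLW : ∀ i, L i ⊆ W := by
    rintro i v ⟨F, g, u, hF, hFW, -⟩
    exact hFW hF.right_mem
  have hxM : ∀ i, x i ∈ M i := by
    intro i
    obtain ⟨c, hc⟩ := hM.nonempty i
    obtain ⟨S, u, h1, h2, -⟩ := hM.rung i c (hM.sub i hc)
    exact h2 h1.left_mem
  have hxA : ∀ i j, i ≠ j → x i ∉ A i ∨ x j ∉ A j := by
    intro i j hij
    by_contra! hx
    exact h.x_not_adj i j ((hM.adj i j hij _ (hxM i) _ (hxM j)).2.2 hx)
  have hLadj : ∀ i, ∀ v ∈ L i, ∀ w ∈ W, G.Adj v w → w ∈ L i := by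
    rintro i v ⟨F, g, u, hF, hFW, hu, huA, hgu⟩ w hw e
    obtain ⟨R, hR, hR'⟩ := hF.trans (w := w) (T := {v, w})
      (.cons (.single w) (by simpa using e.ne) e (by simp))
    refine ⟨R, g, u, hR', fun p hp => ?_, hu, huA, hgu⟩
    rcases hR hp with h1 | rfl | rfl
    exacts [hFW h1, hFW hF.right_mem, hw]
  have hLM : ∀ i j, i ≠ j → ∀ v ∈ L i, ∀ w ∈ M j, ¬ G.Adj v w := by
    rintro i j hij v ⟨F, g, u, hF, hFW, hu, huA, hgu⟩ w hw e
    exact hloc hF (fun v hv => (hFW hv).1) (fun v hv => (hFW hv).2) hij hu huA hw hgu e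
  have hLL : ∀ i j, i ≠ j → ∀ v ∈ L i, v ∉ L j := by
    rintro i j hij v ⟨F, g, u, hF, hFW, hu, huA, hgu⟩ ⟨F', g', u', hF', hFW', hu', huA', hgu'⟩
    obtain ⟨R, hR, hR'⟩ := hF.trans hF'.symm
    have hRW : R ⊆ W := hR.trans (Set.union_subset hFW hFW')
    exact hloc hR' (fun v hv => (hRW hv).1) (fun v hv => (hRW hv).2) hij hu huA hu' hgu hgu'
  have hLA : ∀ i, ∀ v ∈ L i, v ∉ A i := fun i v hv hA => (hLW i hv).2 i (hM.sub i hA)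
  refine ⟨fun i => M i ∪ L i, A, {v | v ∈ W ∧ ∀ i, v ∉ L i}, ?_⟩
  constructor
  · rintro v hv
    by_cases hvM : ∃ m, v ∈ M m
    · obtain ⟨m, hm⟩ := hvM
      exact .inr ⟨m, .inl hm⟩
    · push Not at hvM
      rcases hv with hv | ⟨i, rfl⟩
      · by_cases hvL : ∃ m, v ∈ L m
        · obtain ⟨m, hm⟩ := hvL
          exact .inr ⟨m, .inr hm⟩
        · push Not at hvL
          exact .inl ⟨⟨hv, hvM⟩, hvL⟩
      · exact absurd (hxM i) (hvM i)
  · exact fun i => Set.union_subset (hM.subset i) fun v hv => .inl (hLW i hv).1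
  · exact fun i => .inl (hxM i)
  · exact fun i => (hM.sub i).trans Set.subset_union_left
  · rintro i v (hv | hv) hC
    exacts [hC.1.2 i hv, hC.2 i hv]
  · rintro i j hij u (hu | hu) v (hv | hv)
    · exact hM.adj i j hij u hu v hv
    · refine ⟨fun e => (hLW j hv).2 i (e ▸ hu), fun e => ?_, fun hA => absurd hA.2 (hLA j v hv)⟩
      exact absurd e.symm (hLM j i hij.symm v hv u hu)
    · refine ⟨fun e => (hLW i hu).2 j (e ▸ hv), fun e => ?_, fun hA => absurd hA.1 (hLA i u hu)⟩
      exact absurd e (hLM i j hij u hu v hv)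
    · refine ⟨fun e => hLL i j hij u hu (e ▸ hv), fun e => ?_, fun hA => absurd hA.1 (hLA i u hu)⟩
      exact absurd hv (hLL i j hij v (hLadj i u hu v (hLW j hv) e))
  · rintro i u (hu | hu) v ⟨hvW, hvL⟩ e
    · by_contra huA
      exact hvL i ⟨{v}, v, u, .single v, by simpa using hvW, hu, huA, e.symm⟩
    · exact absurd (hLadj i u hu v hvW e) (hvL i)

/-- A nonadjacent pair on each side would induce a `C₄`. -/
lemma C4FreeOddSignable.clique_or_clique (hG : C4FreeOddSignable G) {X Y : Set V}
    (hXY : Complete G X Y) : G.IsClique X ∨ G.IsClique Y := by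
  by_contra! h
  simp only [SimpleGraph.IsClique, Set.Pairwise, not_forall] at h
  obtain ⟨⟨u, hu, u', hu', hne, hadj⟩, w, hw, w', hw', hne', hadj'⟩ := h
  refine hG.c4_free ⟨⟨⟨![u, w, u', w'], ?_⟩, ?_⟩⟩
  · have e1 := (hXY u hu w hw).ne
    have e2 := (hXY u hu w' hw').ne
    have e3 := (hXY u' hu' w hw).ne
    have e4 := (hXY u' hu' w' hw').ne
    intro m n hmn
    fin_cases m <;> fin_cases n <;> simp_all
  · have e1 := hXY u hu w hw
    have e2 := hXY u hu w' hw'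
    have e3 := hXY u' hu' w hw
    have e4 := hXY u' hu' w' hw'
    have f1 := fun e => hadj (G.adj_symm e)
    have f2 := fun e => hadj' (G.adj_symm e)
    have key : ∀ m n : Fin 4, G.Adj (![u, w, u', w'] m) (![u, w, u', w'] n) ↔
        (SimpleGraph.cycleGraph 4).Adj m n := by
      intro m n
      fin_cases m <;> fin_cases n <;> first
        | exact iff_of_false G.irrefl (by decide)
        | exact iff_of_true e1 (by decide)
        | exact iff_of_true e2 (by decide)
        | exact iff_of_true e3 (by decide)
        | exact iff_of_true e4 (by decide)
        | exact iff_of_true e1.symm (by decide)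
        | exact iff_of_true e2.symm (by decide)
        | exact iff_of_true e3.symm (by decide)
        | exact iff_of_true e4.symm (by decide)
        | exact iff_of_false hadj (by decide)
        | exact iff_of_false hadj' (by decide)
        | exact iff_of_false f1 (by decide)
        | exact iff_of_false f2 (by decide)
    exact fun {m n} => key m n

/-! ### Attached components and last vertices on paths. -/

lemma mem_attached_iff {x : V} : v ∈ attached G S x ↔ ∃ u T, G.Adj x u ∧ T ⊆ S ∧ PS G T u v := by
  constructor
  · rintro ⟨C, ⟨u, hu, hxu⟩, w, hw, rfl⟩
    have : (G.induce S).Reachable u w := by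
      rw [← SimpleGraph.ConnectedComponent.eq]
      exact ((SimpleGraph.ConnectedComponent.mem_supp_iff _ _).1 hu).trans
        ((SimpleGraph.ConnectedComponent.mem_supp_iff _ _).1 hw).symm
    obtain ⟨T, hT, hT'⟩ := PS.of_preconnected this
    exact ⟨u, T, hxu, hT, hT'⟩
  · rintro ⟨u, T, hxu, hT, hT'⟩
    refine ⟨(G.induce S).connectedComponentMk ⟨u, hT hT'.left_mem⟩, ⟨⟨u, hT hT'.left_mem⟩, rfl, hxu⟩,
      ⟨v, hT hT'.right_mem⟩, ?_, rfl⟩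
    rw [SimpleGraph.ConnectedComponent.mem_supp_iff, SimpleGraph.ConnectedComponent.eq]
    exact (hT'.reachable hT).symm

/-- A set that contains the neighbors of `x` in `S` and is closed under adjacency in `S`. -/
lemma attached_subset {x : V} {Y : Set V} (h₀ : ∀ u ∈ S, G.Adj x u → u ∈ Y)
    (h₁ : ∀ u ∈ S, u ∈ Y → ∀ v ∈ S, G.Adj u v → v ∈ Y) : attached G S x ⊆ Y := by
  intro v hv
  obtain ⟨u, T, hxu, hT, hP⟩ := mem_attached_iff.1 hv
  have hu := h₀ u (hT hP.left_mem) hxu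
  clear hxu
  induction hP with
  | single u => exact hu
  | @cons T u w v hP _ huw _ ih =>
    exact ih hv (fun p hp => hT (.inr hp)) (h₁ u (hT (.inl rfl)) hu w (hT (.inr hP.left_mem)) huw)

lemma exists_lastVertex {x y : V} (P : G.Walk x y) {A : Set V} (h : (verts P ∩ A).Nonempty) :
    ∃ v, IsLastVertex P A v := by
  classical
  obtain ⟨w, hw, hwA⟩ := h
  obtain ⟨n, rfl, hn⟩ := SimpleGraph.Walk.mem_support_iff_exists_getVert.1 hw
  refine ⟨_, Nat.findGreatest (fun m => P.getVert m ∈ A) P.length, Nat.findGreatest_le _, rfl,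
    Nat.findGreatest_spec (P := fun m => P.getVert m ∈ A) hn hwA, fun m hm hm' => ?_⟩
  exact Nat.findGreatest_is_greatest hm hm'

lemma IsLastVertex.unique {x y : V} {P : G.Walk x y} {A : Set V} (hv : IsLastVertex P A v)
    (hw : IsLastVertex P A w) : v = w := by
  obtain ⟨n, hn, rfl, hA, hmax⟩ := hv
  obtain ⟨m, hm, rfl, hA', hmax'⟩ := hw
  rcases lt_trichotomy n m with h | h | h
  · exact absurd hA' (hmax m h hm)
  · rw [h]
  · exact absurd hA (hmax' n h hn)

/-- A walk that leaves the set `Y` does so for the last time. -/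
lemma exists_last_exit {x y : V} (P : G.Walk x y) {Y : Set V} (hx : x ∈ Y) (hy : y ∉ Y) :
    ∃ n < P.length, P.getVert n ∈ Y ∧ ∀ m, n < m → m ≤ P.length → P.getVert m ∉ Y := by
  obtain ⟨v, n, hn, rfl, hv, hmax⟩ := exists_lastVertex P (A := Y) ⟨x, by simp [verts], hx⟩
  refine ⟨n, lt_of_le_of_ne hn ?_, hv, hmax⟩
  rintro rfl
  rw [SimpleGraph.Walk.getVert_length] at hv
  exact hy hv

lemma getVert_mem_verts {x y : V} (P : G.Walk x y) (n : ℕ) : P.getVert n ∈ verts P :=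
  P.getVert_mem_support n

/-- If the last neighbor of `q` on every path from `b` to `x j` is complete to `K`, then one of the
two outcomes holds. -/
lemma exists_separates_of_last {x : Fin 3 → V} {D K : Set V} {b q : V} {i j : Fin 3} (hKD : K ⊆ D)
    (hK : G.IsClique K) (hij : i ≠ j) (hbD : b ∈ D) (hxD : ∀ i, x i ∉ D)
    (hbx : ∀ i, ¬ G.Adj b (x i)) (hqj : ¬ G.Adj q (x j))
    (hq : (b ∈ K ∧ q = b) ∨ ∃ k, k ≠ i ∧ Complete G {x k} K ∧ q = x k)
    (hbi : b ∉ closedNbhd G (attached G (D \ K) (x i)))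
    (hlast : ∀ P : G.Walk b (x j), IsInducedPath P → verts P ⊆ D ∪ {x j} →
      (verts P ∩ G.neighborSet q).Nonempty ∧
        ∀ v, IsLastVertex P (verts P ∩ G.neighborSet q) v → Complete G {v} K) :
    ∃ K ⊆ D, G.IsClique K ∧ ∃ i j : Fin 3, i ≠ j ∧
      (SeparatesPair G D K x b i j ∨ WeaklySeparates G D K x b i j) := by
  let D' : Set V := {v | ∃ P : G.Walk b (x j), IsInducedPath P ∧ verts P ⊆ D ∪ {x j} ∧
    (verts P ∩ G.neighborSet q).Nonempty ∧ IsLastVertex P (verts P ∩ G.neighborSet q) v}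
  have hD'q : ∀ v ∈ D', G.Adj q v := by
    rintro v ⟨P, -, -, -, n, -, -, h, -⟩
    exact h.2
  have hD'D : D' ⊆ D := by
    rintro v ⟨P, -, hP, -, n, -, -, h, -⟩
    rcases hP h.1 with h1 | rfl
    exacts [h1, absurd h.2 hqj]
  have hD'K : Complete G D' K := by
    rintro v ⟨P, hP, hPD, -, hv⟩ w hw
    exact (hlast P hP hPD).2 v hv v rfl w hw
  by_cases hD' : G.IsClique D'
  -- The enlarged clique meets every path from `b` to `x j` in its last neighbor of `q`. Dropping
  -- `b` is harmless for `x i`: a path that reaches `b` would make `b` a neighbor of a vertex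
  -- attached to `x i` already in `D \ K`.
  · refine ⟨K \ {b} ∪ D', Set.union_subset (Set.sdiff_subset.trans hKD) hD'D, ?_, i, j, hij, .inl ?_⟩
    · rintro v (hv | hv) w (hw | hw) hne
      exacts [hK hv.1 hw.1 hne, (hD'K w hw v hv.1).symm, hD'K v hv w hw.1, hD' hv hw hne]
    · rintro ((hb | hb) | hb)
      · rcases hb with hb | hb
        · exact hb.2 rfl
        · have := hD'q b hb
          rcases hq with ⟨-, rfl⟩ | ⟨k, -, -, rfl⟩
          exacts [G.irrefl this, hbx k this.symm]
      · obtain ⟨u, T, hu, hT, hP⟩ := mem_attached_iff.1 hb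
        obtain ⟨w, T', hP', hbT, rfl, hw⟩ := hP.symm.exists_cons (by rintro rfl; exact hbx i hu.symm)
        refine hbi (.inr ⟨w, mem_attached_iff.2 ⟨u, T', hu, fun p hp => ?_, hP'.symm⟩,
          ((hw w hP'.left_mem).2 rfl).symm⟩)
        have hp' := hT (Set.mem_insert_of_mem _ hp)
        exact ⟨hp'.1, fun hpK => hp'.2 (.inl ⟨hpK, by rintro rfl; exact hbT hp⟩)⟩
      · obtain ⟨u, T, hu, hT, hP⟩ := mem_attached_iff.1 hb
        obtain ⟨R, hR, hR'⟩ := hP.symm.trans (w := x j) (T := {u, x j})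
          (.cons (.single _) (by simpa using hu.ne') hu.symm (by simp))
        have hRT : ∀ p ∈ R, p ∈ T ∨ p = x j := by
          intro p hp
          rcases hR hp with h | rfl | rfl
          exacts [.inl h, .inl hP.left_mem, .inr rfl]
        obtain ⟨p, hp, hpR⟩ := hR'.exists_walk
        have hpD : verts p ⊆ D ∪ {x j} := by
          intro y hy
          rcases hRT y (hpR ▸ hy) with h | h
          exacts [.inl (hT h).1, .inr h]
        have hne := (hlast p hp hpD).1
        obtain ⟨v, hv⟩ := exists_lastVertex p (A := verts p ∩ G.neighborSet q)
          (by rwa [← Set.inter_assoc, Set.inter_self])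
        have hvD' : v ∈ D' := ⟨p, hp, hpD, hne, hv⟩
        obtain ⟨n, -, -, hvA, -⟩ := hv
        rcases hRT v (hpR ▸ hvA.1) with h | rfl
        exacts [(hT h).2 (.inr hvD'), hxD j (hD'D hvD')]
  · refine ⟨K, hKD, hK, i, j, hij, .inr ⟨hbi, D', hD', hD'K, q, ?_, fun v hv => hv, hlast⟩⟩
    refine hq.imp id fun ⟨k, hk, hk', e⟩ => ⟨k, hk, ?_, e⟩
    rintro y rfl w (hw | hw)
    exacts [hk' _ rfl w hw, e ▸ hD'q w hw]

/-! ### Clique cutsets from a separation. -/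

namespace Separation

variable {x : Fin 3 → V} {D K C : Set V} {N A : Fin 3 → Set V} {b q : V} {i j k : Fin 3}

lemma complete (h : Separation G x D N A C) (hij : i ≠ j) : Complete G (A i) (A j) :=
  fun u hu v hv => (h.adj i j hij u (h.sub i hu) v (h.sub j hv)).2.2 ⟨hu, hv⟩

lemma not_mem (h : Separation G x D N A C) (hij : i ≠ j) (hu : u ∈ N i) : u ∉ N j :=
  fun hu' => (h.adj i j hij u hu u hu').1 rfl

lemma mem_of_adj (h : Separation G x D N A C) (hu : u ∈ N k) (huA : u ∉ A k)
    (hv : v ∈ D ∨ ∃ i, v = x i) (e : G.Adj u v) : v ∈ N k := by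
  rcases h.cover v hv with hv | ⟨m, hv⟩
  · exact absurd (h.adj_C k u hu v hv e) huA
  · by_cases hm : k = m
    · exact hm ▸ hv
    · exact absurd ((h.adj k m hm u hu v hv).2.1 e).1 huA

lemma attached_subset_diff (h : Separation G x D N A C) (hA : A k ⊆ K) (hx : x k ∉ A k) :
    attached G (D \ K) (x k) ⊆ N k \ A k := by
  refine attached_subset ?_ ?_
  · exact fun u hu e => ⟨h.mem_of_adj (h.mem k) hx (.inl hu.1) e, fun h' => hu.2 (hA h')⟩
  · exact fun u _ hu v hv e => ⟨h.mem_of_adj hu.1 hu.2 (.inl hv.1) e, fun h' => hv.2 (hA h')⟩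

lemma not_mem_closedNbhd (h : Separation G x D N A C) (hA : A k ⊆ K) (hx : x k ∉ A k)
    (hbD : b ∈ D) (hb : b ∉ N k) : b ∉ closedNbhd G (attached G (D \ K) (x k)) := by
  rintro (h' | ⟨u, hu, e⟩)
  · exact hb (h.attached_subset_diff hA hx h').1
  · have hu' := h.attached_subset_diff hA hx hu
    exact hb (h.mem_of_adj hu'.1 hu'.2 (.inl hbD) e)

/-- Every edge leaving `N i` starts in `A i`, and `D \ K` misses `A i` because the only possible
exception `x i` is not in `D`. A component seen from `x j` can therefore never enter `N i`. -/
lemma attached_subset_compl (h : Separation G x D N A C) (hxD : ∀ i, x i ∉ D)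
    (hA : A i \ {x i} ⊆ K) (hij : i ≠ j) : attached G (D \ K) (x j) ⊆ (N i)ᶜ := by
  have key : ∀ v ∈ D \ K, v ∉ A i := fun v hv hvA =>
    hv.2 (hA ⟨hvA, by rintro rfl; exact hxD i hv.1⟩)
  refine attached_subset (fun u hu e huN => ?_) fun u hu huN v hv e hvN => ?_
  · exact key u hu ((h.adj i j hij u huN _ (h.mem j)).2.1 e.symm).1
  · rcases h.cover u (.inl hu.1) with hC | ⟨m, hm⟩
    · exact key v hv (h.adj_C i v hvN u hC e.symm)
    · have him : i ≠ m := by rintro rfl; exact huN hm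
      exact key v hv ((h.adj i m him v hvN u hm).2.1 e.symm).1

/-- The path enters `N k \ A k` for the last time from a vertex of `A k`. This vertex is adjacent to
`q`, and nothing after it is. -/
lemma last_mem (h : Separation G x D N A C) (P : G.Walk b (x k)) (hP : verts P ⊆ D ∪ {x k})
    (hb : b ∉ N k \ A k) (hx : x k ∉ A k) (hjk : j ≠ k) (hq : q ∈ A j) :
    (verts P ∩ G.neighborSet q).Nonempty ∧
      ∀ v, IsLastVertex P (verts P ∩ G.neighborSet q) v → v ∈ A k := by
  obtain ⟨n, hn, hnY, hmax⟩ := exists_last_exit P (Y := (N k \ A k)ᶜ) hb (by simp [h.mem k, hx])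
  simp only [Set.mem_compl_iff, not_not] at hnY hmax
  have hn' := hmax (n + 1) n.lt_succ_self hn
  have hw : P.getVert n ∈ A k := by
    by_contra hA
    refine hnY ⟨h.mem_of_adj hn'.1 hn'.2 ?_ (P.adj_getVert_succ hn).symm, hA⟩
    exact (hP (getVert_mem_verts P n)).imp id fun e => ⟨k, e⟩
  have hw' : P.getVert n ∈ verts P ∩ G.neighborSet q :=
    ⟨getVert_mem_verts P n, h.complete hjk q hq _ hw⟩
  refine ⟨⟨_, hw'⟩, fun v hv => ?_⟩
  have : IsLastVertex P (verts P ∩ G.neighborSet q) (P.getVert n) := by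
    refine ⟨n, hn.le, rfl, hw', fun m hm hm' hmem => ?_⟩
    have := hmax m hm hm'
    exact this.2 ((h.adj j k hjk q (h.sub j hq) _ this.1).2.1 hmem.2).2
  exact hv.unique this ▸ hw

lemma isClique_union (h : Separation G x D N A C) (hij : i ≠ j) (hi : G.IsClique (A i))
    (hj : G.IsClique (A j)) : G.IsClique (A i ∪ A j) := by
  rintro u (hu | hu) v (hv | hv) hne
  exacts [hi hu hv hne, h.complete hij u hu v hv, h.complete hij.symm u hu v hv, hj hu hv hne]

/-- The case in which two of the sets `A i` are cliques and one of them contains its root. -/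
lemma exists_separates_aux_apex (h : Separation G x D N A C) (hxD : ∀ i, x i ∉ D)
    (hxx : ∀ i j, ¬ G.Adj (x i) (x j)) (hbD : b ∈ D) (hbx : ∀ i, ¬ G.Adj b (x i)) (hij : i ≠ j)
    (hik : i ≠ k) (hjk : j ≠ k) (hj : G.IsClique (A j)) (hk : G.IsClique (A k)) (hxj : x j ∈ A j)
    (hb : b ∈ N i \ A i ∨ b ∈ C) :
    ∃ K ⊆ D, G.IsClique K ∧ ∃ i j : Fin 3, i ≠ j ∧
      (SeparatesPair G D K x b i j ∨ WeaklySeparates G D K x b i j) := by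
  have hxk : x k ∉ A k := fun h' => hxx j k (h.complete hjk _ hxj _ h')
  have hxi : x i ∉ A i := fun h' => hxx j i (h.complete hij.symm _ hxj _ h')
  have hbN : ∀ m, m ≠ i → b ∉ N m := by
    rintro m hm hbm
    rcases hb with hb | hb
    exacts [h.not_mem hm hbm hb.1, h.disj m b hbm hb]
  have hKD : (A j ∪ A k) \ {x j} ⊆ D := by
    rintro v ⟨hv | hv, hvj⟩
    · exact (h.subset j (h.sub j hv)).resolve_right hvj
    · exact (h.subset k (h.sub k hv)).resolve_right (by rintro rfl; exact hxk hv)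
  have hK : G.IsClique ((A j ∪ A k) \ {x j}) := (h.isClique_union hjk hj hk).subset Set.sdiff_subset
  have hAK : A k ⊆ (A j ∪ A k) \ {x j} :=
    fun v hv => ⟨.inr hv, by rintro rfl; exact h.not_mem hjk (h.mem j) (h.sub k hv)⟩
  have hbk := h.not_mem_closedNbhd hAK hxk hbD (hbN k hik.symm)
  have hq : Complete G {x j} ((A j ∪ A k) \ {x j}) := by
    rintro _ rfl v ⟨hv | hv, hne⟩
    exacts [hj hxj hv (Ne.symm hne), h.complete hjk _ hxj v hv]
  have hiK : ∀ v ∈ A i, Complete G {v} ((A j ∪ A k) \ {x j}) := by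
    rintro v hv _ rfl w ⟨hw | hw, -⟩
    exacts [h.complete hij _ hv w hw, h.complete hik _ hv w hw]
  rcases hb with hb | hb
  -- Every path from `b` to `x j` must leave `N i \ A i` through `A i`, which is complete to `x j`.
  -- As the path is induced, this exit vertex is the only neighbor of `x j` on it.
  · refine exists_separates_of_last (i := k) (j := j) (q := x j) hKD hK hjk.symm hbD hxD hbx G.irrefl
      (.inr ⟨j, hjk, hq, rfl⟩) hbk fun P hP hPD => ?_
    obtain ⟨n, hn, hnY, hmax⟩ := exists_last_exit P (Y := N i \ A i) hb
      fun h' => h.not_mem hij.symm (h.mem j) h'.1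
    have hw : P.getVert (n + 1) ∈ A i := by
      by_contra hA
      refine hmax (n + 1) n.lt_succ_self hn ⟨h.mem_of_adj hnY.1 hnY.2 ?_ (P.adj_getVert_succ hn), hA⟩
      exact (hPD (getVert_mem_verts P (n + 1))).imp id fun e => ⟨j, e⟩
    have hwj := h.complete hij.symm _ hxj _ hw
    have hmem := getVert_mem_verts P (n + 1)
    refine ⟨⟨_, hmem, hwj⟩, fun v hv => ?_⟩
    obtain ⟨-, -, -, hvA, -⟩ := hv
    obtain ⟨y, -, -, hy⟩ := (PS.of_isInducedPath hP).symm.exists_adj (by rintro rfl; exact hxD j hbD)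
    rw [hy v hvA.1 hvA.2, ← hy _ hmem hwj]
    exact hiK _ hw
  -- For `b ∈ C` the target is `x i` instead, and the last neighbor of `x j` is where the path
  -- finally passes `A i`.
  · refine exists_separates_of_last (i := k) (j := i) (q := x j) hKD hK hik.symm hbD hxD hbx
      (hxx j i) (.inr ⟨j, hjk, hq, rfl⟩) hbk fun P hP hPD => ?_
    have := h.last_mem P hPD (fun h' => h.disj i b h'.1 hb) hxi hij.symm hxj
    exact ⟨this.1, fun v hv => hiK v (this.2 v hv)⟩

/-- If neither clique contains its root, their union lies in `D` and cuts `b` off from both `x j`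
and `x k`. -/
lemma exists_separates_aux (h : Separation G x D N A C) (hxD : ∀ i, x i ∉ D)
    (hxx : ∀ i j, ¬ G.Adj (x i) (x j)) (hbD : b ∈ D) (hbx : ∀ i, ¬ G.Adj b (x i)) (hij : i ≠ j)
    (hik : i ≠ k) (hjk : j ≠ k) (hj : G.IsClique (A j)) (hk : G.IsClique (A k))
    (hb : b ∈ N i \ A i ∨ b ∈ C) :
    ∃ K ⊆ D, G.IsClique K ∧ ∃ i j : Fin 3, i ≠ j ∧
      (SeparatesPair G D K x b i j ∨ WeaklySeparates G D K x b i j) := by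
  by_cases hxj : x j ∈ A j
  · exact h.exists_separates_aux_apex hxD hxx hbD hbx hij hik hjk hj hk hxj hb
  by_cases hxk : x k ∈ A k
  · exact h.exists_separates_aux_apex hxD hxx hbD hbx hik hij hjk.symm hk hj hxk hb
  have hbN : ∀ m, m ≠ i → b ∉ N m := by
    rintro m hm hbm
    rcases hb with hb | hb
    exacts [h.not_mem hm hbm hb.1, h.disj m b hbm hb]
  have hAD : ∀ m, x m ∉ A m → A m ⊆ D := fun m hm v hv =>
    (h.subset m (h.sub m hv)).resolve_right (by rintro rfl; exact hm hv)
  refine ⟨A j ∪ A k, Set.union_subset (hAD j hxj) (hAD k hxk), h.isClique_union hjk hj hk, j, k, hjk,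
    .inl ?_⟩
  rintro (((hb' | hb') | hb') | hb')
  · exact hbN j hij.symm (h.sub j hb')
  · exact hbN k hik.symm (h.sub k hb')
  · exact hbN j hij.symm (h.attached_subset_diff Set.subset_union_left hxj hb').1
  · exact hbN k hik.symm (h.attached_subset_diff Set.subset_union_right hxk hb').1

/-- Here `b` plays the role of `q` and joins the cutset, `K = {b} ∪ A j`. As `b` is complete to `A
j` and `A k` but misses the roots, these two sets do not contain their roots. -/
lemma exists_separates_of_mem (h : Separation G x D N A C) (hxD : ∀ i, x i ∉ D)
    (hbD : b ∈ D) (hbx : ∀ i, ¬ G.Adj b (x i)) (hij : i ≠ j)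
    (hik : i ≠ k) (hjk : j ≠ k) (hj : G.IsClique (A j)) (hb : b ∈ A i) :
    ∃ K ⊆ D, G.IsClique K ∧ ∃ i j : Fin 3, i ≠ j ∧
      (SeparatesPair G D K x b i j ∨ WeaklySeparates G D K x b i j) := by
  have hx : ∀ m, i ≠ m → x m ∉ A m := fun m hm h' => hbx m (h.complete hm _ hb _ h')
  have hbj := h.complete hij b hb
  refine exists_separates_of_last (i := j) (j := k) (q := b) (K := insert b (A j)) ?_
    (hj.insert fun v hv _ => hbj v hv) hjk hbD hxD hbx (hbx k) (.inl ⟨.inl rfl, rfl⟩)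
    (h.not_mem_closedNbhd (Set.subset_insert _ _) (hx j hij) hbD (h.not_mem hij (h.sub i hb)))
    fun P hP hPD => ?_
  · rintro v (rfl | hv)
    · exact hbD
    · exact (h.subset j (h.sub j hv)).resolve_right (by rintro rfl; exact hx j hij hv)
  · have := h.last_mem P hPD (fun h' => h.not_mem hik (h.sub i hb) h'.1) (hx k hik) hik hb
    refine ⟨this.1, ?_⟩
    rintro v hv _ rfl w (rfl | hw)
    · exact h.complete hik.symm _ (this.2 _ hv) _ hb
    · exact h.complete hjk.symm _ (this.2 _ hv) w hw

/-- If `b ∈ N i \ A i` and `A i` is a clique, then `A i` without its root already cuts `b` off from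
the two other roots. In all other cases the cutset uses cliques among the other end sets, and at
most one `A i` is not a clique. -/
theorem exists_separates (h : Separation G x D N A C) (hG : C4FreeOddSignable G)
    (hxD : ∀ i, x i ∉ D) (hxx : ∀ i j, ¬ G.Adj (x i) (x j)) (hbD : b ∈ D)
    (hbx : ∀ i, ¬ G.Adj b (x i)) :
    ∃ K ⊆ D, G.IsClique K ∧ ∃ i j : Fin 3, i ≠ j ∧
      (SeparatesPair G D K x b i j ∨ WeaklySeparates G D K x b i j) := by
  have hcl : ∀ i j, i ≠ j → G.IsClique (A i) ∨ G.IsClique (A j) :=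
    fun i j hij => hG.clique_or_clique (h.complete hij)
  rcases h.cover b (.inl hbD) with hb | ⟨i, hb⟩
  · obtain ⟨i, j, k, hij, hik, hjk, hj, hk⟩ : ∃ i j k : Fin 3, i ≠ j ∧ i ≠ k ∧ j ≠ k ∧
        G.IsClique (A j) ∧ G.IsClique (A k) := by
      by_cases h0 : G.IsClique (A 0)
      · rcases hcl 1 2 (by decide) with h1 | h2
        · exact ⟨2, 0, 1, by decide, by decide, by decide, h0, h1⟩
        · exact ⟨1, 0, 2, by decide, by decide, by decide, h0, h2⟩
      · exact ⟨0, 1, 2, by decide, by decide, by decide, (hcl 0 1 (by decide)).resolve_left h0,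
          (hcl 0 2 (by decide)).resolve_left h0⟩
    exact h.exists_separates_aux hxD hxx hbD hbx hij hik hjk hj hk (.inr hb)
  · obtain ⟨j, k, hij, hik, hjk⟩ : ∃ j k : Fin 3, i ≠ j ∧ i ≠ k ∧ j ≠ k := by
      clear hb
      revert i
      decide
    by_cases hbA : b ∈ A i
    · rcases hcl j k hjk with hj | hk
      · exact h.exists_separates_of_mem hxD hbD hbx hij hik hjk hj hbA
      · exact h.exists_separates_of_mem hxD hbD hbx hik hij hjk.symm hk hbA
    by_cases hi : G.IsClique (A i)
    · refine ⟨A i \ {x i}, fun v hv => (h.subset i (h.sub i hv.1)).resolve_right hv.2,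
        hi.subset Set.sdiff_subset, j, k, hjk, .inl ?_⟩
      rintro ((hb' | hb') | hb')
      · exact hbA hb'.1
      · exact h.attached_subset_compl hxD subset_rfl hij hb' hb
      · exact h.attached_subset_compl hxD subset_rfl hik hb' hb
    · exact h.exists_separates_aux hxD hxx hbD hbx hij hik hjk ((hcl i j hij).resolve_left hi)
        ((hcl i k hik).resolve_left hi) (.inl ⟨hb, hbA⟩)

end Separation

/-! ### From the pyramid to the rooted configuration. -/

namespace IsHole

open Fin.CommRing in
lemma eq_of_adj (h : IsHole G S) (hz : z ∈ S) {y₁ y₂ y₃ : V} (h₁ : y₁ ∈ S) (h₂ : y₂ ∈ S)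
    (h₃ : y₃ ∈ S) (e₁ : G.Adj z y₁) (e₂ : G.Adj z y₂) (e₃ : G.Adj z y₃) :
    y₁ = y₂ ∨ y₁ = y₃ ∨ y₂ = y₃ := by
  obtain ⟨n, hn, ⟨f⟩⟩ := h
  obtain ⟨n, rfl⟩ := Nat.exists_eq_add_of_le' hn
  have key : ∀ y (hy : y ∈ S), G.Adj z y →
      f.symm ⟨y, hy⟩ = f.symm ⟨z, hz⟩ - 1 ∨ f.symm ⟨y, hy⟩ = f.symm ⟨z, hz⟩ + 1 := by
    intro y hy e
    have : (SimpleGraph.cycleGraph (n + 4)).Adj (f.symm ⟨z, hz⟩) (f.symm ⟨y, hy⟩) :=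
      f.symm.map_adj_iff.2 e
    rw [SimpleGraph.cycleGraph_adj] at this
    rcases this with h | h
    · exact .inl (by rw [← h]; ring)
    · exact .inr (by rw [← h]; ring)
  have inj : ∀ y y' (hy : y ∈ S) (hy' : y' ∈ S), f.symm ⟨y, hy⟩ = f.symm ⟨y', hy'⟩ → y = y' :=
    fun y y' hy hy' e => congrArg Subtype.val (f.symm.injective e)
  rcases key y₁ h₁ e₁ with a₁ | a₁ <;> rcases key y₂ h₂ e₂ with a₂ | a₂ <;>
    rcases key y₃ h₃ e₃ with a₃ | a₃
  all_goals first
    | exact .inl (inj _ _ h₁ h₂ (a₁.trans a₂.symm))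
    | exact .inr (.inl (inj _ _ h₁ h₃ (a₁.trans a₃.symm)))
    | exact .inr (.inr (inj _ _ h₂ h₃ (a₂.trans a₃.symm)))

-- Going around a triangle in the cyclic group of order `n + 4`, three steps `±1` sum to zero. This
-- forces `3 = 0` or `1 = 0`, neither of which holds as `n + 4 ≥ 4`.
open Fin.CommRing in
lemma not_triangle (h : IsHole G S) {y₁ y₂ y₃ : V} (h₁ : y₁ ∈ S) (h₂ : y₂ ∈ S)
    (h₃ : y₃ ∈ S) (e₁ : G.Adj y₁ y₂) (e₂ : G.Adj y₂ y₃) (e₃ : G.Adj y₃ y₁) : False := by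
  obtain ⟨n, hn, ⟨f⟩⟩ := h
  obtain ⟨n, rfl⟩ := Nat.exists_eq_add_of_le' hn
  have key : ∀ y y' (hy : y ∈ S) (hy' : y' ∈ S), G.Adj y y' →
      f.symm ⟨y, hy⟩ - f.symm ⟨y', hy'⟩ = 1 ∨ f.symm ⟨y', hy'⟩ - f.symm ⟨y, hy⟩ = 1 := by
    intro y y' hy hy' e
    have : (SimpleGraph.cycleGraph (n + 4)).Adj (f.symm ⟨y, hy⟩) (f.symm ⟨y', hy'⟩) :=
      f.symm.map_adj_iff.2 e
    rwa [SimpleGraph.cycleGraph_adj] at this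
  have one : (1 : Fin (n + 4)) ≠ 0 := by simp
  have three : (3 : Fin (n + 4)) ≠ 0 := by
    intro e
    have := congrArg Fin.val e
    change 3 % (n + 4) = 0 % (n + 4) at this
    rw [Nat.mod_eq_of_lt (by lia), Nat.zero_mod] at this
    lia
  have k₁ := key _ _ h₁ h₂ e₁
  have k₂ := key _ _ h₂ h₃ e₂
  have k₃ := key _ _ h₃ h₁ e₃
  generalize f.symm ⟨y₁, h₁⟩ = c₁ at *
  generalize f.symm ⟨y₂, h₂⟩ = c₂ at *
  generalize f.symm ⟨y₃, h₃⟩ = c₃ at *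
  rcases k₁ with k₁ | k₁ <;> rcases k₂ with k₂ | k₂ <;> rcases k₃ with k₃ | k₃
  · exact three (by linear_combination -k₁ - k₂ - k₃)
  · exact one (by linear_combination -k₁ - k₂ + k₃)
  · exact one (by linear_combination -k₁ + k₂ - k₃)
  · exact one (by linear_combination k₁ - k₂ - k₃)
  · exact one (by linear_combination k₁ - k₂ - k₃)
  · exact one (by linear_combination -k₁ + k₂ - k₃)
  · exact one (by linear_combination -k₁ - k₂ + k₃)
  · exact three (by linear_combination -k₁ - k₂ - k₃)

end IsHole

lemma PS.exists_two_adj (h : PS G S u v) (hz : z ∈ S) (hzu : z ≠ u) (hzv : z ≠ v) :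
    ∃ y ∈ S, ∃ y' ∈ S, y ≠ y' ∧ G.Adj z y ∧ G.Adj z y' := by
  obtain ⟨S₁, h₁, -, h'⟩ := h.initial hz
  obtain ⟨w, S₂, h₂, rfl, hl⟩ := h' hzv
  obtain ⟨y, hy, hzy, -⟩ := h₁.symm.exists_adj hzu
  exact ⟨y, .inl hy, w, .inr h₂.left_mem, (hl y hy w h₂.left_mem).1, hzy,
    (hl z h₁.right_mem w h₂.left_mem).2.2 ⟨rfl, rfl⟩⟩

namespace IsPyramid

variable {a : V} {b : Fin 3 → V} {P : ∀ i, G.Walk a (b i)} {i j : Fin 3}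

lemma base_not_mem (h : IsPyramid G a b P) (hij : i ≠ j) : b j ∉ verts (P i) := by
  intro hj
  obtain ⟨k, hik, hjk⟩ : ∃ k, i ≠ k ∧ j ≠ k := by
    exact (show ∀ i j : Fin 3, ∃ k, i ≠ k ∧ j ≠ k by decide) i j
  exact (h.hole i k hik).not_triangle (.inl (P i).end_mem_support) (.inl hj)
    (.inr (P k).end_mem_support) (h.base i j hij) (h.base j k hjk) (h.base k i hik.symm)

/-- Let `z` be the first vertex of `P i` met from `b j` along `P j`. If `z` were not the apex, it
would have two neighbors on `P i` and a third, its predecessor on `P j`, all in one hole. -/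
lemma eq_apex_of_mem (h : IsPyramid G a b P) (hij : i ≠ j) (hvi : v ∈ verts (P i))
    (hvj : v ∈ verts (P j)) : v = a := by
  have hPi := PS.of_isInducedPath (h.path i)
  have hPj := PS.of_isInducedPath (h.path j)
  obtain ⟨z, S, hS, hSP, hz, -⟩ := hPj.symm.first (A := verts (P i)) ⟨v, hvj, hvi⟩
  have hzi : z ∈ verts (P i) := (hz z hS.right_mem).2 rfl
  have hzb : z ≠ b j := by
    rintro rfl
    exact h.base_not_mem hij hzi
  by_cases hza : z = a
  · subst hza
    obtain rfl := hS.eq_of_subset hPj.symm hSP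
    exact (hz v hvj).1 hvi
  · exfalso
    have hzbi : z ≠ b i := by
      rintro rfl
      exact h.base_not_mem hij.symm (hSP hS.right_mem)
    obtain ⟨y, hy, y', hy', hne, e, e'⟩ := hPi.exists_two_adj hzi hza hzbi
    obtain ⟨w, hw, ew, -⟩ := hS.symm.exists_adj hzb
    have hwi : w ∉ verts (P i) := fun h' => ew.ne ((hz w hw).1 h').symm
    rcases (h.hole i j hij).eq_of_adj (.inl hzi) (.inl hy) (.inl hy') (.inr (hSP hw)) e e' ew with
      h' | h' | h'
    exacts [hne h', hwi (h' ▸ hy), hwi (h' ▸ hy')]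

lemma eq_base_of_adj (h : IsPyramid G a b P) (hij : i ≠ j) (hu : u ∈ verts (P i)) (hua : u ≠ a)
    (hv : v ∈ verts (P j)) (hva : v ≠ a) (e : G.Adj u v) : u = b i := by
  by_contra hub
  have hvi : v ∉ verts (P i) := fun h' => hva (h.eq_apex_of_mem hij h' hv)
  obtain ⟨y, hy, y', hy', hne, e₁, e₂⟩ :=
    (PS.of_isInducedPath (h.path i)).exists_two_adj hu hua hub
  rcases (h.hole i j hij).eq_of_adj (.inl hu) (.inl hy) (.inl hy') (.inr hv) e₁ e₂ e with
    h' | h' | h'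
  exacts [hne h', hvi (h' ▸ hy), hvi (h' ▸ hy')]

lemma link (h : IsPyramid G a b P) (hij : i ≠ j) (hS : S ⊆ verts (P i)) (hSa : a ∉ S)
    (hT : T ⊆ verts (P j)) (hTa : a ∉ T) : Link G S T (b i) (b j) := by
  intro u hu v hv
  have hua : u ≠ a := by rintro rfl; exact hSa hu
  have hva : v ≠ a := by rintro rfl; exact hTa hv
  refine ⟨fun e => hua (h.eq_apex_of_mem hij (hS hu) (hT (e ▸ hv))), fun e =>
    ⟨h.eq_base_of_adj hij (hS hu) hua (hT hv) hva e,
      h.eq_base_of_adj hij.symm (hT hv) hva (hS hu) hua e.symm⟩, ?_⟩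
  rintro ⟨rfl, rfl⟩
  exact h.base i j hij

end IsPyramid

lemma IsInducedPath.of_append {p : G.Walk u v} {q : G.Walk v w} (h : IsInducedPath (p.append q)) :
    IsInducedPath p ∧ IsInducedPath q ∧ ∀ y ∈ p.support, y ∈ q.support → y = v := by
  have hinter : ∀ y ∈ p.support, y ∈ q.support → y = v := by
    intro y hp hq
    by_contra hne
    have := h.isPath.support_nodup
    rw [SimpleGraph.Walk.support_append, List.nodup_append] at this
    rw [SimpleGraph.Walk.mem_support_iff] at hq
    exact this.2.2 y hp y (hq.resolve_left hne) rfl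
  have hc := SimpleGraph.Walk.isChordless_iff_forall_mem_edges.1 h.chordless
  simp only [SimpleGraph.Walk.mem_support_append_iff, SimpleGraph.Walk.edges_append,
    List.mem_append] at hc
  refine ⟨⟨h.isPath.of_append_left, ?_⟩, ⟨h.isPath.of_append_right, ?_⟩, hinter⟩
  · refine SimpleGraph.Walk.isChordless_iff_forall_mem_edges.2 fun y y' hy hy' e => ?_
    refine (hc (.inl hy) (.inl hy') e).resolve_right fun h' => e.ne ?_
    rw [hinter y hy (q.fst_mem_support_of_mem_edges h'),
      hinter y' hy' (q.snd_mem_support_of_mem_edges h')]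
  · refine SimpleGraph.Walk.isChordless_iff_forall_mem_edges.2 fun y y' hy hy' e => ?_
    refine (hc (.inr hy) (.inr hy') e).resolve_left fun h' => e.ne ?_
    rw [hinter y (p.fst_mem_support_of_mem_edges h') hy,
      hinter y' (p.snd_mem_support_of_mem_edges h') hy']

/-- An initial subpath of an induced path, and the rest of that path. -/
lemma IsInducedPath.of_isSubwalk {a x b : V} {p : G.Walk a b} {q : G.Walk a x}
    (h : IsInducedPath p) (hq : q.IsSubwalk p) : PS G (verts q) a x ∧ verts q ⊆ verts p ∧
      ∃ B ⊆ verts p, PS G B x b ∧ ∀ y ∈ verts q, y ∈ B → y = x := by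
  have hsub : verts q ⊆ verts p := hq.support_subset
  obtain ⟨r, t, rfl⟩ := hq
  rw [← SimpleGraph.Walk.append_assoc] at h
  obtain rfl := (SimpleGraph.Walk.isPath_iff_nil.1 h.isPath.of_append_left).eq_nil
  rw [SimpleGraph.Walk.nil_append] at h
  obtain ⟨h₁, h₂, h₃⟩ := h.of_append
  refine ⟨PS.of_isInducedPath h₁, hsub, verts t, fun y hy => ?_, PS.of_isInducedPath h₂, h₃⟩
  exact (SimpleGraph.Walk.mem_support_append_iff _ _).2 (.inr hy)

/-- Each `P i` is cut at `x i`: the first part without the apex is the rooted path, the second is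
the rung. -/
lemma IsPyramid.exists_rooted [Finite V] {a : V} {base : Fin 3 → V} {P : ∀ i, G.Walk a (base i)}
    (hpyr : IsPyramid G a base P) (hG : C4FreeOddSignable G)
    (x : Fin 3 → V) (hxa : ∀ i, x i ≠ a)
    (Q : ∀ i, G.Walk a (x i)) (hQ : ∀ i, (Q i).IsSubwalk (P i))
    (hdeg : ∀ i, ∀ v ∈ interior (Q i), (G.neighborSet v).ncard = 2)
    (hNa : ∀ v, G.Adj a v → v ∈ ⋃ i, verts (P i))
    (hstable : ∀ i j, ¬ G.Adj (x i) (x j))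
    (hcross : ∀ v, ¬ IsCrossEdge G a v)
    (hhub : ∀ i, ¬ IsHub G (x i)) :
    ∃ q T, Rooted G a q x T (⋃ i, verts (Q i))ᶜ := by
  choose hQP hQsub B hBP hB hQB using fun i => (hpyr.path i).of_isSubwalk (hQ i)
  choose q T hT haT hQT hadj using fun i => (hQP i).exists_cons (hxa i).symm
  have hTP : ∀ i, T i ⊆ verts (P i) := fun i v hv => hQsub i (hQT i ▸ .inr hv)
  have haB : ∀ i, a ∉ B i := fun i h => hxa i (hQB i a (hQP i).left_mem h).symm
  have hba : ∀ i, base i ≠ a := fun i e => haB i (e ▸ (hB i).right_mem)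
  have hbT : ∀ i, base i ∈ T i → base i = x i :=
    fun i h => hQB i _ (hQT i ▸ .inr h) (hB i).right_mem
  have haq : ∀ i, G.Adj a (q i) := fun i => (hadj i _ (hT i).left_mem).2 rfl
  refine ⟨q, T, hG, hT, ?_, haT, ?_, ?_, ?_, hhub, hcross, B, base, hB, ?_, ?_⟩
  -- An edge between two rooted paths could only be a base edge. Then both base vertices would be
  -- roots, but the roots are stable.
  · intro i j hij u hu v hv
    have := hpyr.link hij (hTP i) (haT i) (hTP j) (haT j) u hu v hv
    refine ⟨this.1, fun e => ?_⟩
    obtain ⟨rfl, rfl⟩ := this.2.1 e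
    rw [hbT i hu, hbT j hv] at e
    exact hstable i j e
  · refine fun v => ⟨fun e => ?_, ?_⟩
    · obtain ⟨i, hi⟩ := Set.mem_iUnion.1 (hNa v e)
      obtain ⟨y, -, -, hy⟩ := (PS.of_isInducedPath (hpyr.path i)).exists_adj (hba i).symm
      exact ⟨i, (hy v hi e).trans (hy _ (hTP i (hT i).left_mem) (haq i)).symm⟩
    · rintro ⟨i, rfl⟩
      exact haq i
  · intro v
    simp only [hQT, Set.mem_compl_iff, Set.mem_iUnion, Set.mem_insert_iff, not_exists, not_or]
    exact ⟨fun h => ⟨(h 0).1, fun i => (h i).2⟩, fun h i => ⟨h.1, h.2 i⟩⟩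
  · intro i v hv hvx y hy e
    have hvQ : v ∈ verts (Q i) := hQT i ▸ .inr hv
    have hva : v ≠ a := by rintro rfl; exact haT i hv
    have h2 := hdeg i v ⟨hvQ, by simp [hva, hvx]⟩
    obtain ⟨y₁, h₁, y₂, h₂, hne, e₁, e₂⟩ := (hQP i).exists_two_adj hvQ hva hvx
    have hyQ : y ∉ verts (Q i) := fun h => hy (Set.mem_iUnion.2 ⟨i, h⟩)
    -- A neighbor in `D` would be a third neighbor of an interior vertex of `Q i`, which has degree
    -- two.
    have h3 : ({y, y₁, y₂} : Set V).ncard = 3 :=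
      Set.ncard_eq_three.2 ⟨y, y₁, y₂, by rintro rfl; exact hyQ h₁, by rintro rfl; exact hyQ h₂,
        hne, rfl⟩
    have hle : ({y, y₁, y₂} : Set V) ⊆ G.neighborSet v := by
      rintro _ (rfl | rfl | rfl)
      exacts [e, e₁, e₂]
    have := Set.ncard_le_ncard hle (Set.toFinite _)
    lia
  · intro i v hv
    by_cases hvx : v = x i
    · exact .inr hvx
    · refine .inl fun h => ?_
      obtain ⟨m, hm⟩ := Set.mem_iUnion.1 h
      by_cases him : i = m
      · subst him
        exact hvx (hQB i v hm hv)
      · exact haB i (hpyr.eq_apex_of_mem him (hBP i hv) (hQsub m hm) ▸ hv)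
  · exact fun i j hij => hpyr.link hij (hBP i) (haB i) (hBP j) (haB j)

end EvenHole

theorem mainTheorem8 {V : Type*} [Finite V] (G : SimpleGraph V)
    (hG : EvenHole.C4FreeOddSignable G)
    (a : V) (base : Fin 3 → V) (P : ∀ i, G.Walk a (base i))
    (hpyr : EvenHole.IsPyramid G a base P)
    (x : Fin 3 → V) (hxa : ∀ i, x i ≠ a)
    (Q : ∀ i, G.Walk a (x i)) (hQ : ∀ i, (Q i).IsSubwalk (P i))
    (hdeg : ∀ i, ∀ v ∈ EvenHole.interior (Q i), (G.neighborSet v).ncard = 2)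
    (b : V) (hbQ : b ∉ ⋃ i, EvenHole.verts (Q i))
    (hNa : ∀ v, G.Adj a v → v ∈ ⋃ i, EvenHole.verts (P i))
    (hstable : ∀ i j, ¬ G.Adj (x i) (x j))
    (hbx : ∀ i, ¬ G.Adj b (x i))
    (hcross : ∀ v, ¬ EvenHole.IsCrossEdge G a v)
    (hhub : ∀ i, ¬ EvenHole.IsHub G (x i)) :
    ∃ K : Set V, K ⊆ (⋃ i, EvenHole.verts (Q i))ᶜ ∧ G.IsClique K ∧
      ∃ i j : Fin 3, i ≠ j ∧
        (EvenHole.SeparatesPair G (⋃ i, EvenHole.verts (Q i))ᶜ K x b i j ∨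
          EvenHole.WeaklySeparates G (⋃ i, EvenHole.verts (Q i))ᶜ K x b i j) := by
  obtain ⟨q, T, h⟩ := hpyr.exists_rooted hG x hxa Q hQ hdeg hNa hstable hcross hhub
  obtain ⟨N, A, C, hS⟩ := h.exists_separation
  exact hS.exists_separates hG h.x_not_mem_D hstable hbQ hbx
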